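/- Let $d\ge 1$, let $|\cdot|$ be the Euclidean norm and $B(x,r)=\{y\in\mathbb Z^d:|x-y|<r\}$. Let $C_{xy}=C_{yx}\in[0,\infty)$, for $x\ne y$ in $\mathbb Z^d$, be conductances, with $C_{xx}:=0$, and put $\nu_x=\sum_{y}C_{xy}$. Consider the following conditions. (A1) $\nu^-\le\nu_x\le\nu^+$ for all $x\in\mathbb Z^d$, where $\nu^-,\nu^+>0$ are constants. (A2) $M_0\ge1$ and $\delta>0$ are constants such that for all $x,y\in\mathbb Z^d$ with $|x-y|=1$ there are $N\ge2$ and $z_1,\dots,z_N\in B(x,M_0)$ with $z_1=x$, $z_N=y$ and $C_{z_iz_{i+1}}\ge\delta$ for $1\le i\le N-1$. (A3) $\varphi:\{1,2,\dots\}\to[0,\infty)$ is decreasing, $\sum_{i\ge1}i^{d+1}\varphi(i)<\infty$, $\varphi(2i)\le k\,\varphi(i)$ for all $i\ge1$ and some constant $k$, and $C_{xy}\le\varphi(\lfloor|x-y|\rfloor)$ for all $x\ne y$. Let $Y$ be the continuous time Markov chain on $\mathbb Z^d$ which stays at a site $z$ for an exponential time with parameter $\nu_z$ and then jumps to $y$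 with probability $C_{zy}/\nu_z$. Precisely, under $\mathbb P^x$ let $(X_n)_{n\ge0}$ be the discrete time Markov chain with $X_0=x$ and transition probabilities $C_{zy}/\nu_z$, let $U_k^z$ ($k\ge1$, $z\in\mathbb Z^d$) be exponential random variables with parameters $\nu_z$, independent of each other and of $(X_n)$, let $T_n=\sum_{k=1}^nU_k^{X_{k-1}}$, and let $Y_t=X_n$ for $T_n\le t<T_{n+1}$. For $A\subset\mathbb Z^d$ let $\tau_A=\inf\{t\ge0:Y_t\notin A\}$. Then, given $d,\nu^-,\nu^+,M_0,\delta,\varphi$, there are $c>0$ and $\theta\in(0,1)$, depending only on these data, such that for all conductances satisfying (A1)–(A3) with these data, all $x,y\in\mathbb Z^d$, all $t\ge1$ with $|x-y|\le t^{1/2}$ and all $r>t^{1/2}/\theta$, $$\mathbb P^x\bigl(Y_t=y,\ \tau_{B(x,r)}>t\bigr)\ \ge\ c\,t^{-d/2}.$$ -/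

import Mathlib

open MeasureTheory ProbabilityTheory
open scoped ENNReal NNReal

namespace ConductanceChain

/-- The integer lattice `ℤ^d`. -/
abbrev Lattice (d : ℕ) : Type := Fin d → ℤ

/-- The Euclidean distance `|x - y|` between two lattice points. -/
noncomputable def eDist {d : ℕ} (x y : Lattice d) : ℝ :=
  Real.sqrt (∑ i, ((x i : ℝ) - (y i : ℝ)) ^ 2)

/-- The ball `B(x, r) = {y ∈ ℤ^d : |x - y| < r}`. -/
def eBall {d : ℕ} (x : Lattice d) (r : ℝ) : Set (Lattice d) :=
  {y | eDist x y < r}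

/-- Symmetric conductances `C_{xy} ∈ [0, ∞)`, `x ≠ y` (extended by `C_{xx} = 0`), whose total
conductance at every site is finite and positive, so that the associated Markov chain exists. -/
structure Conductance (d : ℕ) where
  /-- the conductance `C_{xy}` -/
  val : Lattice d → Lattice d → ℝ≥0
  symm : ∀ x y, val x y = val y x
  diag : ∀ x, val x x = 0
  summable : ∀ x, Summable (val x)
  pos : ∀ x, 0 < ∑' y, val x y

namespace Conductance

variable {d : ℕ} (C : Conductance d)

/-- The total conductance `ν_x = ∑_y C_{xy}`. -/
noncomputable def nu (x : Lattice d) : ℝ≥0 := ∑' y, C.val x y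

theorem nu_pos (x : Lattice d) : 0 < C.nu x := C.pos x

/-- One step of the jump chain from `x`: the site `y` is chosen with probability
`C_{xy} / ν_x`. -/
noncomputable def jumpPMF (x : Lattice d) : PMF (Lattice d) :=
  ⟨fun y => ((C.val x y / C.nu x : ℝ≥0) : ℝ≥0∞), by
    have h : HasSum (fun y => C.val x y / C.nu x) (C.nu x / C.nu x) :=
      (C.summable x).hasSum.div_const (C.nu x)
    rw [div_self (C.nu_pos x).ne'] at h
    exact ENNReal.hasSum_coe.2 h⟩

/-- The transition kernel `x ↦ (C_{xy} / ν_x)_y` of the jump chain. -/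
noncomputable def jumpKernel : Kernel (Lattice d) (Lattice d) :=
  Kernel.ofFunOfCountable fun x => (C.jumpPMF x).toMeasure

instance : IsMarkovKernel C.jumpKernel :=
  ⟨fun x => by
    change IsProbabilityMeasure (C.jumpPMF x).toMeasure
    infer_instance⟩

/-- The jump mechanism at step `n` as a kernel from the history up to time `n`: it depends on the
history through the current position only. -/
noncomputable def stepKernel (n : ℕ) :
    Kernel (Finset.Iic n → Lattice d) (Lattice d) :=
  C.jumpKernel.comap (fun h => h ⟨n, Finset.mem_Iic.2 le_rfl⟩) (measurable_pi_apply _)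

instance (n : ℕ) : IsMarkovKernel (C.stepKernel n) := by
  unfold stepKernel; infer_instance

/-- The law of the discrete time chain `(X_n)_{n ≥ 0}` started at `x`. -/
noncomputable def jumpChainLaw (x : Lattice d) : Measure (ℕ → Lattice d) :=
  Kernel.traj (X := fun _ => Lattice d) C.stepKernel 0 (fun _ => x)

instance (x : Lattice d) : IsProbabilityMeasure (C.jumpChainLaw x) := by
  unfold jumpChainLaw; infer_instance

/-- The exponential law with parameter `ν_z`, the law of the holding times at `z`. -/
noncomputable def holdingLaw (z : Lattice d) : Measure ℝ := expMeasure (C.nu z)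

instance (z : Lattice d) : IsProbabilityMeasure (C.holdingLaw z) :=
  isProbabilityMeasure_expMeasure (NNReal.coe_pos.2 (C.nu_pos z))

/-- The law of a family of independent clocks `U_k^z`, `k ∈ ℕ`, `z ∈ ℤ^d`, where `U_k^z` is
exponential with parameter `ν_z`. -/
noncomputable def clockLaw : Measure (ℕ × Lattice d → ℝ) :=
  Measure.infinitePi fun p => C.holdingLaw p.2

instance : IsProbabilityMeasure C.clockLaw := by
  unfold clockLaw; infer_instance

/-- The probability `P^x`: the jump chain started at `x`, together with independent clocks that are
also independent of the jump chain. -/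
noncomputable def law (x : Lattice d) :
    Measure ((ℕ → Lattice d) × (ℕ × Lattice d → ℝ)) :=
  (C.jumpChainLaw x).prod C.clockLaw

instance (x : Lattice d) : IsProbabilityMeasure (C.law x) := by
  unfold law; infer_instance

end Conductance

/-- The sample space: trajectories of the jump chain and values of the clocks. -/
abbrev Sample (d : ℕ) : Type := (ℕ → Lattice d) × (ℕ × Lattice d → ℝ)

/-- The time `T_n` of the `n`-th jump: `T_0 = 0` and `T_{n+1} = T_n + U_n^{X_n}`. -/
noncomputable def jumpTime {d : ℕ} (n : ℕ) (ω : Sample d) : ℝ :=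
  ∑ k ∈ Finset.range n, ω.2 (k, ω.1 k)

/-- The number of jumps up to time `t`: the least `n` with `t < T_{n+1}`, so that
`T_n ≤ t < T_{n+1}`. (If there is no such `n`, i.e. if the chain explodes before time `t`, the value
is the irrelevant `0`; this has probability zero when `ν` is bounded.) -/
noncomputable def jumpCount {d : ℕ} (t : ℝ≥0) (ω : Sample d) : ℕ :=
  sInf {n : ℕ | (t : ℝ) < jumpTime (n + 1) ω}

/-- The continuous time chain: `Y_t = X_n` for `T_n ≤ t < T_{n+1}`. -/
noncomputable def Y {d : ℕ} (t : ℝ≥0) (ω : Sample d) : Lattice d :=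
  ω.1 (jumpCount t ω)

/-- The exit time `τ_A = inf {t ≥ 0 : Y_t ∉ A}`, with `inf ∅ = ∞`. -/
noncomputable def exitTime {d : ℕ} (A : Set (Lattice d)) (ω : Sample d) : ℝ≥0∞ :=
  ⨅ (s : ℝ≥0) (_ : Y s ω ∉ A), (s : ℝ≥0∞)

/-- Uniform two-sided bounds on the total conductances: `c₁ ≤ ν_x ≤ c₂` for all `x`. -/
def TotalBounds {d : ℕ} (C : Conductance d) (c₁ c₂ : ℝ) : Prop :=
  ∀ x, c₁ ≤ C.nu x ∧ (C.nu x : ℝ) ≤ c₂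

/-- Uniform local irreducibility with constants `M₀`, `δ`: neighbours `x`, `y` are joined by a path
`z_1 = x, …, z_N = y` in `B(x, M₀)` whose steps have conductance at least `δ`. -/
def LocallyIrreducible {d : ℕ} (C : Conductance d) (M₀ δ : ℝ) : Prop :=
  ∀ x y : Lattice d, eDist x y = 1 →
    ∃ N : ℕ, 2 ≤ N ∧ ∃ z : ℕ → Lattice d, z 1 = x ∧ z N = y ∧
      (∀ i, 1 ≤ i → i ≤ N → z i ∈ eBall x M₀) ∧
      (∀ i, 1 ≤ i → i < N → δ ≤ C.val (z i) (z (i + 1)))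

/-- The requirements on the dominating function `φ` on `{1, 2, …}`: it is decreasing,
`∑_i i^{d+1} φ(i) < ∞`, and `φ(2i) ≤ k φ(i)` for some `k`. -/
structure IsProfile (d : ℕ) (φ : ℕ → ℝ≥0) : Prop where
  antitone : AntitoneOn φ (Set.Ici 1)
  summable : Summable fun i : ℕ => (i : ℝ≥0) ^ (d + 1) * φ i
  doubling : ∃ k : ℝ≥0, ∀ i, 1 ≤ i → φ (2 * i) ≤ k * φ i

/-- Uniform second moment condition: `C_{xy} ≤ φ(|x - y|)` for all `x ≠ y`, where `φ` satisfies the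
above requirements and is extended to real arguments `s ≥ 1` as the step function `φ(⌊s⌋)`. (If `φ`
is any decreasing function on `[1, ∞)`, then `φ(s) ≤ φ(⌊s⌋)`.) -/
def DominatedBy {d : ℕ} (C : Conductance d) (φ : ℕ → ℝ≥0) : Prop :=
  IsProfile d φ ∧ ∀ x y : Lattice d, x ≠ y → C.val x y ≤ φ ⌊eDist x y⌋₊

end ConductanceChain

/-!
The lower bound is proved for a chain on a finite torus and then transferred to the chain on the
lattice, which differs little from the torus chain before it leaves a large ball.

Fix `x` and a scale `R = √t`. On a torus of side much larger than `R` take the conductances of the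
given chain, lifted by `toLattice`, and add unit conductances on the nearest neighbour edges away
from `x`, where the chains of edges of local irreducibility might be cut (`torusCond`). The result
has bounded second moments of the jumps, and its energy controls the nearest neighbour differences
with constants which depend on the data only (`torusChain_torusCond`, `exists_moment_bound`). All
estimates on the torus are made for this class, `TorusChain`, and are uniform in its side:

* Comparing a function with its box averages gives the Nash inequality (`TorusChain.nash`) and the
  on-diagonal bound `p_t ≤ A t^{-d/2}` (`heat_upper_bound`).
* The mean displacement up to time `R²` is at most `A R`: its growth is bounded through the
  Cauchy-Schwarz inequality by the growth of `∑ p^{1-β}`, with a small `β > 0`. The power takes the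
  place of the entropy, and only second moments of the jumps are needed (`heat_moment_bound`).
* These two bounds show that `p` has order `R^{-d}` on a set which carries a fixed proportion of a
  weight `exp (-|z - x| / R)`. By the weighted Poincaré inequality (`TorusChain.weighted_poincare`)
  the weighted mean of `log p` satisfies a Riccati inequality, so it is bounded below
  (`log_mean_lower_bound`). Jensen's inequality in the semigroup identity turns this into
  `p_t(x, y) ≥ c t^{-d/2}` for `|x - y|` of order `√t` (`heat_lower_bound`).
* Killing the chain on leaving a ball of radius `L R` costs at most half of this if `L` is large:
  the probability to leave the ball is small by Markov's inequality, where the maximum principle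
  does the work of the strong Markov property (`killed_mass_ge`), and the loss in the heat kernel is
  at most the on-diagonal bound times that probability (`heat_sub_killed_le`,
  `killed_lower_bound`).

For the transfer, the events that the process has followed a given path up to time `t` are
measurable and disjoint, and their probabilities are explicit (`Conductance.law_pathEvent`), so the
sum over the paths in the ball bounds from below the probability in question
(`Conductance.sum_stepProb_le`). Iterating Duhamel's formula bounds the killed semigroup from above
by the same sum (`Conductance.expMat_le_law`). The process on the lattice may also jump to points
which the torus does not represent. The conductance to these is at most `K / R²`
(`nu_toLattice_le`), so that it costs no more than a factor `exp (-K)` over a time `R²`.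
-/

namespace ConductanceChain

/-! ### Exponentials of finite matrices with nonnegative off-diagonal entries -/

section MatrixSemigroup

variable {V : Type*} [Fintype V] [DecidableEq V]

/-- The one-parameter semigroup `e^{tA}` generated by a finite matrix. -/
noncomputable def expMat (A : Matrix V V ℝ) (t : ℝ) : Matrix V V ℝ := NormedSpace.exp (t • A)

@[simp] theorem expMat_zero (A : Matrix V V ℝ) : expMat A 0 = 1 := by
  simp [expMat]

theorem expMat_add (A : Matrix V V ℝ) (s t : ℝ) : expMat A (s + t) = expMat A s * expMat A t := by
  unfold expMat
  rw [add_smul]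
  exact Matrix.exp_add_of_commute _ _ (((Commute.refl A).smul_left s).smul_right t)

theorem expMat_symm {A : Matrix V V ℝ} (hA : ∀ u v, A u v = A v u) (t : ℝ) (u v : V) :
    expMat A t u v = expMat A t v u := by
  have h : (t • A).IsSymm := by
    ext i j
    simp [hA i j]
  have h2 := congrFun (congrFun h.exp v) u
  simpa [expMat, Matrix.transpose_apply] using h2

theorem hasDerivAt_expMat_left (A : Matrix V V ℝ) (t : ℝ) (u v : V) :
    HasDerivAt (fun s => expMat A s u v) (∑ w, A u w * expMat A t w v) t := by
  let _ : NormedRing (Matrix V V ℝ) := Matrix.linftyOpNormedRing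
  let _ : NormedAlgebra ℝ (Matrix V V ℝ) := Matrix.linftyOpNormedAlgebra
  have h : HasDerivAt (fun s : ℝ => NormedSpace.exp (s • A)) (A * NormedSpace.exp (t • A)) t :=
    hasDerivAt_exp_smul_const' A t
  have h2 := (LinearMap.toContinuousLinearMap
    (Matrix.entryLinearMap ℝ ℝ u v)).hasFDerivAt.comp_hasDerivAt t h
  exact h2.congr_deriv (Matrix.mul_apply ..)

theorem hasDerivAt_expMat_right (A : Matrix V V ℝ) (t : ℝ) (u v : V) :
    HasDerivAt (fun s => expMat A s u v) (∑ w, expMat A t u w * A w v) t := by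
  let _ : NormedRing (Matrix V V ℝ) := Matrix.linftyOpNormedRing
  let _ : NormedAlgebra ℝ (Matrix V V ℝ) := Matrix.linftyOpNormedAlgebra
  have h : HasDerivAt (fun s : ℝ => NormedSpace.exp (s • A)) (NormedSpace.exp (t • A) * A) t :=
    hasDerivAt_exp_smul_const A t
  have h2 := (LinearMap.toContinuousLinearMap
    (Matrix.entryLinearMap ℝ ℝ u v)).hasFDerivAt.comp_hasDerivAt t h
  exact h2.congr_deriv (Matrix.mul_apply ..)

theorem continuous_expMat (A : Matrix V V ℝ) (u v : V) :
    Continuous fun s => expMat A s u v :=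
  continuous_iff_continuousAt.2 fun t => (hasDerivAt_expMat_left A t u v).continuousAt

theorem hasSum_exp_entry (A : Matrix V V ℝ) (u v : V) :
    HasSum (fun n : ℕ => (n.factorial : ℝ)⁻¹ * (A ^ n) u v) (NormedSpace.exp A u v) := by
  let _ : NormedRing (Matrix V V ℝ) := Matrix.linftyOpNormedRing
  let _ : NormedAlgebra ℝ (Matrix V V ℝ) := Matrix.linftyOpNormedAlgebra
  have h := NormedSpace.exp_series_hasSum_exp' (𝕂 := ℝ) A
  exact h.mapL (LinearMap.toContinuousLinearMap (Matrix.entryLinearMap ℝ ℝ u v))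

theorem pow_entry_mono {A B : Matrix V V ℝ} (hA : ∀ u v, 0 ≤ A u v) (hAB : ∀ u v, A u v ≤ B u v)
    (n : ℕ) : ∀ u v, 0 ≤ (A ^ n) u v ∧ (A ^ n) u v ≤ (B ^ n) u v := by
  induction n with
  | zero =>
    intro u v
    simp only [pow_zero, le_refl, and_true]
    by_cases h : u = v <;> simp [Matrix.one_apply, h]
  | succ n ih =>
    intro u v
    simp only [pow_succ, Matrix.mul_apply]
    refine ⟨Finset.sum_nonneg fun w _ => mul_nonneg (ih u w).1 (hA w v), ?_⟩
    exact Finset.sum_le_sum fun w _ =>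
      mul_le_mul (ih u w).2 (hAB w v) (hA w v) ((ih u w).1.trans (ih u w).2)

theorem exp_entry_mono {A B : Matrix V V ℝ} (hA : ∀ u v, 0 ≤ A u v) (hAB : ∀ u v, A u v ≤ B u v)
    (u v : V) : 0 ≤ NormedSpace.exp A u v ∧ NormedSpace.exp A u v ≤ NormedSpace.exp B u v := by
  constructor
  · exact (hasSum_exp_entry A u v).nonneg fun n =>
      mul_nonneg (by positivity) (pow_entry_mono hA hAB n u v).1
  · exact hasSum_le (fun n => mul_le_mul_of_nonneg_left (pow_entry_mono hA hAB n u v).2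
      (by positivity)) (hasSum_exp_entry A u v) (hasSum_exp_entry B u v)

theorem expMat_add_smul_one (A : Matrix V V ℝ) (k t : ℝ) :
    expMat (A + k • (1 : Matrix V V ℝ)) t = Real.exp (t * k) • expMat A t := by
  unfold expMat
  have h1 : t • (A + k • (1 : Matrix V V ℝ)) = t • A + (t * k) • (1 : Matrix V V ℝ) := by
    rw [smul_add, smul_smul]
  rw [h1, Matrix.exp_add_of_commute _ _ ((Commute.one_right _).smul_right _)]
  have h2 : NormedSpace.exp ((t * k) • (1 : Matrix V V ℝ)) = Real.exp (t * k) • 1 := by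
    rw [← Matrix.diagonal_one, ← Matrix.diagonal_smul, Matrix.exp_diagonal]
    rw [← Matrix.diagonal_smul]
    congr 1
    ext i
    rw [Pi.coe_exp]
    simp [Real.exp_eq_exp_ℝ]
  rw [h2, Matrix.mul_smul, mul_one]

/-- Shifting by a multiple of the identity reduces to entrywise nonnegative matrices, whose
exponentials are monotone. -/
theorem expMat_mono {A B : Matrix V V ℝ} (hA : ∀ u v, u ≠ v → 0 ≤ A u v)
    (hAB : ∀ u v, A u v ≤ B u v) {t : ℝ} (ht : 0 ≤ t) (u v : V) :
    0 ≤ expMat A t u v ∧ expMat A t u v ≤ expMat B t u v := by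
  set k : ℝ := ∑ w, |A w w|
  have hk : ∀ w, 0 ≤ A w w + k := fun w => by
    have := Finset.single_le_sum (f := fun w => |A w w|) (fun i _ => abs_nonneg _)
      (Finset.mem_univ w)
    have h2 := neg_abs_le (A w w)
    simp only [k] at *
    linarith
  have h0 : ∀ u v, 0 ≤ (A + k • (1 : Matrix V V ℝ)) u v := fun u v => by
    by_cases h : u = v
    · subst h; simpa using hk u
    · simpa [Matrix.one_apply, h] using hA u v h
  have h := exp_entry_mono (A := t • (A + k • (1 : Matrix V V ℝ)))
    (B := t • (B + k • (1 : Matrix V V ℝ))) (fun u v => mul_nonneg ht (h0 u v))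
    (fun u v => mul_le_mul_of_nonneg_left (by simpa using hAB u v) ht) u v
  have e1 := congrFun (congrFun (expMat_add_smul_one A k t) u) v
  have e2 := congrFun (congrFun (expMat_add_smul_one B k t) u) v
  simp only [expMat, Matrix.smul_apply, smul_eq_mul] at e1 e2 h ⊢
  have hp := Real.exp_pos (t * k)
  rw [e1, e2] at h
  exact ⟨by by_contra hn; push Not at hn; nlinarith [h.1], le_of_mul_le_mul_left h.2 hp⟩

theorem expMat_nonneg {A : Matrix V V ℝ} (hA : ∀ u v, u ≠ v → 0 ≤ A u v) {t : ℝ} (ht : 0 ≤ t)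
    (u v : V) : 0 ≤ expMat A t u v :=
  (expMat_mono hA (fun _ _ => le_rfl) ht u v).1

/-- The maximum principle: a subsolution of `f' = A f` stays below the solution with the same
initial value. -/
theorem le_expMat_of_subsolution {A : Matrix V V ℝ} (hA : ∀ u v, u ≠ v → 0 ≤ A u v)
    {f f' : ℝ → V → ℝ} (hf : ∀ s z, HasDerivAt (fun s => f s z) (f' s z) s) {t : ℝ} (ht : 0 ≤ t)
    (hsub : ∀ s z, 0 ≤ s → s ≤ t → f' s z ≤ ∑ w, A z w * f s w) (z : V) :
    f t z ≤ ∑ w, expMat A t z w * f 0 w := by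
  -- `s ↦ e^{(t-s)A} f(s)` is nonincreasing
  set g : ℝ → ℝ := fun s => ∑ w, expMat A (t - s) z w * f s w with hg
  have hd : ∀ s, HasDerivAt g
      (∑ w, expMat A (t - s) z w * (f' s w - ∑ v, A w v * f s v)) s := by
    intro s
    have h1 : ∀ w, HasDerivAt (fun s => expMat A (t - s) z w * f s w)
        (-(∑ v, expMat A (t - s) z v * A v w) * f s w + expMat A (t - s) z w * f' s w) s := by
      intro w
      have h2 : HasDerivAt (fun s : ℝ => t - s) (-1) s := by
        simpa using (hasDerivAt_id s).const_sub t
      have h3 := (hasDerivAt_expMat_right A (t - s) z w).comp s h2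
      exact (h3.mul (hf s w)).congr_deriv (by simp)
    have h5 := HasDerivAt.fun_sum (u := Finset.univ) fun w _ => h1 w
    refine h5.congr_deriv ?_
    simp only [mul_sub, neg_mul, Finset.sum_add_distrib, Finset.sum_sub_distrib,
      Finset.sum_neg_distrib]
    have : ∑ w, expMat A (t - s) z w * ∑ v, A w v * f s v
        = ∑ w, (∑ v, expMat A (t - s) z v * A v w) * f s w := by
      simp only [Finset.mul_sum, Finset.sum_mul]
      rw [Finset.sum_comm]
      exact Finset.sum_congr rfl fun _ _ => Finset.sum_congr rfl fun _ _ => by ring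
    rw [this]; ring
  have hanti : AntitoneOn g (Set.Icc 0 t) := by
    refine antitoneOn_of_deriv_nonpos (convex_Icc 0 t)
      (fun s _ => (hd s).continuousAt.continuousWithinAt)
      (fun s _ => (hd s).differentiableAt.differentiableWithinAt) ?_
    intro s hs
    rw [interior_Icc] at hs
    rw [(hd s).deriv]
    refine Finset.sum_nonpos fun w _ => mul_nonpos_of_nonneg_of_nonpos
      (expMat_nonneg hA (by linarith [hs.2]) z w) ?_
    linarith [hsub s w hs.1.le hs.2.le]
  have h := hanti (Set.left_mem_Icc.2 ht) (Set.right_mem_Icc.2 ht) ht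
  simpa [hg, Matrix.one_apply] using h

end MatrixSemigroup

/-! ### Symmetric Markov chains on a finite set -/

section FiniteChain

variable {V : Type*} [Fintype V]

/-- The generator `(L f)(u) = ∑_v c_{uv} (f(v) - f(u))` of the chain with conductances `c`. -/
def gen [DecidableEq V] (c : V → V → ℝ) : Matrix V V ℝ :=
  Matrix.of c - Matrix.diagonal fun u => ∑ v, c u v

/-- The heat kernel `p_t(u, v) = (e^{tL})_{uv}`. -/
noncomputable def heat [DecidableEq V] (c : V → V → ℝ) (t : ℝ) (u v : V) : ℝ := expMat (gen c) t u v

theorem gen_apply_ne [DecidableEq V] (c : V → V → ℝ) {u v : V} (h : u ≠ v) : gen c u v = c u v := by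
  simp [gen, h]

theorem gen_apply_self [DecidableEq V] (c : V → V → ℝ) (u : V) :
    gen c u u = c u u - ∑ v, c u v := by
  simp [gen]

theorem sum_gen_mul [DecidableEq V] (c : V → V → ℝ) (f : V → ℝ) (u : V) :
    ∑ v, gen c u v * f v = ∑ v, c u v * (f v - f u) := by
  simp [gen, sub_mul, Matrix.diagonal_apply, mul_sub, Finset.sum_sub_distrib, Finset.sum_mul]

variable {c : V → V → ℝ} (hc : ∀ u v, 0 ≤ c u v) (hs : ∀ u v, c u v = c v u)

include hs in
theorem heat_symm [DecidableEq V] (t : ℝ) (u v : V) : heat c t u v = heat c t v u := by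
  refine expMat_symm (fun u v => ?_) t u v
  by_cases h : u = v
  · rw [h]
  · rw [gen_apply_ne c h, gen_apply_ne c (Ne.symm h), hs]

include hc in
theorem heat_nonneg [DecidableEq V] {t : ℝ} (ht : 0 ≤ t) (u v : V) : 0 ≤ heat c t u v :=
  expMat_nonneg (fun u v h => by rw [gen_apply_ne c h]; exact hc u v) ht u v

theorem heat_zero [DecidableEq V] (u v : V) : heat c 0 u v = if u = v then 1 else 0 := by
  simp [heat, Matrix.one_apply]

theorem heat_add [DecidableEq V] (s t : ℝ) (u v : V) :
    heat c (s + t) u v = ∑ w, heat c s u w * heat c t w v := by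
  simp [heat, expMat_add, Matrix.mul_apply]

/-- `u` solves the heat equation of the chain. -/
def IsHeatSol (c : V → V → ℝ) (u : ℝ → V → ℝ) : Prop :=
  ∀ t z, HasDerivAt (fun s => u s z) (∑ w, c z w * (u t w - u t z)) t

theorem isHeatSol_heat_left [DecidableEq V] (y : V) : IsHeatSol c fun t z => heat c t z y := by
  intro t z
  have h := hasDerivAt_expMat_left (gen c) t z y
  rwa [sum_gen_mul c (fun w => expMat (gen c) t w y)] at h

include hs in
theorem isHeatSol_heat [DecidableEq V] (x : V) : IsHeatSol c fun t z => heat c t x z := by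
  have := isHeatSol_heat_left (c := c) x
  intro t z
  simpa only [heat_symm hs] using this t z

theorem IsHeatSol.add_const {u : ℝ → V → ℝ} (h : IsHeatSol c u) (ε : ℝ) :
    IsHeatSol c fun t z => u t z + ε := by
  intro t z
  simpa using (h t z).add_const ε

include hs in
/-- Summation by parts. -/
theorem sum_mul_gen (f g : V → ℝ) :
    ∑ z, f z * ∑ w, c z w * (g w - g z)
      = -(1 / 2) * ∑ z, ∑ w, c z w * ((f z - f w) * (g z - g w)) := by
  have h1 : ∑ z, f z * ∑ w, c z w * (g w - g z) = ∑ z, ∑ w, c z w * (f z * (g w - g z)) := by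
    refine Finset.sum_congr rfl fun z _ => ?_
    rw [Finset.mul_sum]
    exact Finset.sum_congr rfl fun w _ => by ring
  have h2 : ∑ z, ∑ w, c z w * (f z * (g w - g z)) = ∑ z, ∑ w, c z w * (f w * (g z - g w)) := by
    rw [Finset.sum_comm]
    exact Finset.sum_congr rfl fun w _ => Finset.sum_congr rfl fun z _ => by rw [hs z w]
  have h3 : ∑ z, ∑ w, c z w * ((f z - f w) * (g z - g w))
      = -(∑ z, ∑ w, c z w * (f z * (g w - g z))) - ∑ z, ∑ w, c z w * (f w * (g z - g w)) := by
    rw [← Finset.sum_neg_distrib, ← Finset.sum_sub_distrib]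
    refine Finset.sum_congr rfl fun z _ => ?_
    rw [← Finset.sum_neg_distrib, ← Finset.sum_sub_distrib]
    exact Finset.sum_congr rfl fun w _ => by ring
  rw [h1, h3, ← h2]; ring

include hs in
theorem IsHeatSol.sum_const {u : ℝ → V → ℝ} (h : IsHeatSol c u) (t : ℝ) :
    ∑ z, u t z = ∑ z, u 0 z := by
  have hd : ∀ s, HasDerivAt (fun s => ∑ z, u s z) 0 s := by
    intro s
    have h1 := HasDerivAt.fun_sum (u := Finset.univ) fun z _ => h s z
    refine h1.congr_deriv ?_
    have h2 := sum_mul_gen hs (fun _ => (1 : ℝ)) (u s)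
    simp only [one_mul, sub_self, zero_mul, mul_zero, Finset.sum_const_zero] at h2
    exact h2
  exact is_const_of_deriv_eq_zero (fun s => (hd s).differentiableAt) (fun s => (hd s).deriv) t 0

include hs in
theorem sum_heat [DecidableEq V] (t : ℝ) (x : V) : ∑ z, heat c t x z = 1 := by
  rw [(isHeatSol_heat hs x).sum_const hs t]
  simp [heat_zero]

include hc hs in
theorem heat_le_one [DecidableEq V] {t : ℝ} (ht : 0 ≤ t) (x y : V) : heat c t x y ≤ 1 := by
  rw [← sum_heat hs t x]
  exact Finset.single_le_sum (f := fun z => heat c t x z) (fun z _ => heat_nonneg hc ht x z)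
    (Finset.mem_univ y)

end FiniteChain

/-! ### The discrete torus -/

/-- The discrete torus `(ℤ/N)^d`. -/
abbrev Torus (d N : ℕ) : Type := Fin d → ZMod N

/-- The distance to `0` in the `ℓ¹` metric of the torus. -/
noncomputable def tnorm {d N : ℕ} (u : Torus d N) : ℝ := ∑ i, ((u i).valMinAbs.natAbs : ℝ)

section Geometry

variable {d N : ℕ}

theorem tnorm_nonneg (u : Torus d N) : 0 ≤ tnorm u :=
  Finset.sum_nonneg fun _ _ => Nat.cast_nonneg _

@[simp] theorem tnorm_zero : tnorm (0 : Torus d N) = 0 := by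
  simp [tnorm]

theorem tnorm_neg (u : Torus d N) : tnorm (-u) = tnorm u := by
  simp [tnorm, ZMod.natAbs_valMinAbs_neg]

theorem tnorm_sub_comm (u v : Torus d N) : tnorm (u - v) = tnorm (v - u) := by
  rw [← tnorm_neg, neg_sub]

theorem tnorm_add_le (u v : Torus d N) : tnorm (u + v) ≤ tnorm u + tnorm v := by
  unfold tnorm
  rw [← Finset.sum_add_distrib]
  refine Finset.sum_le_sum fun i _ => ?_
  have h := (ZMod.natAbs_valMinAbs_add_le (u i) (v i)).trans (Int.natAbs_add_le _ _)
  exact_mod_cast h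

theorem tnorm_sub_le (u v w : Torus d N) : tnorm (u - w) ≤ tnorm (u - v) + tnorm (v - w) := by
  simpa using tnorm_add_le (u - v) (v - w)

theorem abs_tnorm_sub_tnorm_le (x u v : Torus d N) :
    |tnorm (u - x) - tnorm (v - x)| ≤ tnorm (u - v) := by
  rw [abs_le]
  constructor
  · linarith [tnorm_sub_le v u x, tnorm_sub_comm u v]
  · linarith [tnorm_sub_le u v x]

theorem coord_le_tnorm (u : Torus d N) (i : Fin d) : ((u i).valMinAbs.natAbs : ℝ) ≤ tnorm u :=
  Finset.single_le_sum (f := fun i => ((u i).valMinAbs.natAbs : ℝ)) (fun _ _ => Nat.cast_nonneg _)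
    (Finset.mem_univ i)

variable [NeZero N]

theorem tnorm_le_size (u : Torus d N) : tnorm u ≤ d * N := by
  unfold tnorm
  calc ∑ i, ((u i).valMinAbs.natAbs : ℝ) ≤ ∑ _i : Fin d, (N : ℝ) := by
        refine Finset.sum_le_sum fun i _ => ?_
        have := (ZMod.natAbs_valMinAbs_le (u i)).trans (Nat.div_le_self N 2)
        exact_mod_cast this
    _ = d * N := by simp

theorem eq_natAbs_or_eq_neg (j : ZMod N) :
    j = (j.valMinAbs.natAbs : ZMod N) ∨ j = -(j.valMinAbs.natAbs : ZMod N) := by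
  rw [ZMod.natCast_natAbs_valMinAbs]
  split_ifs <;> simp

/-- Every class modulo `N` has a representative `±k` with `0 ≤ k ≤ N / 2`. -/
theorem sum_zmod_le (F : ZMod N → ℝ) (hF : ∀ j, 0 ≤ F j) :
    ∑ j, F j ≤ ∑ k ∈ Finset.range (N / 2 + 1), (F (k : ZMod N) + F (-(k : ZMod N))) := by
  have h1 : ∀ j : ZMod N, F j ≤ ∑ k ∈ Finset.range (N / 2 + 1),
      ((if j = (k : ZMod N) then F j else 0) + (if j = -(k : ZMod N) then F j else 0)) := by
    intro j
    have hk : j.valMinAbs.natAbs ∈ Finset.range (N / 2 + 1) :=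
      Finset.mem_range.2 (Nat.lt_succ_of_le (ZMod.natAbs_valMinAbs_le j))
    have hnn : ∀ k : ℕ, 0 ≤ ((if j = (k : ZMod N) then F j else 0)
        + (if j = -(k : ZMod N) then F j else 0)) := fun k => by
      have := hF j
      split_ifs <;> simp [this]
    refine le_trans ?_ (Finset.single_le_sum (fun k _ => hnn k) hk)
    have hj := hF j
    rcases eq_natAbs_or_eq_neg j with h2 | h2
    · rw [if_pos h2]
      split_ifs <;> linarith
    · rw [if_pos h2]
      split_ifs <;> linarith
  refine (Finset.sum_le_sum fun j _ => h1 j).trans ?_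
  rw [Finset.sum_comm]
  refine (Finset.sum_congr rfl fun k _ => ?_).le
  rw [Finset.sum_add_distrib]
  simp

theorem sum_inv_sq_le {R : ℝ} (hR : 1 ≤ R) :
    ∑ j : ZMod N, ((1 + (j.valMinAbs.natAbs : ℝ) / R) ^ 2)⁻¹ ≤ 4 * R := by
  have hR0 : 0 < R := by linarith
  have key : ∀ n : ℕ, ∑ k ∈ Finset.range (n + 1), ((1 + (k : ℝ) / R) ^ 2)⁻¹
      ≤ 1 + R - R * (1 + (n : ℝ) / R)⁻¹ := by
    intro n
    induction n with
    | zero => simp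
    | succ n ih =>
      rw [Finset.sum_range_succ]
      have ha : (0 : ℝ) < 1 + (n : ℝ) / R := by positivity
      have hb : (0 : ℝ) < 1 + ((n + 1 : ℕ) : ℝ) / R := by positivity
      have hab : 1 + ((n + 1 : ℕ) : ℝ) / R = 1 + (n : ℝ) / R + 1 / R := by push_cast; ring
      have h : ((1 + ((n + 1 : ℕ) : ℝ) / R) ^ 2)⁻¹
          ≤ R * (1 + (n : ℝ) / R)⁻¹ - R * (1 + ((n + 1 : ℕ) : ℝ) / R)⁻¹ := by
        have e : R * (1 + (n : ℝ) / R)⁻¹ - R * (1 + ((n + 1 : ℕ) : ℝ) / R)⁻¹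
            = ((1 + (n : ℝ) / R) * (1 + ((n + 1 : ℕ) : ℝ) / R))⁻¹ := by
          rw [hab] at hb ⊢
          field_simp
          ring
        rw [e]
        apply inv_anti₀ (by positivity)
        have : (1 : ℝ) / R > 0 := by positivity
        rw [hab]; nlinarith
      linarith
  refine (sum_zmod_le _ fun j => by positivity).trans ?_
  have h2 : ∑ k ∈ Finset.range (N / 2 + 1),
      (((1 + (((k : ZMod N).valMinAbs.natAbs : ℕ) : ℝ) / R) ^ 2)⁻¹
        + ((1 + (((-(k : ZMod N)).valMinAbs.natAbs : ℕ) : ℝ) / R) ^ 2)⁻¹)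
      = 2 * ∑ k ∈ Finset.range (N / 2 + 1), ((1 + (k : ℝ) / R) ^ 2)⁻¹ := by
    rw [Finset.mul_sum]
    refine Finset.sum_congr rfl fun k hk => ?_
    rw [ZMod.natAbs_valMinAbs_neg,
      ZMod.valMinAbs_natCast_of_le_half (Nat.lt_succ_iff.1 (Finset.mem_range.1 hk))]
    simp; ring
  rw [h2]
  have := key (N / 2)
  have h3 : 0 < R * (1 + ((N / 2 : ℕ) : ℝ) / R)⁻¹ := by positivity
  linarith

theorem sum_torus_prod (φ : ZMod N → ℝ) : ∑ z : Torus d N, ∏ i, φ (z i) = (∑ j, φ j) ^ d :=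
  (Fintype.sum_pow φ d).symm

theorem exp_neg_le_inv_sq {x : ℝ} (hx : 0 ≤ x) : Real.exp (-x) ≤ 4 * ((1 + x) ^ 2)⁻¹ := by
  have h1 : 1 + x / 2 ≤ Real.exp (x / 2) := by linarith [Real.add_one_le_exp (x / 2)]
  have h2 : Real.exp x = Real.exp (x / 2) ^ 2 := by
    rw [← Real.exp_nat_mul]; congr 1; push_cast; ring
  have h3 : (1 + x) ^ 2 / 4 ≤ Real.exp x := by rw [h2]; nlinarith [Real.exp_pos (x / 2)]
  rw [Real.exp_neg]
  have h4 : 0 < (1 + x) ^ 2 / 4 := by positivity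
  calc (Real.exp x)⁻¹ ≤ ((1 + x) ^ 2 / 4)⁻¹ := inv_anti₀ h4 h3
    _ = _ := by field_simp

omit [NeZero N] in
theorem exp_neg_tnorm (R : ℝ) (z : Torus d N) :
    Real.exp (-tnorm z / R) = ∏ i, Real.exp (-((z i).valMinAbs.natAbs : ℝ) / R) := by
  rw [← Real.exp_sum]
  congr 1
  unfold tnorm
  rw [← Finset.sum_neg_distrib, Finset.sum_div]

/-- The weights factorize over the coordinates, so that the bound does not depend on `N`. -/
theorem sum_exp_tnorm_le {R : ℝ} (hR : 1 ≤ R) :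
    ∑ z : Torus d N, Real.exp (-tnorm z / R) ≤ (16 * R) ^ d := by
  simp only [exp_neg_tnorm]
  rw [sum_torus_prod fun j : ZMod N => Real.exp (-(j.valMinAbs.natAbs : ℝ) / R)]
  refine pow_le_pow_left₀ (Finset.sum_nonneg fun _ _ => (Real.exp_pos _).le) ?_ d
  calc ∑ j : ZMod N, Real.exp (-(j.valMinAbs.natAbs : ℝ) / R)
      ≤ ∑ j : ZMod N, 4 * ((1 + (j.valMinAbs.natAbs : ℝ) / R) ^ 2)⁻¹ := by
        refine Finset.sum_le_sum fun j _ => ?_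
        rw [neg_div]
        exact exp_neg_le_inv_sq (by positivity)
    _ ≤ 16 * R := by
        rw [← Finset.mul_sum]
        linarith [sum_inv_sq_le (N := N) hR]

theorem sum_shift (F : Torus d N → ℝ) (x : Torus d N) : ∑ z, F (z - x) = ∑ z, F z :=
  Fintype.sum_equiv (Equiv.subRight x) _ _ fun _ => rfl

theorem sum_shift_add (F : Torus d N → ℝ) (x : Torus d N) : ∑ z, F (z + x) = ∑ z, F z :=
  Fintype.sum_equiv (Equiv.addRight x) _ _ fun _ => rfl

/-- The number of points in a ball, bounded uniformly in `N`: on the ball the exponential weights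
are at least `exp (-m)`. -/
theorem card_ball_le {R : ℝ} (hR : 1 ≤ R) {m : ℝ} (x : Torus d N) :
    ((Finset.univ.filter fun z : Torus d N => tnorm (z - x) ≤ m * R).card : ℝ)
      ≤ Real.exp m * (16 * R) ^ d := by
  have hR0 : 0 < R := by linarith
  have h1 := sum_shift (fun z => Real.exp (-tnorm z / R)) x
  have h2 : ((Finset.univ.filter fun z : Torus d N => tnorm (z - x) ≤ m * R).card : ℝ)
      * Real.exp (-m) ≤ ∑ z : Torus d N, Real.exp (-tnorm (z - x) / R) := by
    rw [← nsmul_eq_mul, ← Finset.sum_const]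
    refine (Finset.sum_le_sum fun z hz => ?_).trans
      (Finset.sum_le_sum_of_subset_of_nonneg (Finset.filter_subset _ _)
        fun _ _ _ => (Real.exp_pos _).le)
    rw [Finset.mem_filter] at hz
    apply Real.exp_le_exp.2
    rw [neg_div, neg_le_neg_iff, div_le_iff₀ hR0]
    exact hz.2
  rw [h1] at h2
  have h3 := h2.trans (sum_exp_tnorm_le hR)
  rw [Real.exp_neg, ← div_eq_mul_inv, div_le_iff₀ (Real.exp_pos m)] at h3
  linarith

end Geometry

/-! ### Conductances on the torus and the Nash inequality -/

/-- The unit vector in direction `i`. -/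
def unitVec {d N : ℕ} (i : Fin d) : Torus d N := Pi.single i 1

/-- Symmetric conductances on the torus with a uniform second moment bound, and such that the
increments of every function across nearest neighbour edges are controlled by its energy nearby. -/
structure TorusChain (d N : ℕ) [NeZero N] (K M : ℝ) (c : Torus d N → Torus d N → ℝ) : Prop where
  nonneg : ∀ u v, 0 ≤ c u v
  symm : ∀ u v, c u v = c v u
  moment : ∀ u, ∑ v, c u v * tnorm (u - v) ^ 2 ≤ K
  edge : ∀ (f : Torus d N → ℝ) (u : Torus d N) (i : Fin d), (f (u + unitVec i) - f u) ^ 2 ≤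
    K * ∑ a, ∑ b, if tnorm (a - u) ≤ M ∧ tnorm (b - u) ≤ M then c a b * (f a - f b) ^ 2 else 0

section Nash

variable {d N : ℕ} [NeZero N]

/-- The energy of nearest neighbour edges is controlled by the energy of the chain, also for
weights which vary by at most a factor `Q` on the range of the edge condition. -/
theorem TorusChain.sum_edge_le {K M : ℝ} {c : Torus d N → Torus d N → ℝ} (hK : 0 ≤ K)
    (h : TorusChain d N K M c) {π : Torus d N → ℝ} (hπ : ∀ z, 0 ≤ π z)
    {Q : ℝ} (hQ0 : 0 ≤ Q) (hQ : ∀ u v, tnorm (u - v) ≤ M → π v ≤ Q * π u)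
    (f : Torus d N → ℝ) (i : Fin d) :
    ∑ u, π u * (f (u + unitVec i) - f u) ^ 2
      ≤ K * Q * (Real.exp M * 16 ^ d) * ∑ a, ∑ b, c a b * (min (π a) (π b) * (f a - f b) ^ 2) := by
  have hstep : ∀ u, π u * (f (u + unitVec i) - f u) ^ 2 ≤ ∑ a, ∑ b,
      if tnorm (a - u) ≤ M then K * Q * (c a b * (min (π a) (π b) * (f a - f b) ^ 2)) else 0 := by
    intro u
    refine (mul_le_mul_of_nonneg_left (h.edge f u i) (hπ u)).trans ?_
    rw [← mul_assoc, Finset.mul_sum]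
    refine Finset.sum_le_sum fun a _ => ?_
    rw [Finset.mul_sum]
    refine Finset.sum_le_sum fun b _ => ?_
    by_cases ha : tnorm (a - u) ≤ M
    · by_cases hb : tnorm (b - u) ≤ M
      · simp only [ha, hb, and_self, if_true]
        have h1 : π u ≤ Q * min (π a) (π b) := by
          rcases min_choice (π a) (π b) with h' | h' <;> rw [h']
          · exact hQ a u ha
          · exact hQ b u hb
        have h2 : 0 ≤ K * (c a b * (f a - f b) ^ 2) :=
          mul_nonneg hK (mul_nonneg (h.nonneg a b) (sq_nonneg _))
        nlinarith [mul_le_mul_of_nonneg_right h1 h2]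
      · simp only [ha, hb, and_false, if_false, mul_zero, if_true]
        have h2 : 0 ≤ Q * min (π a) (π b) := mul_nonneg hQ0 (le_min (hπ a) (hπ b))
        have h3 : 0 ≤ K * (c a b * (f a - f b) ^ 2) :=
          mul_nonneg hK (mul_nonneg (h.nonneg a b) (sq_nonneg _))
        nlinarith [mul_nonneg h2 h3]
    · simp [ha]
  refine (Finset.sum_le_sum fun u _ => hstep u).trans ?_
  rw [Finset.sum_comm]
  rw [Finset.mul_sum]
  refine Finset.sum_le_sum fun a _ => ?_
  rw [Finset.sum_comm, Finset.mul_sum]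
  refine Finset.sum_le_sum fun b _ => ?_
  rw [← Finset.sum_filter, Finset.sum_const, nsmul_eq_mul]
  have hcard := card_ball_le (d := d) (N := N) (R := 1) le_rfl (m := M) a
  simp only [mul_one] at hcard
  simp only [tnorm_sub_comm a]
  have h0 : 0 ≤ Q * min (π a) (π b) := mul_nonneg hQ0 (le_min (hπ a) (hπ b))
  have h3 : 0 ≤ K * (c a b * (f a - f b) ^ 2) :=
    mul_nonneg hK (mul_nonneg (h.nonneg a b) (sq_nonneg _))
  nlinarith [mul_le_mul_of_nonneg_right hcard (mul_nonneg h0 h3)]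

/-- The `ℓ²` norm of the increment `f(· + h) - f`. -/
noncomputable def shiftNorm (f : Torus d N → ℝ) (h : Torus d N) : ℝ :=
  Real.sqrt (∑ x, (f (x + h) - f x) ^ 2)

theorem shiftNorm_add_le (f : Torus d N → ℝ) (h k : Torus d N) :
    shiftNorm f (h + k) ≤ shiftNorm f h + shiftNorm f k := by
  have e1 : ∀ g : Torus d N → ℝ, Real.sqrt (∑ x, (g x) ^ 2) = ‖(WithLp.toLp 2 g :
      EuclideanSpace ℝ (Torus d N))‖ := fun g => by
    rw [EuclideanSpace.norm_eq]; simp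
  have e2 : shiftNorm f h = Real.sqrt (∑ x, (f (x + k + h) - f (x + k)) ^ 2) := by
    unfold shiftNorm
    rw [sum_shift_add (fun x => (f (x + h) - f x) ^ 2) k]
  rw [e2]
  unfold shiftNorm
  rw [e1 (fun x => f (x + (h + k)) - f x), e1 (fun x => f (x + k + h) - f (x + k)),
    e1 (fun x => f (x + k) - f x)]
  refine le_trans (le_of_eq ?_) (norm_add_le _ _)
  congr 1
  ext x
  simp [add_assoc, add_comm k h]

theorem shiftNorm_zero (f : Torus d N → ℝ) : shiftNorm f 0 = 0 := by
  simp [shiftNorm]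

theorem shiftNorm_nsmul_le (f : Torus d N → ℝ) (h : Torus d N) (n : ℕ) :
    shiftNorm f (n • h) ≤ n * shiftNorm f h := by
  induction n with
  | zero => simp [shiftNorm_zero]
  | succ n ih =>
    rw [succ_nsmul]
    refine (shiftNorm_add_le f _ _).trans ?_
    push_cast
    linarith

theorem sum_shift_sq_le (f : Torus d N → ℝ) (n : ℕ) (k : Fin d → ℕ) (hk : ∀ i, k i ≤ n) :
    ∑ x, (f (x + fun i => (k i : ZMod N)) - f x) ^ 2
      ≤ d * n ^ 2 * ∑ i, ∑ x, (f (x + unitVec i) - f x) ^ 2 := by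
  have h1 : (fun i => (k i : ZMod N)) = ∑ i, k i • (unitVec i : Torus d N) := by
    ext j
    simp [unitVec, Finset.sum_apply, Pi.single_apply]
  have h2 : shiftNorm f (fun i => (k i : ZMod N)) ≤ ∑ i, n * shiftNorm f (unitVec i) := by
    rw [h1]
    refine (Finset.le_sum_of_subadditive (shiftNorm f) (shiftNorm_zero f).le
      (shiftNorm_add_le f) Finset.univ _).trans ?_
    refine Finset.sum_le_sum fun i _ => (shiftNorm_nsmul_le f _ _).trans ?_
    exact mul_le_mul_of_nonneg_right (by exact_mod_cast hk i) (Real.sqrt_nonneg _)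
  have hsq : ∀ h, ∑ x, (f (x + h) - f x) ^ 2 = shiftNorm f h ^ 2 := fun h => by
    rw [shiftNorm, Real.sq_sqrt (Finset.sum_nonneg fun _ _ => sq_nonneg _)]
  simp only [hsq]
  calc shiftNorm f (fun i => (k i : ZMod N)) ^ 2
      ≤ (∑ i, n * shiftNorm f (unitVec i)) ^ 2 :=
        pow_le_pow_left₀ (Real.sqrt_nonneg _) h2 2
    _ ≤ d * ∑ i, (n * shiftNorm f (unitVec i)) ^ 2 := by
        have := sq_sum_le_card_mul_sum_sq (s := (Finset.univ : Finset (Fin d)))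
          (f := fun i => n * shiftNorm f (unitVec i))
        simpa using this
    _ = _ := by
        simp only [mul_pow, ← Finset.mul_sum]
        ring

/-- The pseudo-Poincaré inequality: compare `f` with its averages over boxes of side `n`. -/
theorem pseudo_poincare (f : Torus d N → ℝ) {n : ℕ} (hn : 1 ≤ n) (hnN : n ≤ N) :
    ∑ x, f x ^ 2 ≤ 2 * (d * n ^ 2) * (∑ i, ∑ x, (f (x + unitVec i) - f x) ^ 2)
      + 2 / (n : ℝ) ^ d * (∑ x, |f x|) ^ 2 := by
  set ι : (Fin d → Fin n) → Torus d N := fun k i => ((k i : ℕ) : ZMod N) with hι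
  have hinj : Function.Injective ι := by
    intro k l hkl
    ext i
    have h1 := congrFun hkl i
    simp only [hι] at h1
    rw [ZMod.natCast_eq_natCast_iff] at h1
    exact Nat.ModEq.eq_of_lt_of_lt h1 ((k i).2.trans_le hnN) ((l i).2.trans_le hnN)
  have hn0 : (0 : ℝ) < (n : ℝ) ^ d := by positivity
  have hcard : (Finset.univ : Finset (Fin d → Fin n)).card = n ^ d := by simp
  set D := ∑ i, ∑ x, (f (x + unitVec i) - f x) ^ 2
  set S := ∑ x, |f x|
  set a : Torus d N → ℝ := fun x => (∑ k, f (x + ι k)) / (n : ℝ) ^ d with ha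
  have h1 : ∑ x, (f x - a x) ^ 2 ≤ d * n ^ 2 * D := by
    have h2 : ∀ x, (f x - a x) ^ 2 ≤ (∑ k, (f (x + ι k) - f x) ^ 2) / (n : ℝ) ^ d := by
      intro x
      have h3 : f x - a x = -(∑ k, (f (x + ι k) - f x)) / (n : ℝ) ^ d := by
        rw [Finset.sum_sub_distrib, Finset.sum_const, hcard, ha]
        field_simp
        ring
      have h4 := sq_sum_le_card_mul_sum_sq (s := (Finset.univ : Finset (Fin d → Fin n)))
        (f := fun k => f (x + ι k) - f x)
      rw [hcard] at h4
      push_cast at h4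
      rw [h3, div_pow, neg_sq, div_le_div_iff₀ (by positivity) hn0]
      nlinarith
    refine (Finset.sum_le_sum fun x _ => h2 x).trans ?_
    rw [← Finset.sum_div, Finset.sum_comm, div_le_iff₀ hn0]
    refine (Finset.sum_le_sum fun k _ =>
      sum_shift_sq_le f n (fun i => (k i : ℕ)) fun i => (k i).2.le).trans ?_
    rw [Finset.sum_const, hcard, nsmul_eq_mul]
    push_cast
    linarith
  have hle : ∀ x, |a x| ≤ S / (n : ℝ) ^ d := by
    intro x
    rw [ha]
    simp only [abs_div, abs_of_pos hn0]
    refine div_le_div_of_nonneg_right ((Finset.abs_sum_le_sum_abs _ _).trans ?_) hn0.le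
    have hinj2 : Function.Injective fun k => x + ι k := fun k l h => hinj (add_left_cancel h)
    rw [← Finset.sum_image (s := Finset.univ) (g := fun k => x + ι k) (f := fun z => |f z|)
      (hinj2.injOn)]
    exact Finset.sum_le_sum_of_subset_of_nonneg (Finset.subset_univ _) fun _ _ _ => abs_nonneg _
  have hS : ∑ x, |a x| ≤ S := by
    have h2 : ∀ x, |a x| ≤ (∑ k, |f (x + ι k)|) / (n : ℝ) ^ d := fun x => by
      rw [ha]
      simp only [abs_div, abs_of_pos hn0]
      exact div_le_div_of_nonneg_right (Finset.abs_sum_le_sum_abs _ _) hn0.le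
    refine (Finset.sum_le_sum fun x _ => h2 x).trans ?_
    rw [← Finset.sum_div, Finset.sum_comm, div_le_iff₀ hn0]
    refine (Finset.sum_congr rfl fun k _ => sum_shift_add (fun z => |f z|) (ι k)).le.trans ?_
    rw [Finset.sum_const, hcard, nsmul_eq_mul]
    push_cast
    linarith
  have h5 : ∑ x, a x ^ 2 ≤ S ^ 2 / (n : ℝ) ^ d := by
    calc ∑ x, a x ^ 2 ≤ ∑ x, S / (n : ℝ) ^ d * |a x| := by
          refine Finset.sum_le_sum fun x _ => ?_
          rw [← sq_abs, sq]
          exact mul_le_mul_of_nonneg_right (hle x) (abs_nonneg _)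
      _ ≤ S / (n : ℝ) ^ d * S := by
          rw [← Finset.mul_sum]
          refine mul_le_mul_of_nonneg_left hS (div_nonneg ?_ hn0.le)
          exact Finset.sum_nonneg fun _ _ => abs_nonneg _
      _ = _ := by ring
  calc ∑ x, f x ^ 2 ≤ ∑ x, (2 * (f x - a x) ^ 2 + 2 * a x ^ 2) :=
        Finset.sum_le_sum fun x _ => by nlinarith [sq_nonneg (f x - 2 * a x)]
    _ = 2 * ∑ x, (f x - a x) ^ 2 + 2 * ∑ x, a x ^ 2 := by
        rw [Finset.sum_add_distrib, Finset.mul_sum, Finset.mul_sum]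
    _ ≤ 2 * (d * n ^ 2 * D) + 2 * (S ^ 2 / (n : ℝ) ^ d) := by linarith
    _ = _ := by ring

/-- The Nash inequality in scale-by-scale form. -/
theorem TorusChain.nash {K M : ℝ} {c : Torus d N → Torus d N → ℝ} (hK : 0 ≤ K)
    (h : TorusChain d N K M c) (f : Torus d N → ℝ) {n : ℕ} (hn : 1 ≤ n) (hnN : n ≤ N) :
    ∑ x, f x ^ 2 ≤ 2 * d ^ 2 * (K * (Real.exp M * 16 ^ d)) * n ^ 2
        * (∑ a, ∑ b, c a b * (f a - f b) ^ 2)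
      + 2 / (n : ℝ) ^ d * (∑ x, |f x|) ^ 2 := by
  refine (pseudo_poincare f hn hnN).trans ?_
  have h1 : ∀ i : Fin d, ∑ u, (f (u + unitVec i) - f u) ^ 2
      ≤ K * (Real.exp M * 16 ^ d) * ∑ a, ∑ b, c a b * (f a - f b) ^ 2 := by
    intro i
    have := h.sum_edge_le hK (π := fun _ => 1) (fun _ => zero_le_one) zero_le_one
      (fun _ _ _ => by simp) f i
    simpa using this
  have h2 : ∑ i : Fin d, ∑ u, (f (u + unitVec i) - f u) ^ 2
      ≤ d * (K * (Real.exp M * 16 ^ d) * ∑ a, ∑ b, c a b * (f a - f b) ^ 2) := by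
    refine (Finset.sum_le_sum fun i _ => h1 i).trans ?_
    simp
  have h3 := mul_le_mul_of_nonneg_left h2 (show (0 : ℝ) ≤ 2 * (d * n ^ 2) by positivity)
  nlinarith

end Nash

/-! ### On-diagonal upper bound for the heat kernel -/

section UpperBound

variable {V : Type*} [Fintype V]

theorem IsHeatSol.hasDerivAt_sum_sq {c : V → V → ℝ} (hs : ∀ u v, c u v = c v u)
    {u : ℝ → V → ℝ} (hu : IsHeatSol c u) (t : ℝ) :
    HasDerivAt (fun s => ∑ z, u s z ^ 2) (-∑ a, ∑ b, c a b * (u t a - u t b) ^ 2) t := by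
  have h1 := HasDerivAt.fun_sum (u := Finset.univ) fun z _ => (hu t z).pow 2
  refine h1.congr_deriv ?_
  have h2 := sum_mul_gen hs (u t) (u t)
  have h3 : ∑ z, ((2 : ℕ) : ℝ) * u t z ^ (2 - 1) * ∑ w, c z w * (u t w - u t z)
      = 2 * ∑ z, u t z * ∑ w, c z w * (u t w - u t z) := by
    rw [Finset.mul_sum]
    exact Finset.sum_congr rfl fun z _ => by norm_num; ring
  rw [h3, h2]
  simp only [sq]
  ring

variable {d N : ℕ} [NeZero N]

/-- The decay of the `ℓ²` norm at the spatial scale `n`. -/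
theorem TorusChain.sum_sq_decay {K M : ℝ} {c : Torus d N → Torus d N → ℝ} (hK : 0 ≤ K)
    (h : TorusChain d N K M c) {B : ℝ} (hB : 0 < B)
    (hB2 : 2 * d ^ 2 * (K * (Real.exp M * 16 ^ d)) ≤ B)
    {n : ℕ} (hn : 1 ≤ n) (hnN : n ≤ N) (x : Torus d N) {s s' : ℝ} (hs0 : 0 ≤ s) (hss : s ≤ s') :
    ∑ z, heat c s' x z ^ 2
      ≤ 2 / (n : ℝ) ^ d + Real.exp (-((s' - s) / (B * n ^ 2))) * ∑ z, heat c s x z ^ 2 := by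
  set u : ℝ → ℝ := fun s => ∑ z, heat c s x z ^ 2 with hu
  set E : ℝ → ℝ := fun s => ∑ a, ∑ b, c a b * (heat c s x a - heat c s x b) ^ 2
  have hd : ∀ t, HasDerivAt u (-E t) t := (isHeatSol_heat h.symm x).hasDerivAt_sum_sq h.symm
  have hnpos : (0 : ℝ) < B * n ^ 2 := by positivity
  have hE : ∀ t, 0 ≤ E t := fun t => Finset.sum_nonneg fun a _ => Finset.sum_nonneg fun b _ =>
    mul_nonneg (h.nonneg a b) (sq_nonneg _)
  have hnash : ∀ t, 0 ≤ t → u t ≤ B * n ^ 2 * E t + 2 / (n : ℝ) ^ d := by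
    intro t ht
    have h1 := h.nash hK (fun z => heat c t x z) hn hnN
    have h2 : ∑ z, |heat c t x z| = 1 := by
      rw [← sum_heat h.symm t x]
      exact Finset.sum_congr rfl fun z _ => abs_of_nonneg (heat_nonneg h.nonneg ht x z)
    rw [h2] at h1
    have h3 : 2 * d ^ 2 * (K * (Real.exp M * 16 ^ d)) * (n : ℝ) ^ 2 * E t ≤ B * n ^ 2 * E t :=
      mul_le_mul_of_nonneg_right (mul_le_mul_of_nonneg_right hB2 (sq_nonneg _)) (hE t)
    simp only [one_pow, mul_one] at h1
    exact h1.trans (by linarith)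
  set g : ℝ → ℝ := fun t => Real.exp (t / (B * n ^ 2)) * (u t - 2 / (n : ℝ) ^ d) with hg
  have hgd : ∀ t, HasDerivAt g (Real.exp (t / (B * n ^ 2)) * (1 / (B * n ^ 2))
      * (u t - 2 / (n : ℝ) ^ d) + Real.exp (t / (B * n ^ 2)) * (-E t)) t := fun t =>
    (((hasDerivAt_id t).div_const _).exp).mul ((hd t).sub_const _)
  have hanti : AntitoneOn g (Set.Icc s s') := by
    refine antitoneOn_of_deriv_nonpos (convex_Icc _ _)
      (fun t _ => (hgd t).continuousAt.continuousWithinAt)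
      (fun t _ => (hgd t).differentiableAt.differentiableWithinAt) ?_
    intro t ht
    rw [interior_Icc] at ht
    rw [(hgd t).deriv]
    have h1 := hnash t (hs0.trans ht.1.le)
    have h2 : 1 / (B * n ^ 2) * (u t - 2 / (n : ℝ) ^ d) ≤ E t := by
      rw [one_div_mul_eq_div, div_le_iff₀ hnpos]
      linarith
    nlinarith [Real.exp_pos (t / (B * n ^ 2))]
  have h1 := hanti (Set.left_mem_Icc.2 hss) (Set.right_mem_Icc.2 hss) hss
  simp only [hg] at h1
  have h2 : Real.exp (-((s' - s) / (B * n ^ 2))) * Real.exp (s' / (B * n ^ 2))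
      = Real.exp (s / (B * n ^ 2)) := by
    rw [← Real.exp_add]; congr 1; field_simp; ring
  have h3 : u s' - 2 / (n : ℝ) ^ d
      ≤ Real.exp (-((s' - s) / (B * n ^ 2))) * (u s - 2 / (n : ℝ) ^ d) := by
    have hp := Real.exp_pos (s' / (B * n ^ 2))
    rw [← h2] at h1
    nlinarith
  have h4 : 0 ≤ Real.exp (-((s' - s) / (B * n ^ 2))) * (2 / (n : ℝ) ^ d) := by positivity
  linarith

theorem exp_neg_three_mul_le (m : ℕ) : Real.exp (-(3 * m)) ≤ (1 / 2) ^ m := by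
  have h : Real.exp (-3) ≤ 1 / 2 := by
    rw [Real.exp_neg, one_div]
    apply inv_anti₀ (by norm_num)
    linarith [Real.add_one_le_exp (3 : ℝ)]
  calc Real.exp (-(3 * m)) = Real.exp (-3) ^ m := by
        rw [← Real.exp_nat_mul]; congr 1; ring
    _ ≤ _ := pow_le_pow_left₀ (Real.exp_pos _).le h m

/-- The on-diagonal bound `p_t(x, y) ≤ A t^{-d/2}`, by iterating the decay over dyadic scales. -/
theorem heat_upper_bound (d : ℕ) {K : ℝ} (hK : 0 ≤ K) (M : ℝ) :
    ∃ A : ℝ, 1 ≤ A ∧ ∀ (N : ℕ) [NeZero N] (c : Torus d N → Torus d N → ℝ), TorusChain d N K M c →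
      ∀ t : ℝ, 0 < t → t ≤ (N : ℝ) ^ 2 → ∀ x y, heat c t x y ≤ A / Real.sqrt t ^ d := by
  set B : ℝ := 2 * d ^ 2 * (K * (Real.exp M * 16 ^ d)) + 1 with hBdef
  have hB1 : 1 ≤ B := by
    have : 0 ≤ 2 * d ^ 2 * (K * (Real.exp M * 16 ^ d)) := by positivity
    linarith
  have hB : 0 < B := by linarith
  set T : ℝ := 4 * B * (d + 1) with hT
  have hT1 : 1 ≤ T := by nlinarith [(Nat.cast_nonneg d : (0 : ℝ) ≤ d)]
  have hT0 : 0 < T := by linarith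
  have hD1 : 1 ≤ 2 * Real.sqrt (2 * T) := by
    have : 1 ≤ Real.sqrt (2 * T) := Real.one_le_sqrt.2 (by linarith)
    linarith
  refine ⟨4 * (2 * Real.sqrt (2 * T)) ^ d, by linarith [one_le_pow₀ (n := d) hD1], ?_⟩
  intro N _ c h
  have hdyadic : ∀ k : ℕ, 2 ^ k ≤ N → ∀ x,
      ∑ z, heat c (T * 4 ^ k) x z ^ 2 ≤ 4 / ((2 : ℝ) ^ k) ^ d := by
    intro k
    induction k with
    | zero =>
      intro _ x
      simp only [pow_zero, mul_one, one_pow, div_one]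
      calc ∑ z, heat c T x z ^ 2 ≤ ∑ z, heat c T x z := Finset.sum_le_sum fun z _ => by
            have h0 := heat_nonneg h.nonneg hT0.le x z
            have h1 := heat_le_one h.nonneg h.symm hT0.le x z
            nlinarith
        _ = 1 := sum_heat h.symm T x
        _ ≤ 4 := by norm_num
    | succ k ih =>
      intro hk x
      have hk' : 2 ^ k ≤ N := (Nat.pow_le_pow_right (by norm_num) (Nat.le_succ k)).trans hk
      have h1 := h.sum_sq_decay hK hB (by linarith : 2 * d ^ 2 * (K * (Real.exp M * 16 ^ d)) ≤ B)
        (n := 2 ^ (k + 1)) Nat.one_le_two_pow hk x (s := T * 4 ^ k) (s' := T * 4 ^ (k + 1))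
        (by positivity) (by rw [pow_succ]; nlinarith [show (0 : ℝ) < T * 4 ^ k by positivity])
      have h2 : (T * 4 ^ (k + 1) - T * 4 ^ k) / (B * ((2 ^ (k + 1) : ℕ) : ℝ) ^ 2)
          = 3 * ((d + 1 : ℕ) : ℝ) := by
        have : (((2 ^ (k + 1) : ℕ) : ℝ)) ^ 2 = 4 * 4 ^ k := by
          push_cast; rw [← pow_mul, mul_comm, pow_mul]; norm_num [pow_succ]; ring
        rw [this, hT]
        push_cast
        field_simp
        ring
      rw [h2] at h1
      have h3 := exp_neg_three_mul_le (d + 1)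
      have h4 := ih hk' x
      have hp : (0 : ℝ) < ((2 : ℝ) ^ k) ^ d := by positivity
      have h5 : Real.exp (-(3 * ((d + 1 : ℕ) : ℝ))) * ∑ z, heat c (T * 4 ^ k) x z ^ 2
          ≤ (1 / 2) ^ (d + 1) * (4 / ((2 : ℝ) ^ k) ^ d) :=
        mul_le_mul h3 h4 (Finset.sum_nonneg fun _ _ => sq_nonneg _) (by positivity)
      have h6 : (1 / 2 : ℝ) ^ (d + 1) * (4 / ((2 : ℝ) ^ k) ^ d) = 2 / ((2 : ℝ) ^ (k + 1)) ^ d := by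
        rw [pow_succ (2 : ℝ) k, mul_pow, pow_succ, one_div, inv_pow]
        field_simp
        norm_num
      have h7 : (4 : ℝ) / ((2 : ℝ) ^ (k + 1)) ^ d = 2 / ((2 : ℝ) ^ (k + 1)) ^ d
          + 2 / ((2 : ℝ) ^ (k + 1)) ^ d := by ring
      rw [h7]
      push_cast at h1
      push_cast at h5
      linarith
  have hdiag : ∀ s : ℝ, 0 < s → s ≤ (N : ℝ) ^ 2 → ∀ x, ∑ z, heat c s x z ^ 2
      ≤ 4 * (2 * Real.sqrt (2 * T)) ^ d / Real.sqrt (2 * s) ^ d := by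
    intro s hs hsN x
    have hs2 : 0 < Real.sqrt (2 * s) := Real.sqrt_pos.2 (by linarith)
    rcases lt_or_ge s T with hlt | hge
    · have h1 : ∑ z, heat c s x z ^ 2 ≤ 1 := by
        rw [← sum_heat h.symm s x]
        refine Finset.sum_le_sum fun z _ => ?_
        have h0 := heat_nonneg h.nonneg hs.le x z
        have h1 := heat_le_one h.nonneg h.symm hs.le x z
        nlinarith
      have h2 : Real.sqrt (2 * s) ≤ 2 * Real.sqrt (2 * T) := by
        have := Real.sqrt_le_sqrt (show 2 * s ≤ 2 * T by linarith)
        linarith [Real.sqrt_nonneg (2 * T)]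
      have h3 := pow_le_pow_left₀ hs2.le h2 d
      rw [le_div_iff₀ (by positivity)]
      have h4 : 0 < Real.sqrt (2 * s) ^ d := by positivity
      nlinarith
    · obtain ⟨k, hk1, hk2⟩ := exists_nat_pow_near (x := s / T) (y := 4)
        ((one_le_div hT0).2 hge) (by norm_num)
      rw [le_div_iff₀ hT0] at hk1
      rw [div_lt_iff₀ hT0] at hk2
      have h4k : (4 : ℝ) ^ k = ((2 : ℝ) ^ k) ^ 2 := by
        rw [← pow_mul, mul_comm, pow_mul]; norm_num
      have hkN : 2 ^ k ≤ N := by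
        have h1 : ((2 : ℝ) ^ k) ^ 2 ≤ (N : ℝ) ^ 2 := by
          rw [← h4k]
          nlinarith [show (0 : ℝ) < 4 ^ k by positivity]
        have h2 := (pow_le_pow_iff_left₀ (by positivity) (by positivity) (by norm_num)).1 h1
        exact_mod_cast h2
      have h1 := hdyadic k hkN x
      have hmono : ∑ z, heat c s x z ^ 2 ≤ ∑ z, heat c (T * 4 ^ k) x z ^ 2 := by
        have hd := (isHeatSol_heat h.symm x).hasDerivAt_sum_sq h.symm
        refine antitone_of_deriv_nonpos (fun t => (hd t).differentiableAt) (fun t => ?_)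
          (by linarith : T * 4 ^ k ≤ s)
        rw [(hd t).deriv, neg_nonpos]
        exact Finset.sum_nonneg fun a _ => Finset.sum_nonneg fun b _ =>
          mul_nonneg (h.nonneg a b) (sq_nonneg _)
      refine (hmono.trans h1).trans ?_
      rw [div_le_div_iff₀ (by positivity) (by positivity)]
      rw [mul_assoc, ← mul_pow]
      refine mul_le_mul_of_nonneg_left (pow_le_pow_left₀ hs2.le ?_ d) (by norm_num)
      rw [Real.sqrt_le_left (by positivity), mul_pow, mul_pow, Real.sq_sqrt (by linarith), ← h4k]
      rw [pow_succ] at hk2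
      linarith
  intro t ht htN x y
  have h1 := hdiag (t / 2) (by linarith) (by linarith)
  have e : 2 * (t / 2) = t := by ring
  rw [e] at h1
  calc heat c t x y = ∑ z, heat c (t / 2) x z * heat c (t / 2) z y := by
        rw [← heat_add]; congr 1; ring
    _ ≤ ∑ z, (heat c (t / 2) x z ^ 2 / 2 + heat c (t / 2) y z ^ 2 / 2) := by
        refine Finset.sum_le_sum fun z _ => ?_
        rw [heat_symm h.symm (t / 2) z y]
        nlinarith [sq_nonneg (heat c (t / 2) x z - heat c (t / 2) y z)]
    _ ≤ _ := by
        rw [Finset.sum_add_distrib, ← Finset.sum_div, ← Finset.sum_div]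
        linarith [h1 x, h1 y]

end UpperBound

/-! ### The first moment of the heat kernel -/

section Moment

/-- A quantitative form of the monotonicity of `s ↦ s ^ (-β)`. -/
theorem sq_mul_max_rpow_le {β a b : ℝ} (hβ : 0 ≤ β) (ha : 0 < a) (hb : 0 < b) :
    β * ((a - b) ^ 2 * (max a b) ^ (-(1 + β))) ≤ -((a ^ (-β) - b ^ (-β)) * (a - b)) := by
  have key : ∀ a b : ℝ, 0 < b → b ≤ a →
      β * ((a - b) ^ 2 * a ^ (-(1 + β))) ≤ -((a ^ (-β) - b ^ (-β)) * (a - b)) := by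
    intro a b hb hab
    have ha : 0 < a := hb.trans_le hab
    have h1 : 1 + β * ((a - b) / a) ≤ (b / a) ^ (-β) := by
      have hr : 0 < b / a := div_pos hb ha
      have h2 := Real.log_le_sub_one_of_pos hr
      have h3 := Real.add_one_le_exp (Real.log (b / a) * -β)
      rw [Real.rpow_def_of_pos hr]
      have h4 : (a - b) / a = 1 - b / a := by field_simp
      rw [h4]
      nlinarith
    have h2 : b ^ (-β) = a ^ (-β) * (b / a) ^ (-β) := by
      rw [← Real.mul_rpow ha.le (div_pos hb ha).le]; congr 1; field_simp
    have h3 : a ^ (-(1 + β)) = a ^ (-β) / a := by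
      rw [show -(1 + β) = -β - 1 by ring, Real.rpow_sub_one ha.ne']
    have h4 : 0 < a ^ (-β) := Real.rpow_pos_of_pos ha _
    rw [h2, h3]
    have h5 : -((a ^ (-β) - a ^ (-β) * (b / a) ^ (-β)) * (a - b))
        = a ^ (-β) * (a - b) * ((b / a) ^ (-β) - 1) := by ring
    have h6 : β * ((a - b) ^ 2 * (a ^ (-β) / a)) = a ^ (-β) * (a - b) * (β * ((a - b) / a)) := by
      field_simp
    rw [h5, h6]
    exact mul_le_mul_of_nonneg_left (by linarith) (mul_nonneg h4.le (by linarith))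
  rcases le_total b a with h | h
  · rw [max_eq_left h]; exact key a b hb h
  · rw [max_eq_right h]
    have := key b a ha h
    linarith [this, show (a - b) ^ 2 = (b - a) ^ 2 by ring,
      show β * ((a - b) ^ 2 * b ^ (-(1 + β))) = β * ((b - a) ^ 2 * b ^ (-(1 + β))) by ring]

variable {V : Type*} [Fintype V]

/-- The dissipation of `∑ u^{1-β}` along a positive solution `u` of the heat equation. -/
noncomputable def powDissipation (c : V → V → ℝ) (β : ℝ) (f : V → ℝ) : ℝ :=
  ∑ z, ∑ w, c z w * ((f z - f w) ^ 2 * (max (f z) (f w)) ^ (-(1 + β)))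

theorem IsHeatSol.hasDerivAt_sum_rpow {c : V → V → ℝ} (hc : ∀ u v, 0 ≤ c u v)
    (hs : ∀ u v, c u v = c v u) {u : ℝ → V → ℝ} (hu : IsHeatSol c u) {t : ℝ}
    (hpos : ∀ z, 0 < u t z) {β : ℝ} (hβ : 0 ≤ β) (hβ1 : β ≤ 1) :
    ∃ H' : ℝ, HasDerivAt (fun s => ∑ z, u s z ^ (1 - β)) H' t ∧
      (1 - β) * β / 2 * powDissipation c β (u t) ≤ H' := by
  have h1 := HasDerivAt.fun_sum (u := Finset.univ) fun z _ =>
    (hu t z).rpow_const (p := 1 - β) (Or.inl (hpos z).ne')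
  refine ⟨_, h1, ?_⟩
  have h2 : ∑ z, (∑ w, c z w * (u t w - u t z)) * (1 - β) * u t z ^ (1 - β - 1)
      = (1 - β) * ∑ z, u t z ^ (-β) * ∑ w, c z w * (u t w - u t z) := by
    rw [Finset.mul_sum]
    refine Finset.sum_congr rfl fun z _ => ?_
    rw [show 1 - β - 1 = -β by ring]; ring
  rw [h2, sum_mul_gen hs (fun z => u t z ^ (-β)) (u t)]
  have h3 : β * powDissipation c β (u t) ≤ -∑ z, ∑ w,
      c z w * ((u t z ^ (-β) - u t w ^ (-β)) * (u t z - u t w)) := by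
    unfold powDissipation
    rw [Finset.mul_sum, ← Finset.sum_neg_distrib]
    refine Finset.sum_le_sum fun z _ => ?_
    rw [Finset.mul_sum, ← Finset.sum_neg_distrib]
    refine Finset.sum_le_sum fun w _ => ?_
    have := mul_le_mul_of_nonneg_left (sq_mul_max_rpow_le hβ (hpos z) (hpos w)) (hc z w)
    linarith
  nlinarith

/-- The time derivative of a weighted mean is bounded through the Cauchy-Schwarz inequality by the
dissipation of `∑ u^{1-β}`. -/
theorem sum_mul_gen_le_dissipation {c : V → V → ℝ} (hc : ∀ u v, 0 ≤ c u v)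
    (hs : ∀ u v, c u v = c v u) {ρ f : V → ℝ} (hpos : ∀ z, 0 < f z) {K : ℝ}
    (hρ : ∀ z, ∑ w, c z w * (ρ z - ρ w) ^ 2 ≤ K) (β : ℝ) {l : ℝ} (hl : 0 < l) :
    ∑ z, ρ z * ∑ w, c z w * (f w - f z)
      ≤ l * K / 2 * ∑ z, f z ^ (1 + β) + 1 / (4 * l) * powDissipation c β f := by
  rw [sum_mul_gen hs]
  set P : V → V → ℝ := fun z w => c z w * (ρ z - ρ w) ^ 2 with hP
  have hPs : ∀ z w, P z w = P w z := fun z w => by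
    simp only [hP]; rw [hs z w]; ring
  have h1 : ∀ z w, -(c z w * ((ρ z - ρ w) * (f z - f w)))
      ≤ l / 2 * (P z w * f z ^ (1 + β) + P z w * f w ^ (1 + β))
        + 1 / (2 * l) * (c z w * ((f z - f w) ^ 2 * (max (f z) (f w)) ^ (-(1 + β)))) := by
    intro z w
    set m := max (f z) (f w) with hm
    have hm0 : 0 < m := (hpos z).trans_le (le_max_left _ _)
    have hmp : 0 < m ^ (1 + β) := Real.rpow_pos_of_pos hm0 _
    have h2 : m ^ (1 + β) ≤ f z ^ (1 + β) + f w ^ (1 + β) := by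
      have := Real.rpow_pos_of_pos (hpos z) (1 + β)
      have := Real.rpow_pos_of_pos (hpos w) (1 + β)
      rcases max_choice (f z) (f w) with h' | h' <;> rw [hm, h'] <;> linarith
    rw [Real.rpow_neg hm0.le]
    have h3 : -((ρ z - ρ w) * (f z - f w)) ≤ l / 2 * ((ρ z - ρ w) ^ 2 * m ^ (1 + β))
        + 1 / (2 * l) * ((f z - f w) ^ 2 * (m ^ (1 + β))⁻¹) := by
      have e : l / 2 * ((ρ z - ρ w) ^ 2 * m ^ (1 + β))
        + 1 / (2 * l) * ((f z - f w) ^ 2 * (m ^ (1 + β))⁻¹) + (ρ z - ρ w) * (f z - f w)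
        = (l * m ^ (1 + β) * (ρ z - ρ w) + (f z - f w)) ^ 2 / (2 * l * m ^ (1 + β)) := by
        field_simp
        ring
      have : 0 ≤ (l * m ^ (1 + β) * (ρ z - ρ w) + (f z - f w)) ^ 2 / (2 * l * m ^ (1 + β)) := by
        positivity
      linarith
    have h4 := mul_le_mul_of_nonneg_left h3 (hc z w)
    have h5 : c z w * (l / 2 * ((ρ z - ρ w) ^ 2 * m ^ (1 + β)))
        ≤ l / 2 * (P z w * f z ^ (1 + β) + P z w * f w ^ (1 + β)) := by
      have h6 : 0 ≤ P z w := mul_nonneg (hc z w) (sq_nonneg _)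
      have h7 := mul_le_mul_of_nonneg_left h2 h6
      simp only [hP] at h7 ⊢
      nlinarith
    linarith
  have hsum : ∑ z, ∑ w, P z w * f z ^ (1 + β) ≤ K * ∑ z, f z ^ (1 + β) := by
    rw [Finset.mul_sum]
    refine Finset.sum_le_sum fun z _ => ?_
    rw [← Finset.sum_mul]
    exact mul_le_mul_of_nonneg_right (hρ z) (Real.rpow_pos_of_pos (hpos z) _).le
  have hsum2 : ∑ z, ∑ w, P z w * f w ^ (1 + β) = ∑ z, ∑ w, P z w * f z ^ (1 + β) := by
    rw [Finset.sum_comm]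
    exact Finset.sum_congr rfl fun z _ => Finset.sum_congr rfl fun w _ => by rw [hPs]
  have h8 : -∑ z, ∑ w, c z w * ((ρ z - ρ w) * (f z - f w))
      ≤ l / 2 * (∑ z, ∑ w, P z w * f z ^ (1 + β) + ∑ z, ∑ w, P z w * f w ^ (1 + β))
        + 1 / (2 * l) * powDissipation c β f := by
    unfold powDissipation
    simp only [Finset.mul_sum, ← Finset.sum_neg_distrib, ← Finset.sum_add_distrib]
    refine Finset.sum_le_sum fun z _ => Finset.sum_le_sum fun w _ => ?_
    have := h1 z w
    rw [mul_add] at this ⊢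
    linarith
  rw [hsum2] at h8
  have e : 1 / (4 * l) * powDissipation c β f = 1 / 2 * (1 / (2 * l) * powDissipation c β f) := by
    field_simp; ring
  rw [e]
  nlinarith [mul_le_mul_of_nonneg_left hsum hl.le]

variable {d N : ℕ} [NeZero N]

theorem TorusChain.moment_tnorm {K M : ℝ} {c : Torus d N → Torus d N → ℝ}
    (h : TorusChain d N K M c) (x z : Torus d N) :
    ∑ w, c z w * (tnorm (z - x) - tnorm (w - x)) ^ 2 ≤ K := by
  refine (Finset.sum_le_sum fun w _ => ?_).trans (h.moment z)
  refine mul_le_mul_of_nonneg_left ?_ (h.nonneg z w)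
  rw [← sq_abs]
  exact pow_le_pow_left₀ (abs_nonneg _) (abs_tnorm_sub_tnorm_le x z w) 2

/-- The sum of `f^{1-β}`, `β = 1/(8d)`, is controlled by the mean of `f` with respect to the square
root of the distance. This is the tangent line inequality for `s ↦ s^{1-β}` at the polynomially
decaying weight `R^{-d} (1 + |z|/R)^{-4d}`. -/
theorem sum_rpow_le (hd : 1 ≤ d) {R : ℝ} (hR : 1 ≤ R) (x : Torus d N) {f : Torus d N → ℝ}
    (hf : ∀ z, 0 < f z) :
    ∑ z, f z ^ (1 - 1 / (8 * (d : ℝ)))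
      ≤ R ^ (1 / 8 : ℝ) * (∑ z, f z * Real.sqrt (1 + tnorm (z - x) / R) + 4 ^ d) := by
  have hR0 : 0 < R := by linarith
  have hd0 : (0 : ℝ) < d := by exact_mod_cast hd
  set β : ℝ := 1 / (8 * (d : ℝ)) with hβ
  have hβ0 : 0 ≤ β := by positivity
  have hβ1 : β ≤ 1 := by
    rw [hβ, div_le_one (by positivity)]
    have : (1 : ℝ) ≤ d := by exact_mod_cast hd
    linarith
  set S : Torus d N → ℝ := fun z => 1 + tnorm (z - x) / R with hS
  have hS1 : ∀ z, 1 ≤ S z := fun z => by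
    have := div_nonneg (tnorm_nonneg (z - x)) hR0.le
    simp only [hS]; linarith
  have hS0 : ∀ z, 0 < S z := fun z => by linarith [hS1 z]
  set w : Torus d N → ℝ := fun z => (R ^ d * S z ^ (4 * d))⁻¹ with hw
  have hw0 : ∀ z, 0 < w z := fun z => by
    have := hS0 z
    simp only [hw]; positivity
  have hwβ : ∀ z, w z ^ (-β) = R ^ (1 / 8 : ℝ) * Real.sqrt (S z) := by
    intro z
    have h0 := hS0 z
    simp only [hw]
    rw [Real.rpow_neg (by positivity), Real.inv_rpow (by positivity), inv_inv,
      Real.mul_rpow (by positivity) (by positivity), ← Real.rpow_natCast, ← Real.rpow_natCast,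
      ← Real.rpow_mul hR0.le, ← Real.rpow_mul h0.le, Real.sqrt_eq_rpow]
    congr 2
    · rw [hβ]; field_simp
    · rw [hβ]; push_cast; field_simp; norm_num
  have htan : ∀ z, f z ^ (1 - β) ≤ w z ^ (-β) * (f z + w z) := by
    intro z
    have h1 := Real.geom_mean_le_arith_mean2_weighted (w₁ := 1 - β) (w₂ := β) (by linarith) hβ0
      (hf z).le (hw0 z).le (by ring)
    have h2 : (1 - β) * f z + β * w z ≤ f z + w z := by nlinarith [hf z, hw0 z]
    have h3 : 0 < w z ^ (-β) := Real.rpow_pos_of_pos (hw0 z) _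
    have h4 : w z ^ (-β) * (f z ^ (1 - β) * w z ^ β) = f z ^ (1 - β) := by
      rw [mul_comm (f z ^ _), ← mul_assoc, ← Real.rpow_add (hw0 z)]
      simp
    rw [← h4]
    exact mul_le_mul_of_nonneg_left (h1.trans h2) h3.le
  have hwS : ∑ z, w z * Real.sqrt (S z) ≤ 4 ^ d := by
    have h1 : ∀ z, w z * Real.sqrt (S z)
        ≤ (R ^ d)⁻¹ * ∏ i, ((1 + (((z - x) i).valMinAbs.natAbs : ℝ) / R) ^ 2)⁻¹ := by
      intro z
      have h0 := hS0 z
      have h2 : Real.sqrt (S z) ≤ S z ^ (2 * d) := by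
        calc Real.sqrt (S z) ≤ S z := by
              rw [Real.sqrt_le_left h0.le]; nlinarith [hS1 z]
          _ ≤ S z ^ (2 * d) := le_self_pow₀ (hS1 z) (by omega)
      have h3 : ∏ i, (1 + (((z - x) i).valMinAbs.natAbs : ℝ) / R) ^ 2 ≤ S z ^ (2 * d) := by
        calc ∏ i, (1 + (((z - x) i).valMinAbs.natAbs : ℝ) / R) ^ 2 ≤ ∏ _i : Fin d, S z ^ 2 := by
              refine Finset.prod_le_prod (fun i _ => sq_nonneg _) fun i _ => ?_
              refine pow_le_pow_left₀ (by positivity) ?_ 2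
              have := div_le_div_of_nonneg_right (coord_le_tnorm (z - x) i) hR0.le
              simp only [hS]; linarith
          _ = S z ^ (2 * d) := by simp [← pow_mul]
      have hprod : 0 < ∏ i, (1 + (((z - x) i).valMinAbs.natAbs : ℝ) / R) ^ 2 :=
        Finset.prod_pos fun i _ => by positivity
      rw [Finset.prod_inv_distrib]
      calc w z * Real.sqrt (S z) ≤ w z * S z ^ (2 * d) :=
            mul_le_mul_of_nonneg_left h2 (hw0 z).le
        _ = (R ^ d)⁻¹ * (S z ^ (2 * d))⁻¹ := by
            simp only [hw]
            rw [show 4 * d = 2 * d + 2 * d by ring, pow_add]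
            field_simp
        _ ≤ _ := mul_le_mul_of_nonneg_left (inv_anti₀ hprod h3) (by positivity)
    refine (Finset.sum_le_sum fun z _ => h1 z).trans ?_
    rw [← Finset.mul_sum]
    have h4 := sum_shift (fun z : Torus d N =>
      ∏ i, ((1 + ((z i).valMinAbs.natAbs : ℝ) / R) ^ 2)⁻¹) x
    rw [h4, sum_torus_prod fun j : ZMod N => ((1 + (j.valMinAbs.natAbs : ℝ) / R) ^ 2)⁻¹]
    have h5 := pow_le_pow_left₀ (Finset.sum_nonneg fun j _ => by positivity)
      (sum_inv_sq_le (N := N) hR) d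
    rw [inv_mul_le_iff₀ (by positivity)]
    rw [mul_pow] at h5
    linarith
  calc ∑ z, f z ^ (1 - β) ≤ ∑ z, w z ^ (-β) * (f z + w z) := Finset.sum_le_sum fun z _ => htan z
    _ = R ^ (1 / 8 : ℝ) * (∑ z, f z * Real.sqrt (S z) + ∑ z, w z * Real.sqrt (S z)) := by
        rw [← Finset.sum_add_distrib, Finset.mul_sum]
        refine Finset.sum_congr rfl fun z _ => ?_
        rw [hwβ]; ring
    _ ≤ _ := mul_le_mul_of_nonneg_left (by linarith) (Real.rpow_nonneg hR0.le _)

end Moment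

section MomentBound

set_option maxHeartbeats 1000000 in
/-- The first moment bound `∑_z p_t(x, z) |z - x| ≤ A R` for `t ≤ R²`. With `u = p + ε`, the mean
displacement grows at most like the square root of (a negative power of `t`) times (the growth of
`∑ u^{1-β}`), and the latter sum is in turn bounded by the mean displacement. -/
theorem heat_moment_bound {d : ℕ} (hd : 1 ≤ d) {K : ℝ} (hK : 0 ≤ K) (M : ℝ) :
    ∃ A : ℝ, 1 ≤ A ∧ ∀ (N : ℕ) [NeZero N] (c : Torus d N → Torus d N → ℝ), TorusChain d N K M c →
      ∀ R : ℝ, 1 ≤ R → R ≤ N → ∀ x t, 0 ≤ t → t ≤ R ^ 2 →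
        ∑ z, heat c t x z * tnorm (z - x) ≤ A * R := by
  obtain ⟨A, hA1, hA⟩ := heat_upper_bound d hK M
  have hd0 : (0 : ℝ) < d := by exact_mod_cast hd
  have hd1 : (1 : ℝ) ≤ d := by exact_mod_cast hd
  set β : ℝ := 1 / (8 * (d : ℝ)) with hβ
  have hβ0 : 0 < β := by positivity
  have hβ1 : β < 1 := by
    rw [hβ, div_lt_one (by positivity)]
    linarith
  set κ : ℝ := (1 - β) * β with hκ
  have hκ0 : 0 < κ := mul_pos (by linarith) hβ0
  refine ⟨2 * (3 * K * A + 1 + 1 / (2 * κ) * (1 / (4 * κ) + 1 + 4 ^ d)), ?_, ?_⟩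
  · have h1 : 0 ≤ 1 / (2 * κ) * (1 / (4 * κ) + 1 + 4 ^ d) := by positivity
    have h2 : 0 ≤ 3 * K * A := by positivity
    linarith
  intro N _ c h R hR hRN x T hT0 hTR
  have hR0 : 0 < R := by linarith
  have hN1 : (1 : ℝ) ≤ N := hR.trans hRN
  -- a small constant is added to the heat kernel to make it positive
  set ε : ℝ := ((N : ℝ) ^ d * (1 + d * N))⁻¹ with hε
  have hε0 : 0 < ε := by positivity
  have hεN : ε * (N : ℝ) ^ d * (1 + d * N) = 1 := by rw [hε]; field_simp
  set u : ℝ → Torus d N → ℝ := fun t z => heat c t x z + ε with hu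
  have husol : IsHeatSol c u := (isHeatSol_heat h.symm x).add_const ε
  have hcard : (Finset.univ : Finset (Torus d N)).card = N ^ d := by
    simp [ZMod.card]
  have hupos : ∀ t, 0 ≤ t → ∀ z, 0 < u t z := fun t ht z => by
    have := heat_nonneg h.nonneg ht x z
    simp only [hu]; linarith
  have husum : ∀ t, ∑ z, u t z ≤ 2 := by
    intro t
    simp only [hu]
    rw [Finset.sum_add_distrib, sum_heat h.symm, Finset.sum_const, hcard, nsmul_eq_mul]
    push_cast
    have h1 : 0 ≤ ε * (N : ℝ) ^ d * (d * N) := by positivity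
    nlinarith
  have husup : ∀ t, 0 < t → t ≤ R ^ 2 → ∀ z, u t z ≤ 2 * A / Real.sqrt t ^ d := by
    intro t ht htR z
    have h1 := hA N c h t ht (htR.trans (pow_le_pow_left₀ hR0.le hRN 2)) x z
    have hst : 0 < Real.sqrt t := Real.sqrt_pos.2 ht
    have h2 : ε ≤ A / Real.sqrt t ^ d := by
      have h3 : Real.sqrt t ≤ N := (Real.sqrt_le_left hR0.le).2 htR |>.trans hRN
      have h4 : ε ≤ ((N : ℝ) ^ d)⁻¹ := by
        rw [hε]
        refine inv_anti₀ (by positivity) (le_mul_of_one_le_right (by positivity) ?_)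
        have : (0 : ℝ) ≤ d * N := by positivity
        linarith
      have h5 : ((N : ℝ) ^ d)⁻¹ ≤ (Real.sqrt t ^ d)⁻¹ :=
        inv_anti₀ (by positivity) (pow_le_pow_left₀ hst.le h3 d)
      have h6 : (Real.sqrt t ^ d)⁻¹ ≤ A / Real.sqrt t ^ d := by
        rw [inv_eq_one_div]
        exact div_le_div_of_nonneg_right hA1 (by positivity)
      linarith
    have h7 : 2 * A / Real.sqrt t ^ d = A / Real.sqrt t ^ d + A / Real.sqrt t ^ d := by ring
    rw [h7]
    simp only [hu]; linarith
  have hpow : ∀ t, 0 < t → t ≤ R ^ 2 → ∑ z, u t z ^ (1 + β) ≤ 4 * A * t ^ (-(1 / 16) : ℝ) := by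
    intro t ht htR
    have hst : 0 < Real.sqrt t := Real.sqrt_pos.2 ht
    have h1 : ∀ z, u t z ^ (1 + β) ≤ u t z * (2 * A * t ^ (-(1 / 16) : ℝ)) := by
      intro z
      rw [Real.rpow_add (hupos t ht.le z), Real.rpow_one]
      refine mul_le_mul_of_nonneg_left ?_ (hupos t ht.le z).le
      refine (Real.rpow_le_rpow (hupos t ht.le z).le (husup t ht htR z) hβ0.le).trans ?_
      rw [Real.div_rpow (by positivity) (by positivity), div_eq_mul_inv]
      have h2 : (2 * A) ^ β ≤ 2 * A := by
        calc (2 * A) ^ β ≤ (2 * A) ^ (1 : ℝ) :=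
              Real.rpow_le_rpow_of_exponent_le (by linarith) hβ1.le
          _ = 2 * A := Real.rpow_one _
      have h3 : ((Real.sqrt t ^ d) ^ β)⁻¹ = t ^ (-(1 / 16) : ℝ) := by
        rw [← Real.rpow_natCast, ← Real.rpow_mul hst.le, Real.sqrt_eq_rpow, ← Real.rpow_mul ht.le,
          ← Real.rpow_neg ht.le]
        congr 1
        rw [hβ]; field_simp; norm_num
      rw [h3]
      exact mul_le_mul_of_nonneg_right h2 (Real.rpow_nonneg ht.le _)
    refine (Finset.sum_le_sum fun z _ => h1 z).trans ?_
    rw [← Finset.sum_mul]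
    have h4 : 0 ≤ 2 * A * t ^ (-(1 / 16) : ℝ) := by positivity
    nlinarith [mul_le_mul_of_nonneg_right (husum t) h4]
  set H : ℝ → ℝ := fun t => ∑ z, u t z ^ (1 - β) with hH
  set m : ℝ → ℝ := fun t => ∑ z, heat c t x z * tnorm (z - x) with hm
  set l : ℝ := R ^ (-(7 / 8) : ℝ) with hl
  have hl0 : 0 < l := Real.rpow_pos_of_pos hR0 _
  set Φ : ℝ → ℝ := fun t => m t - 2 * l * K * A * (16 / 15 * t ^ (15 / 16 : ℝ))
    - 1 / (2 * l * κ) * H t with hΦ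
  have hmd : ∀ t, HasDerivAt m (∑ z, tnorm (z - x) * ∑ w, c z w * (u t w - u t z)) t := by
    intro t
    have h1 := HasDerivAt.fun_sum (u := Finset.univ) fun z _ =>
      ((isHeatSol_heat h.symm x) t z).mul_const (tnorm (z - x))
    refine h1.congr_deriv (Finset.sum_congr rfl fun z _ => ?_)
    rw [mul_comm]
    simp [hu]
  have hcontu : ∀ z, Continuous fun t => u t z := fun z =>
    continuous_iff_continuousAt.2 fun t => (husol t z).continuousAt
  have hanti : AntitoneOn Φ (Set.Icc 0 T) := by
    have hder : ∀ t ∈ Set.Ioo 0 T, ∃ D, HasDerivAt Φ D t ∧ D ≤ 0 := by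
      intro t ht
      obtain ⟨H', hH1, hH2⟩ := husol.hasDerivAt_sum_rpow h.nonneg h.symm (hupos t ht.1.le)
        hβ0.le hβ1.le
      have ht16 : HasDerivAt (fun t : ℝ => 16 / 15 * t ^ (15 / 16 : ℝ))
          (t ^ (-(1 / 16) : ℝ)) t := by
        have h1 := ((hasDerivAt_id t).rpow_const (p := (15 / 16 : ℝ)) (Or.inl ht.1.ne')).const_mul
          (16 / 15 : ℝ)
        refine h1.congr_deriv ?_
        simp only [id]
        rw [show (15 / 16 : ℝ) - 1 = -(1 / 16) by norm_num]
        ring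
      refine ⟨_, ((hmd t).sub (ht16.const_mul (2 * l * K * A))).sub
        (hH1.const_mul (1 / (2 * l * κ))), ?_⟩
      have h2 := sum_mul_gen_le_dissipation h.nonneg h.symm (hupos t ht.1.le)
        (h.moment_tnorm x) β hl0
      have h3 := hpow t ht.1 (ht.2.le.trans hTR)
      have h4 : l * K / 2 * ∑ z, u t z ^ (1 + β)
          ≤ l * K / 2 * (4 * A * t ^ (-(1 / 16) : ℝ)) :=
        mul_le_mul_of_nonneg_left h3 (by positivity)
      have h5 : 1 / (4 * l) * powDissipation c β (u t) ≤ 1 / (2 * l * κ) * H' := by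
        have h6 := mul_le_mul_of_nonneg_left hH2 (show 0 ≤ 1 / (2 * l * κ) by positivity)
        refine le_trans (le_of_eq ?_) h6
        rw [← hκ]
        field_simp
        ring
      linarith
    refine antitoneOn_of_deriv_nonpos (convex_Icc _ _) ?_ ?_ ?_
    · have hc1 : Continuous m := continuous_iff_continuousAt.2 fun t => (hmd t).continuousAt
      have hc2 : Continuous fun t : ℝ => t ^ (15 / 16 : ℝ) :=
        Real.continuous_rpow_const (by norm_num)
      have hc3 : ContinuousOn H (Set.Icc 0 T) := by
        refine continuousOn_finsetSum _ fun z _ => ?_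
        exact (hcontu z).continuousOn.rpow_const fun t ht => Or.inl (hupos t ht.1 z).ne'
      exact ((hc1.sub ((hc2.const_mul (16 / 15 : ℝ)).const_mul _)).continuousOn).sub
        (hc3.const_mul _)
    · rw [interior_Icc]
      intro t ht
      obtain ⟨D, hD, _⟩ := hder t ht
      exact hD.differentiableAt.differentiableWithinAt
    · rw [interior_Icc]
      intro t ht
      obtain ⟨D, hD, hD0⟩ := hder t ht
      rw [hD.deriv]; exact hD0
  have hm0 : m 0 = 0 := by
    simp [hm, heat_zero]
  have hH0 : 0 ≤ H 0 := Finset.sum_nonneg fun z _ =>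
    (Real.rpow_pos_of_pos (hupos 0 le_rfl z) _).le
  have hΦ0 : Φ 0 ≤ 0 := by
    simp only [hΦ, hm0]
    rw [Real.zero_rpow (by norm_num)]
    have : 0 ≤ 1 / (2 * l * κ) * H 0 := by positivity
    linarith
  have hΦT := (hanti (Set.left_mem_Icc.2 hT0) (Set.right_mem_Icc.2 hT0) hT0).trans hΦ0
  have hmT : 0 ≤ m T := Finset.sum_nonneg fun z _ =>
    mul_nonneg (heat_nonneg h.nonneg hT0 x z) (tnorm_nonneg _)
  -- the growth of `H` in terms of the moment
  have hHT : H T ≤ R ^ (1 / 8 : ℝ) * (κ * (1 + m T / R) + 1 / (4 * κ) + 1 + 4 ^ d) := by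
    refine (sum_rpow_le hd hR x (hupos T hT0)).trans ?_
    refine mul_le_mul_of_nonneg_left ?_ (Real.rpow_nonneg hR0.le _)
    have h1 : ∑ z, u T z * Real.sqrt (1 + tnorm (z - x) / R)
        = ∑ z, heat c T x z * Real.sqrt (1 + tnorm (z - x) / R)
          + ∑ z, ε * Real.sqrt (1 + tnorm (z - x) / R) := by
      rw [← Finset.sum_add_distrib]
      exact Finset.sum_congr rfl fun z _ => by simp only [hu]; ring
    have h2 : ∑ z : Torus d N, ε * Real.sqrt (1 + tnorm (z - x) / R) ≤ 1 := by
      calc ∑ z : Torus d N, ε * Real.sqrt (1 + tnorm (z - x) / R)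
          ≤ ∑ _z : Torus d N, ε * (1 + d * N) := by
            refine Finset.sum_le_sum fun z _ => mul_le_mul_of_nonneg_left ?_ hε0.le
            have h3 : tnorm (z - x) / R ≤ d * N :=
              (div_le_self (tnorm_nonneg _) hR).trans (tnorm_le_size _)
            have h4 : 0 ≤ tnorm (z - x) / R := div_nonneg (tnorm_nonneg _) hR0.le
            rw [Real.sqrt_le_left (by positivity)]
            nlinarith
        _ = 1 := by
            rw [Finset.sum_const, hcard, nsmul_eq_mul]
            push_cast
            linarith
    have h5 : ∑ z, heat c T x z * Real.sqrt (1 + tnorm (z - x) / R)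
        ≤ κ * (1 + m T / R) + 1 / (4 * κ) := by
      have h6 : ∀ z, heat c T x z * Real.sqrt (1 + tnorm (z - x) / R)
          ≤ κ * (heat c T x z + heat c T x z * tnorm (z - x) / R)
            + 1 / (4 * κ) * heat c T x z := by
        intro z
        have h7 : 0 ≤ 1 + tnorm (z - x) / R := by
          have := div_nonneg (tnorm_nonneg (z - x)) hR0.le
          linarith
        have h8 : Real.sqrt (1 + tnorm (z - x) / R)
            ≤ κ * (1 + tnorm (z - x) / R) + 1 / (4 * κ) := by
          have h9 := Real.sq_sqrt h7
          set s := Real.sqrt (1 + tnorm (z - x) / R)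
          rw [← h9]
          have e : κ * s ^ 2 + 1 / (4 * κ) - s = (2 * κ * s - 1) ^ 2 / (4 * κ) := by
            field_simp; ring
          have : 0 ≤ (2 * κ * s - 1) ^ 2 / (4 * κ) := by positivity
          linarith
        have h10 := mul_le_mul_of_nonneg_left h8 (heat_nonneg h.nonneg hT0 x z)
        refine h10.trans (le_of_eq ?_)
        ring
      refine (Finset.sum_le_sum fun z _ => h6 z).trans (le_of_eq ?_)
      rw [Finset.sum_add_distrib, ← Finset.mul_sum, ← Finset.mul_sum, Finset.sum_add_distrib,
        sum_heat h.symm, ← Finset.sum_div]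
      ring
    rw [h1]; linarith
  have hT16 : l * T ^ (15 / 16 : ℝ) ≤ R := by
    have h1 : T ^ (15 / 16 : ℝ) ≤ R ^ (15 / 8 : ℝ) := by
      refine (Real.rpow_le_rpow hT0 hTR (by norm_num)).trans (le_of_eq ?_)
      rw [← Real.rpow_natCast, ← Real.rpow_mul hR0.le]
      norm_num
    refine (mul_le_mul_of_nonneg_left h1 hl0.le).trans (le_of_eq ?_)
    rw [hl, ← Real.rpow_add hR0]
    norm_num
  have hlR : 1 / l * R ^ (1 / 8 : ℝ) = R := by
    rw [hl, one_div, ← Real.rpow_neg hR0.le, ← Real.rpow_add hR0]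
    norm_num
  have hfin : m T ≤ 32 / 15 * K * A * R
      + 1 / (2 * κ) * (R * (κ * (1 + m T / R) + 1 / (4 * κ) + 1 + 4 ^ d)) := by
    have h1 : 1 / (2 * l * κ) * H T
        ≤ 1 / (2 * κ) * (R * (κ * (1 + m T / R) + 1 / (4 * κ) + 1 + 4 ^ d)) := by
      refine (mul_le_mul_of_nonneg_left hHT (by positivity)).trans (le_of_eq ?_)
      have h2 : 1 / (2 * l * κ) * R ^ (1 / 8 : ℝ) = 1 / (2 * κ) * R := by
        calc 1 / (2 * l * κ) * R ^ (1 / 8 : ℝ) = 1 / (2 * κ) * (1 / l * R ^ (1 / 8 : ℝ)) := by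
              field_simp
          _ = _ := by rw [hlR]
      rw [← mul_assoc, h2, mul_assoc]
    have h2 : 2 * l * K * A * (16 / 15 * T ^ (15 / 16 : ℝ)) ≤ 32 / 15 * K * A * R := by
      have h3 : 0 ≤ 32 / 15 * K * A := by positivity
      nlinarith [mul_le_mul_of_nonneg_left hT16 h3]
    simp only [hΦ] at hΦT
    linarith
  have e : 1 / (2 * κ) * (R * (κ * (1 + m T / R) + 1 / (4 * κ) + 1 + 4 ^ d))
      = R / 2 + m T / 2 + R * (1 / (2 * κ) * (1 / (4 * κ) + 1 + 4 ^ d)) := by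
    field_simp
    ring
  rw [e] at hfin
  have h1 : 0 ≤ K * A * R := by positivity
  change m T ≤ _
  nlinarith

end MomentBound

/-! ### A weighted Poincaré inequality on the torus -/

section Poincare

/-- A Hardy type inequality for exponential weights on the half line. -/
theorem hardy_exp {R : ℝ} (hR : 1 ≤ R) (h : ℕ → ℝ) (h0 : h 0 = 0) (n : ℕ) :
    ∑ k ∈ Finset.range (n + 1), Real.exp (-(k : ℝ) / R) * h k ^ 2
      ≤ 9 * R ^ 2 * ∑ k ∈ Finset.range n,
        Real.exp (-((k + 1 : ℕ) : ℝ) / R) * (h (k + 1) - h k) ^ 2 := by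
  have hR0 : 0 < R := by linarith
  set q : ℝ := Real.exp (-(1 / (2 * R))) with hq
  have hq0 : 0 < q := Real.exp_pos _
  have hq1 : 1 / (3 * R) ≤ 1 - q := by
    have h1 : q ≤ 1 / (1 + 1 / (2 * R)) := by
      rw [hq, Real.exp_neg, ← one_div]
      apply one_div_le_one_div_of_le (by positivity)
      linarith [Real.add_one_le_exp (1 / (2 * R))]
    have h2 : 1 - 1 / (1 + 1 / (2 * R)) = 1 / (2 * R + 1) := by field_simp; ring
    have h3 : 1 / (3 * R) ≤ 1 / (2 * R + 1) :=
      one_div_le_one_div_of_le (by positivity) (by linarith)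
    linarith
  have hq1' : 0 < 1 - q := lt_of_lt_of_le (by positivity) hq1
  set S := ∑ k ∈ Finset.range (n + 1), Real.exp (-(k : ℝ) / R) * h k ^ 2 with hS
  set D := ∑ k ∈ Finset.range n, Real.exp (-((k + 1 : ℕ) : ℝ) / R) * (h (k + 1) - h k) ^ 2 with hD
  have hstep : ∀ k, Real.exp (-((k + 1 : ℕ) : ℝ) / R) * h (k + 1) ^ 2
      ≤ q * (Real.exp (-(k : ℝ) / R) * h k ^ 2)
        + 1 / (1 - q) * (Real.exp (-((k + 1 : ℕ) : ℝ) / R) * (h (k + 1) - h k) ^ 2) := by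
    intro k
    have e1 : Real.exp (-((k + 1 : ℕ) : ℝ) / R) = q ^ 2 * Real.exp (-(k : ℝ) / R) := by
      rw [hq, ← Real.exp_nat_mul, ← Real.exp_add]
      congr 1; push_cast; field_simp; ring
    have e2 : h (k + 1) ^ 2 ≤ 1 / q * h k ^ 2 + 1 / (1 - q) * (h (k + 1) - h k) ^ 2 := by
      have e3 : 1 / q * h k ^ 2 + 1 / (1 - q) * (h (k + 1) - h k) ^ 2 - h (k + 1) ^ 2
          = ((1 - q) * h k - q * (h (k + 1) - h k)) ^ 2 / (q * (1 - q)) := by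
        field_simp; ring
      have : 0 ≤ ((1 - q) * h k - q * (h (k + 1) - h k)) ^ 2 / (q * (1 - q)) := by positivity
      linarith
    have e4 := mul_le_mul_of_nonneg_left e2 (Real.exp_pos (-((k + 1 : ℕ) : ℝ) / R)).le
    refine e4.trans (le_of_eq ?_)
    rw [e1]
    field_simp
  have h1 : S ≤ q * S + 1 / (1 - q) * D := by
    have h2 : S = ∑ k ∈ Finset.range n, Real.exp (-((k + 1 : ℕ) : ℝ) / R) * h (k + 1) ^ 2 := by
      rw [hS, Finset.sum_range_succ']; simp [h0]
    have h3 : ∑ k ∈ Finset.range n, Real.exp (-(k : ℝ) / R) * h k ^ 2 ≤ S := by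
      rw [hS, Finset.sum_range_succ]
      have : 0 ≤ Real.exp (-(n : ℝ) / R) * h n ^ 2 := by positivity
      linarith
    calc S ≤ ∑ k ∈ Finset.range n, (q * (Real.exp (-(k : ℝ) / R) * h k ^ 2)
        + 1 / (1 - q) * (Real.exp (-((k + 1 : ℕ) : ℝ) / R) * (h (k + 1) - h k) ^ 2)) := by
          rw [h2]; exact Finset.sum_le_sum fun k _ => hstep k
      _ = q * ∑ k ∈ Finset.range n, Real.exp (-(k : ℝ) / R) * h k ^ 2 + 1 / (1 - q) * D := by
          rw [Finset.sum_add_distrib, ← Finset.mul_sum, ← Finset.mul_sum]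
      _ ≤ _ := by nlinarith
  have hD0 : 0 ≤ D := Finset.sum_nonneg fun _ _ => by positivity
  have h4 : (1 - q) ^ 2 * S ≤ D := by
    have : (1 - q) * S ≤ 1 / (1 - q) * D := by linarith
    rw [one_div, ← div_eq_inv_mul, le_div_iff₀ hq1'] at this
    nlinarith
  have h5 : 1 ≤ 9 * R ^ 2 * (1 - q) ^ 2 := by
    have h6 : 1 ≤ (1 - q) * (3 * R) := by rwa [div_le_iff₀ (by positivity)] at hq1
    nlinarith
  have hS0 : 0 ≤ S := Finset.sum_nonneg fun _ _ => by positivity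
  nlinarith [mul_le_mul_of_nonneg_right h5 hS0, mul_le_mul_of_nonneg_left h4 (sq_nonneg R)]

variable {N : ℕ} [NeZero N]

omit [NeZero N] in
theorem cast_injOn_half : Set.InjOn (fun k : ℕ => (k : ZMod N)) (Finset.range (N / 2 + 1)) := by
  intro k hk l hl hkl
  have hk' := Nat.lt_succ_iff.1 (Finset.mem_range.1 hk)
  have hl' := Nat.lt_succ_iff.1 (Finset.mem_range.1 hl)
  have := congrArg ZMod.valMinAbs hkl
  simp only [ZMod.valMinAbs_natCast_of_le_half hk', ZMod.valMinAbs_natCast_of_le_half hl'] at this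
  exact_mod_cast this

/-- The one-dimensional weighted inequality on the cycle. -/
theorem hardy_cycle {R : ℝ} (hR : 1 ≤ R) (g : ZMod N → ℝ) :
    ∑ j : ZMod N, Real.exp (-(j.valMinAbs.natAbs : ℝ) / R) * (g j - g 0) ^ 2
      ≤ 18 * R ^ 2 * ∑ j : ZMod N, Real.exp (-(j.valMinAbs.natAbs : ℝ) / R)
        * (g (j + 1) - g j) ^ 2 := by
  have hR0 : 0 < R := by linarith
  set n := N / 2
  set Γ : ZMod N → ℝ := fun j => Real.exp (-(j.valMinAbs.natAbs : ℝ) / R) * (g (j + 1) - g j) ^ 2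
    with hΓ
  have hΓ0 : ∀ j, 0 ≤ Γ j := fun j => by positivity
  have habs : ∀ k ≤ n, ((k : ZMod N).valMinAbs.natAbs) = k := fun k hk => by
    rw [ZMod.valMinAbs_natCast_of_le_half hk]; simp
  have hinj : Set.InjOn (fun k : ℕ => (k : ZMod N)) (Finset.range (n + 1)) := cast_injOn_half
  have hpos : ∑ k ∈ Finset.range (n + 1), Real.exp (-(k : ℝ) / R) * (g (k : ZMod N) - g 0) ^ 2
      ≤ 9 * R ^ 2 * ∑ j, Γ j := by
    refine (hardy_exp hR (fun k => g (k : ZMod N) - g 0) (by simp) n).trans ?_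
    refine mul_le_mul_of_nonneg_left ?_ (by positivity)
    have h1 : ∑ k ∈ Finset.range n, Γ (k : ZMod N) ≤ ∑ j, Γ j := by
      rw [← Finset.sum_image (g := fun k : ℕ => (k : ZMod N)) (f := Γ)]
      · exact Finset.sum_le_sum_of_subset_of_nonneg (Finset.subset_univ _) fun j _ _ => hΓ0 j
      · exact hinj.mono (by simp)
    refine (Finset.sum_le_sum fun k hk => ?_).trans h1
    have hk' := (Finset.mem_range.1 hk).le
    simp only [hΓ, habs k hk']
    have e : g ((k + 1 : ℕ) : ZMod N) - g 0 - (g (k : ZMod N) - g 0)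
        = g ((k : ZMod N) + 1) - g k := by push_cast; ring
    rw [e]
    refine mul_le_mul_of_nonneg_right (Real.exp_le_exp.2 ?_) (sq_nonneg _)
    refine div_le_div_of_nonneg_right ?_ hR0.le
    push_cast; linarith
  have hneg : ∑ k ∈ Finset.range (n + 1), Real.exp (-(k : ℝ) / R) * (g (-(k : ZMod N)) - g 0) ^ 2
      ≤ 9 * R ^ 2 * ∑ j, Γ j := by
    refine (hardy_exp hR (fun k => g (-(k : ZMod N)) - g 0) (by simp) n).trans ?_
    refine mul_le_mul_of_nonneg_left ?_ (by positivity)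
    have h1 : ∑ k ∈ Finset.range n, Γ (-((k + 1 : ℕ) : ZMod N)) ≤ ∑ j, Γ j := by
      rw [← Finset.sum_image (g := fun k : ℕ => (-((k + 1 : ℕ) : ZMod N))) (f := Γ)]
      · exact Finset.sum_le_sum_of_subset_of_nonneg (Finset.subset_univ _) fun j _ _ => hΓ0 j
      · intro k hk l hl hkl
        have hk' : k + 1 ∈ Finset.range (n + 1) := by simpa using hk
        have hl' : l + 1 ∈ Finset.range (n + 1) := by simpa using hl
        have := hinj hk' hl' (neg_injective hkl)
        omega
    refine (Finset.sum_le_sum fun k hk => ?_).trans h1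
    have hk' : k + 1 ≤ n := Finset.mem_range.1 hk
    simp only [hΓ, ZMod.natAbs_valMinAbs_neg, habs (k + 1) hk']
    have e : g (-((k + 1 : ℕ) : ZMod N)) - g 0 - (g (-(k : ZMod N)) - g 0)
        = -(g (-((k + 1 : ℕ) : ZMod N) + 1) - g (-((k + 1 : ℕ) : ZMod N))) := by
      push_cast; ring_nf
    rw [e, neg_sq]
  have h2 := sum_zmod_le (fun j : ZMod N => Real.exp (-(j.valMinAbs.natAbs : ℝ) / R)
    * (g j - g 0) ^ 2) fun j => by positivity
  rw [Finset.sum_add_distrib] at h2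
  have e1 : ∑ k ∈ Finset.range (n + 1), Real.exp (-(((k : ZMod N).valMinAbs.natAbs : ℕ) : ℝ) / R)
      * (g (k : ZMod N) - g 0) ^ 2
      = ∑ k ∈ Finset.range (n + 1), Real.exp (-(k : ℝ) / R) * (g (k : ZMod N) - g 0) ^ 2 :=
    Finset.sum_congr rfl fun k hk => by rw [habs k (Nat.lt_succ_iff.1 (Finset.mem_range.1 hk))]
  have e2 : ∑ k ∈ Finset.range (n + 1),
      Real.exp (-(((-(k : ZMod N)).valMinAbs.natAbs : ℕ) : ℝ) / R) * (g (-(k : ZMod N)) - g 0) ^ 2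
      = ∑ k ∈ Finset.range (n + 1), Real.exp (-(k : ℝ) / R) * (g (-(k : ZMod N)) - g 0) ^ 2 :=
    Finset.sum_congr rfl fun k hk => by
      rw [ZMod.natAbs_valMinAbs_neg, habs k (Nat.lt_succ_iff.1 (Finset.mem_range.1 hk))]
  rw [e1, e2] at h2
  linarith

section Product

variable {d : ℕ} {X : Type*}

/-- Exchange the coordinates in `P` of two points of a product. -/
def swapCoords (P : Fin d → Prop) [DecidablePred P] (p : (Fin d → X) × (Fin d → X)) :
    (Fin d → X) × (Fin d → X) :=
  (fun i => if P i then p.2 i else p.1 i, fun i => if P i then p.1 i else p.2 i)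

theorem swapCoords_involutive (P : Fin d → Prop) [DecidablePred P] :
    Function.Involutive (swapCoords (X := X) P) := by
  rintro ⟨x, y⟩
  simp only [swapCoords, Prod.mk.injEq]
  constructor <;> ext i <;> by_cases h : P i <;> simp [h]

variable [Fintype X] [DecidableEq X]

omit [DecidableEq X] in
theorem sum_swapCoords (w : X → ℝ) (P : Fin d → Prop) [DecidablePred P]
    (Ψ : (Fin d → X) × (Fin d → X) → ℝ) :
    ∑ p : (Fin d → X) × (Fin d → X), (∏ i, w (p.1 i)) * (∏ i, w (p.2 i)) * Ψ (swapCoords P p)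
      = ∑ p : (Fin d → X) × (Fin d → X), (∏ i, w (p.1 i)) * (∏ i, w (p.2 i)) * Ψ p := by
  refine Fintype.sum_equiv (swapCoords_involutive P).toPerm _ _ fun p => ?_
  simp only [Function.Involutive.coe_toPerm]
  congr 1
  rw [← Finset.prod_mul_distrib, ← Finset.prod_mul_distrib]
  refine Finset.prod_congr rfl fun i _ => ?_
  by_cases h : P i <;> simp [swapCoords, h, mul_comm]

omit [DecidableEq X] in
/-- Tensorization of variances: change the coordinates of one point into those of the other one at
a time, and exchange the coordinates already changed. -/
theorem sum_sq_sub_le (w : X → ℝ) (hw : ∀ j, 0 ≤ w j) (o : X) (f : (Fin d → X) → ℝ) :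
    ∑ x : Fin d → X, ∑ y : Fin d → X, (∏ i, w (x i)) * (∏ i, w (y i)) * (f x - f y) ^ 2
      ≤ 4 * d * (∑ x : Fin d → X, ∏ i, w (x i))
        * ∑ i, ∑ x : Fin d → X, (∏ i, w (x i)) * (f x - f (Function.update x i o)) ^ 2 := by
  set π : (Fin d → X) → ℝ := fun x => ∏ i, w (x i) with hπ
  have hπ0 : ∀ x, 0 ≤ π x := fun x => Finset.prod_nonneg fun i _ => hw _
  set hyb : ℕ → (Fin d → X) → (Fin d → X) → (Fin d → X) :=
    fun k x y i => if (i : ℕ) < k then y i else x i with hhyb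
  have hyb0 : ∀ x y, hyb 0 x y = x := fun x y => by simp [hhyb]
  have hybd : ∀ x y, hyb d x y = y := fun x y => by ext i; simp [hhyb]
  have htel : ∀ x y, (f x - f y) ^ 2
      ≤ d * ∑ k : Fin d, (f (hyb k x y) - f (hyb (k + 1) x y)) ^ 2 := by
    intro x y
    have h1 : f x - f y = ∑ k : Fin d, (f (hyb k x y) - f (hyb (k + 1) x y)) := by
      rw [Fin.sum_univ_eq_sum_range (fun k => f (hyb k x y) - f (hyb (k + 1) x y)) d,
        Finset.sum_range_sub' (fun k => f (hyb k x y)), hyb0, hybd]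
    rw [h1]
    have := sq_sum_le_card_mul_sum_sq (s := (Finset.univ : Finset (Fin d)))
      (f := fun k : Fin d => f (hyb k x y) - f (hyb (k + 1) x y))
    simpa using this
  have hk : ∀ k : Fin d, ∑ p : (Fin d → X) × (Fin d → X),
      π p.1 * π p.2 * (f (hyb k p.1 p.2) - f (hyb (k + 1) p.1 p.2)) ^ 2
      ≤ 4 * (∑ x, π x) * ∑ x, π x * (f x - f (Function.update x k o)) ^ 2 := by
    intro k
    have h1 := sum_swapCoords w (fun i : Fin d => (i : ℕ) < k)
      (fun p => (f p.1 - f (Function.update p.1 k (p.2 k))) ^ 2)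
    have h2 : ∀ p : (Fin d → X) × (Fin d → X),
        f (hyb (k + 1) p.1 p.2) = f (Function.update
          (swapCoords (fun i : Fin d => (i : ℕ) < k) p).1 k
          ((swapCoords (fun i : Fin d => (i : ℕ) < k) p).2 k)) := by
      intro p
      congr 1
      ext i
      by_cases hi : i = k
      · subst hi; simp [hhyb, swapCoords]
      · have : (i : ℕ) ≠ k := fun h => hi (Fin.ext h)
        simp only [hhyb, swapCoords, Function.update_of_ne hi]
        have e : (i : ℕ) < k + 1 ↔ (i : ℕ) < k := by omega
        simp only [e]
    have h3 : ∀ p : (Fin d → X) × (Fin d → X),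
        hyb k p.1 p.2 = (swapCoords (fun i : Fin d => (i : ℕ) < k) p).1 := fun p => rfl
    simp only [h2, h3]
    rw [h1]
    have h4 : ∀ p : (Fin d → X) × (Fin d → X),
        (∏ i, w (p.1 i)) * (∏ i, w (p.2 i)) * (f p.1 - f (Function.update p.1 k (p.2 k))) ^ 2
        ≤ 2 * ((∏ i, w (p.1 i)) * (∏ i, w (p.2 i)) * (f p.1 - f (Function.update p.1 k o)) ^ 2)
          + 2 * ((∏ i, w (p.1 i)) * (∏ i, w (p.2 i)) *
            (f (swapCoords (· = k) p).1 -
              f (Function.update (swapCoords (· = k) p).1 k o)) ^ 2) := by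
      intro p
      have e1 : (swapCoords (· = k) p).1 = Function.update p.1 k (p.2 k) := by
        ext i
        by_cases hi : i = k
        · subst hi; simp [swapCoords]
        · simp [swapCoords, hi]
      rw [e1, Function.update_idem]
      have h5 : 0 ≤ (∏ i, w (p.1 i)) * (∏ i, w (p.2 i)) := mul_nonneg (hπ0 _) (hπ0 _)
      have h6 : (f p.1 - f (Function.update p.1 k (p.2 k))) ^ 2
          ≤ 2 * (f p.1 - f (Function.update p.1 k o)) ^ 2
            + 2 * (f (Function.update p.1 k (p.2 k)) - f (Function.update p.1 k o)) ^ 2 := by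
        nlinarith [sq_nonneg (f p.1 - f (Function.update p.1 k o)
          + (f (Function.update p.1 k (p.2 k)) - f (Function.update p.1 k o)))]
      have := mul_le_mul_of_nonneg_left h6 h5
      linarith
    refine (Finset.sum_le_sum fun p _ => h4 p).trans (le_of_eq ?_)
    rw [Finset.sum_add_distrib, ← Finset.mul_sum, ← Finset.mul_sum,
      sum_swapCoords w (· = k) (fun p => (f p.1 - f (Function.update p.1 k o)) ^ 2)]
    have h7 : ∑ p : (Fin d → X) × (Fin d → X),
        (∏ i, w (p.1 i)) * (∏ i, w (p.2 i)) * (f p.1 - f (Function.update p.1 k o)) ^ 2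
        = (∑ x, π x) * ∑ x, π x * (f x - f (Function.update x k o)) ^ 2 := by
      rw [Fintype.sum_prod_type, Finset.mul_sum]
      refine Finset.sum_congr rfl fun x _ => ?_
      rw [Finset.sum_mul]
      refine Finset.sum_congr rfl fun y _ => ?_
      simp only [hπ]; ring
    rw [h7]; ring
  calc ∑ x : Fin d → X, ∑ y : Fin d → X, π x * π y * (f x - f y) ^ 2
      ≤ ∑ x : Fin d → X, ∑ y : Fin d → X, π x * π y *
          (d * ∑ k : Fin d, (f (hyb k x y) - f (hyb (k + 1) x y)) ^ 2) :=
        Finset.sum_le_sum fun x _ => Finset.sum_le_sum fun y _ =>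
          mul_le_mul_of_nonneg_left (htel x y) (mul_nonneg (hπ0 x) (hπ0 y))
    _ = d * ∑ k : Fin d, ∑ p : (Fin d → X) × (Fin d → X),
          π p.1 * π p.2 * (f (hyb k p.1 p.2) - f (hyb (k + 1) p.1 p.2)) ^ 2 := by
        rw [Finset.sum_comm (s := (Finset.univ : Finset (Fin d))), Fintype.sum_prod_type,
          Finset.mul_sum]
        refine Finset.sum_congr rfl fun x _ => ?_
        rw [Finset.mul_sum]
        refine Finset.sum_congr rfl fun y _ => ?_
        rw [← Finset.mul_sum]; ring
    _ ≤ d * ∑ k : Fin d, 4 * (∑ x, π x) * ∑ x, π x * (f x - f (Function.update x k o)) ^ 2 :=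
        mul_le_mul_of_nonneg_left (Finset.sum_le_sum fun k _ => hk k) (Nat.cast_nonneg d)
    _ = _ := by rw [← Finset.mul_sum]; ring

omit [DecidableEq X] in
theorem card_mul_sum_eq (F : (Fin d → X) → ℝ) (i : Fin d) :
    (Fintype.card X : ℝ) * ∑ x, F x = ∑ x, ∑ j, F (Function.update x i j) := by
  have hinv : Function.Involutive fun p : (Fin d → X) × X =>
      (Function.update p.1 i p.2, p.1 i) := by
    rintro ⟨x, j⟩
    simp
  have h := Fintype.sum_equiv hinv.toPerm (fun p : (Fin d → X) × X => F (Function.update p.1 i p.2))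
    (fun p => F p.1) fun p => rfl
  rw [Fintype.sum_prod_type, Fintype.sum_prod_type] at h
  rw [h, Finset.mul_sum]
  simp

end Product

variable {d : ℕ}

/-- The one-dimensional inequality along the lines of the torus in direction `i`. -/
theorem hardy_line {R : ℝ} (hR : 1 ≤ R) (f : Torus d N → ℝ) (i : Fin d) :
    ∑ x, Real.exp (-tnorm x / R) * (f x - f (Function.update x i 0)) ^ 2
      ≤ 18 * R ^ 2 * ∑ x, Real.exp (-tnorm x / R) * (f (x + unitVec i) - f x) ^ 2 := by
  have hN : (0 : ℝ) < Fintype.card (ZMod N) := by exact_mod_cast Fintype.card_pos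
  refine le_of_mul_le_mul_left ?_ hN
  rw [mul_left_comm, card_mul_sum_eq _ i, card_mul_sum_eq _ i, Finset.mul_sum]
  refine Finset.sum_le_sum fun x _ => ?_
  set w : ZMod N → ℝ := fun j => Real.exp (-(j.valMinAbs.natAbs : ℝ) / R) with hw
  have e1 : ∀ j, Real.exp (-tnorm (Function.update x i j) / R)
      = w j * ∏ k ∈ Finset.univ \ {i}, w (x k) := by
    intro j
    rw [exp_neg_tnorm]
    have := Finset.prod_update_of_mem (Finset.mem_univ i) (fun k => w (x k)) (w j)
    rw [← this]
    refine Finset.prod_congr rfl fun k _ => ?_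
    by_cases hk : k = i
    · subst hk; simp [hw]
    · simp [hk, hw]
  have e2 : ∀ j : ZMod N, Function.update x i j + unitVec i = Function.update x i (j + 1) := by
    intro j
    ext k
    by_cases hk : k = i
    · subst hk; simp [unitVec]
    · simp [unitVec, hk]
  simp only [Function.update_idem, e1, e2]
  have h := hardy_cycle hR (fun j => f (Function.update x i j))
  have hp : 0 ≤ ∏ k ∈ Finset.univ \ {i}, w (x k) :=
    Finset.prod_nonneg fun k _ => (Real.exp_pos _).le
  have h2 := mul_le_mul_of_nonneg_right h hp
  generalize ∏ k ∈ Finset.univ \ {i}, w (x k) = P at h2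
  calc ∑ j, w j * P * (f (Function.update x i j) - f (Function.update x i 0)) ^ 2
      = (∑ j, w j * (f (Function.update x i j) - f (Function.update x i 0)) ^ 2) * P := by
        rw [Finset.sum_mul]; exact Finset.sum_congr rfl fun j _ => by ring
    _ ≤ _ := h2
    _ = _ := by
        rw [mul_assoc, Finset.sum_mul]
        congr 1
        exact Finset.sum_congr rfl fun j _ => by simp only [hw]; ring

omit [NeZero N] in
theorem exp_tnorm_le_of_near {M R : ℝ} (hM : 0 ≤ M) (hR : 1 ≤ R) (x u v : Torus d N)
    (huv : tnorm (u - v) ≤ M) :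
    Real.exp (-tnorm (v - x) / R) ≤ Real.exp M * Real.exp (-tnorm (u - x) / R) := by
  rw [← Real.exp_add]
  apply Real.exp_le_exp.2
  have hR0 : 0 < R := by linarith
  have h1 : tnorm (u - x) ≤ M + tnorm (v - x) := by linarith [tnorm_sub_le u v x]
  have h2 : tnorm (u - x) / R ≤ M / R + tnorm (v - x) / R := by
    rw [← add_div]; exact div_le_div_of_nonneg_right h1 hR0.le
  have h3 : M / R ≤ M := div_le_self hM hR
  rw [neg_div, neg_div]; linarith

/-- The weighted Poincaré inequality for the weights `exp (-|z - x| / R)`. -/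
theorem TorusChain.weighted_poincare {K M : ℝ} {c : Torus d N → Torus d N → ℝ} (hK : 0 ≤ K)
    (hM : 0 ≤ M) (h : TorusChain d N K M c) {R : ℝ} (hR : 1 ≤ R) (x : Torus d N)
    (f : Torus d N → ℝ) {π : Torus d N → ℝ} (hπ : ∀ z, π z = Real.exp (-tnorm (z - x) / R)) :
    ∑ z, π z * (f z - (∑ y, π y * f y) / ∑ y, π y) ^ 2
      ≤ 72 * d ^ 2 * (K * Real.exp M * (Real.exp M * 16 ^ d)) * R ^ 2
        * ∑ a, ∑ b, c a b * (min (π a) (π b) * (f a - f b) ^ 2) := by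
  have hπpos : ∀ z, 0 < π z := fun z => by rw [hπ]; exact Real.exp_pos _
  set W := ∑ y, π y with hW
  have hW0 : 0 < W := Finset.sum_pos (fun z _ => hπpos z) ⟨x, Finset.mem_univ x⟩
  set m := (∑ y, π y * f y) / W with hm
  set E := ∑ a, ∑ b, c a b * (min (π a) (π b) * (f a - f b) ^ 2) with hE
  -- variance as a double sum
  have h1 : W * ∑ z, π z * (f z - m) ^ 2 ≤ ∑ z, ∑ y, π z * π y * (f z - f y) ^ 2 := by
    rw [Finset.mul_sum]
    refine Finset.sum_le_sum fun z _ => ?_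
    have h2 : ∑ y, π y * (f z - f y) ^ 2 = W * (f z - m) ^ 2 + ∑ y, π y * (f y - m) ^ 2 := by
      have e : ∀ y, π y * (f z - f y) ^ 2 = π y * (f z - m) ^ 2 + π y * (f y - m) ^ 2
          - 2 * (f z - m) * (π y * f y - π y * m) := fun y => by ring
      simp only [e]
      rw [Finset.sum_sub_distrib, Finset.sum_add_distrib, ← Finset.sum_mul, ← Finset.mul_sum,
        Finset.sum_sub_distrib, ← Finset.sum_mul]
      have : ∑ y, π y * f y = W * m := by rw [hm]; field_simp
      rw [this]; ring
    have h3 : 0 ≤ ∑ y, π y * (f y - m) ^ 2 := Finset.sum_nonneg fun y _ =>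
      mul_nonneg (hπpos y).le (sq_nonneg _)
    have h4 : ∑ y, π z * π y * (f z - f y) ^ 2 = π z * ∑ y, π y * (f z - f y) ^ 2 := by
      rw [Finset.mul_sum]; exact Finset.sum_congr rfl fun y _ => by ring
    rw [h4, h2]
    nlinarith [mul_nonneg (hπpos z).le h3]
  -- tensorization, after moving the centre to the origin
  set f₀ : Torus d N → ℝ := fun z => f (z + x) with hf₀
  have hshift : ∀ z, π (z + x) = Real.exp (-tnorm z / R) := fun z => by rw [hπ]; simp
  have h2 : ∑ z, ∑ y, π z * π y * (f z - f y) ^ 2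
      ≤ 4 * d * W * ∑ i, ∑ z,
        Real.exp (-tnorm z / R) * (f₀ z - f₀ (Function.update z i 0)) ^ 2 := by
    have h3 := sum_sq_sub_le (d := d) (fun j : ZMod N => Real.exp (-(j.valMinAbs.natAbs : ℝ) / R))
      (fun j => (Real.exp_pos _).le) 0 f₀
    simp only [← exp_neg_tnorm] at h3
    have e1 : W = ∑ z : Torus d N, Real.exp (-tnorm z / R) := by
      rw [hW, ← sum_shift_add π x]
      exact Finset.sum_congr rfl fun z _ => hshift z
    have e2 : ∑ z, ∑ y, π z * π y * (f z - f y) ^ 2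
        = ∑ z, ∑ y, Real.exp (-tnorm z / R) * Real.exp (-tnorm y / R) * (f₀ z - f₀ y) ^ 2 := by
      rw [← sum_shift_add _ x]
      refine Finset.sum_congr rfl fun z _ => ?_
      rw [← sum_shift_add _ x]
      exact Finset.sum_congr rfl fun y _ => by rw [hshift, hshift]
    rw [e1, e2]
    exact h3
  have h3 : ∀ i : Fin d, ∑ z, Real.exp (-tnorm z / R) * (f₀ z - f₀ (Function.update z i 0)) ^ 2
      ≤ 18 * R ^ 2 * (K * Real.exp M * (Real.exp M * 16 ^ d) * E) := by
    intro i
    refine (hardy_line hR f₀ i).trans (mul_le_mul_of_nonneg_left ?_ (by positivity))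
    have h4 := h.sum_edge_le hK (fun z => (hπpos z).le) (Real.exp_pos M).le
      (fun u v huv => by
        rw [hπ, hπ]; exact exp_tnorm_le_of_near hM hR x u v huv) f i
    refine le_trans (le_of_eq ?_) h4
    rw [← sum_shift_add (fun u => π u * (f (u + unitVec i) - f u) ^ 2) x]
    refine Finset.sum_congr rfl fun z _ => ?_
    rw [hshift]
    simp only [hf₀]
    rw [add_right_comm]
  have h4 : ∑ i : Fin d, ∑ z, Real.exp (-tnorm z / R) * (f₀ z - f₀ (Function.update z i 0)) ^ 2
      ≤ d * (18 * R ^ 2 * (K * Real.exp M * (Real.exp M * 16 ^ d) * E)) := by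
    refine (Finset.sum_le_sum fun i _ => h3 i).trans ?_
    simp
  have h5 := h1.trans (h2.trans (mul_le_mul_of_nonneg_left h4
    (show 0 ≤ 4 * d * W by positivity)))
  refine le_of_mul_le_mul_left (h5.trans (le_of_eq ?_)) hW0
  ring

end Poincare

/-! ### Near-diagonal lower bound for the heat kernel -/

section LowerBound

/-- This is `a ≤ sinh a` for `a = log r`. -/
theorem two_log_le_sub_inv {r : ℝ} (hr : 1 ≤ r) : 2 * Real.log r ≤ r - r⁻¹ := by
  have hr0 : 0 < r := by linarith
  have h := Real.self_le_sinh_iff.2 (Real.log_nonneg hr)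
  rw [Real.sinh_eq, Real.exp_neg, Real.exp_log hr0] at h
  linarith

/-- The energy inequality behind the estimate of the mean logarithm. -/
theorem log_energy_le {a b p q : ℝ} (ha : 0 < a) (hb : 0 < b) (hp : 0 < p) (hq : 0 < q) :
    1 / 2 * (min (p ^ 2) (q ^ 2) * (Real.log a - Real.log b) ^ 2) - 2 * (p - q) ^ 2
      ≤ -((p ^ 2 / a - q ^ 2 / b) * (a - b)) := by
  have key : ∀ a b p q : ℝ, 0 < a → a ≤ b → 0 < p → 0 < q →
      1 / 2 * (min (p ^ 2) (q ^ 2) * (Real.log a - Real.log b) ^ 2) - 2 * (p - q) ^ 2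
      ≤ -((p ^ 2 / a - q ^ 2 / b) * (a - b)) := by
    intro a b p q ha hab hp hq
    have hb : 0 < b := ha.trans_le hab
    set r := Real.sqrt (b / a) with hr
    have hr2 : r ^ 2 = b / a := Real.sq_sqrt (div_pos hb ha).le
    have hr1 : 1 ≤ r := Real.one_le_sqrt.2 ((one_le_div ha).2 hab)
    have hr0 : 0 < r := by linarith
    have hbr : b = r ^ 2 * a := by rw [hr2]; field_simp
    have hlog : Real.log b - Real.log a = 2 * Real.log r := by
      rw [hbr, Real.log_mul (by positivity) ha.ne', Real.log_pow]; push_cast; ring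
    set s := 2 * Real.log r with hs
    have hs0 : 0 ≤ s := mul_nonneg (by norm_num) (Real.log_nonneg hr1)
    have hsr : s ≤ r - r⁻¹ := two_log_le_sub_inv hr1
    have e1 : -((p ^ 2 / a - q ^ 2 / b) * (a - b)) = (p * r - q * r⁻¹) ^ 2 - (p - q) ^ 2 := by
      rw [hbr]; field_simp; ring
    have e2 : (Real.log a - Real.log b) ^ 2 = s ^ 2 := by rw [← hlog]; ring
    have hmin : min (p ^ 2) (q ^ 2) = min p q ^ 2 := by
      rcases le_total p q with h | h
      · rw [min_eq_left h, min_eq_left (pow_le_pow_left₀ hp.le h 2)]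
      · rw [min_eq_right h, min_eq_right (pow_le_pow_left₀ hq.le h 2)]
    have hrinv : r⁻¹ ≤ 1 := inv_le_one_of_one_le₀ hr1
    have hrinv0 : 0 < r⁻¹ := inv_pos.2 hr0
    have h1 : min p q * s ≤ |p * r - q * r⁻¹| + |p - q| := by
      rcases le_total p q with h | h
      · rw [min_eq_left h]
        have : |p - q| = q - p := by rw [abs_of_nonpos (by linarith)]; ring
        rw [this]
        have h2 := le_abs_self (p * r - q * r⁻¹)
        nlinarith [mul_le_mul_of_nonneg_left hsr hp.le]
      · rw [min_eq_right h]
        have h2 := le_abs_self (p * r - q * r⁻¹)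
        have h3 := abs_nonneg (p - q)
        nlinarith [mul_le_mul_of_nonneg_left hsr hq.le]
    have h2 : (min p q * s) ^ 2 ≤ 2 * (p * r - q * r⁻¹) ^ 2 + 2 * (p - q) ^ 2 := by
      have h0 : 0 ≤ min p q * s := mul_nonneg (le_min hp.le hq.le) hs0
      have h3 := pow_le_pow_left₀ h0 h1 2
      rw [← sq_abs (p * r - q * r⁻¹), ← sq_abs (p - q)]
      nlinarith [sq_nonneg (|p * r - q * r⁻¹| - |p - q|)]
    rw [e1, e2, hmin]
    rw [mul_pow] at h2
    linarith
  rcases le_total a b with h | h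
  · exact key a b p q ha h hp hq
  · have := key b a q p hb h hq hp
    rw [min_comm] at this
    linarith [this, show (p - q) ^ 2 = (q - p) ^ 2 by ring,
      show min (p ^ 2) (q ^ 2) * (Real.log a - Real.log b) ^ 2
        = min (p ^ 2) (q ^ 2) * (Real.log b - Real.log a) ^ 2 by ring,
      show -((p ^ 2 / a - q ^ 2 / b) * (a - b)) = -((q ^ 2 / b - p ^ 2 / a) * (b - a)) by ring]

theorem IsHeatSol.hasDerivAt_sum_log {V : Type*} [Fintype V] {c : V → V → ℝ}
    (hc : ∀ u v, 0 ≤ c u v) (hs : ∀ u v, c u v = c v u) {u : ℝ → V → ℝ} (hu : IsHeatSol c u) {t : ℝ}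
    (hpos : ∀ z, 0 < u t z) {p : V → ℝ} (hp : ∀ z, 0 < p z) :
    ∃ G' : ℝ, HasDerivAt (fun s => ∑ z, p z ^ 2 * Real.log (u s z)) G' t ∧
      1 / 4 * (∑ z, ∑ w, c z w * (min (p z ^ 2) (p w ^ 2)
        * (Real.log (u t z) - Real.log (u t w)) ^ 2))
      - ∑ z, ∑ w, c z w * (p z - p w) ^ 2 ≤ G' := by
  have h1 := HasDerivAt.fun_sum (u := Finset.univ) fun z _ =>
    ((hu t z).log (hpos z).ne').const_mul (p z ^ 2)
  refine ⟨_, h1, ?_⟩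
  have h2 : ∑ z, p z ^ 2 * ((∑ w, c z w * (u t w - u t z)) / u t z)
      = ∑ z, p z ^ 2 / u t z * ∑ w, c z w * (u t w - u t z) :=
    Finset.sum_congr rfl fun z _ => by ring
  rw [h2, sum_mul_gen hs (fun z => p z ^ 2 / u t z) (u t)]
  have h3 : 1 / 2 * (∑ z, ∑ w, c z w * (min (p z ^ 2) (p w ^ 2)
        * (Real.log (u t z) - Real.log (u t w)) ^ 2))
      - 2 * ∑ z, ∑ w, c z w * (p z - p w) ^ 2
      ≤ -∑ z, ∑ w, c z w * ((p z ^ 2 / u t z - p w ^ 2 / u t w) * (u t z - u t w)) := by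
    simp only [Finset.mul_sum, ← Finset.sum_sub_distrib, ← Finset.sum_neg_distrib]
    refine Finset.sum_le_sum fun z _ => Finset.sum_le_sum fun w _ => ?_
    have := mul_le_mul_of_nonneg_left (log_energy_le (hpos z) (hpos w) (hp z) (hp w)) (hc z w)
    linarith
  linarith

/-- A Riccati type differential inequality forces the solution below a universal bound. -/
theorem riccati_bound {h h' : ℝ → ℝ} {t₀ τ b B : ℝ} (hτ : 0 < τ) (hb : 0 < b) (hB : 0 ≤ B)
    (hd : ∀ s ∈ Set.Icc t₀ (t₀ + τ), HasDerivAt h (h' s) s)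
    (h1 : ∀ s ∈ Set.Icc t₀ (t₀ + τ), h' s ≤ B / τ)
    (h2 : ∀ s ∈ Set.Icc t₀ (t₀ + τ), 0 ≤ h s → h' s ≤ (B - b * h s ^ 2) / τ) :
    h (t₀ + τ) ≤ B + (2 * B / b + 1) + 2 / b := by
  by_contra hcon
  push Not at hcon
  set T := t₀ + τ with hT
  have hle : t₀ ≤ T := by linarith
  set H₀ := 2 * B / b + 1 with hH₀
  have hH₀1 : 1 ≤ H₀ := by
    have : 0 ≤ 2 * B / b := by positivity
    linarith
  have hbH : 2 * B ≤ b * H₀ := by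
    rw [hH₀, mul_add, mul_div_cancel₀ _ hb.ne']; linarith
  -- `h` increases by at most `B`, so it is large on the whole interval
  have hlow : ∀ s ∈ Set.Icc t₀ T, H₀ ≤ h s := by
    intro s hs
    have hanti : AntitoneOn (fun s => h s - B / τ * s) (Set.Icc t₀ T) := by
      have hd' : ∀ s ∈ Set.Icc t₀ T, HasDerivAt (fun s => h s - B / τ * s) (h' s - B / τ) s :=
        fun s hs => ((hd s hs).sub ((hasDerivAt_id s).const_mul (B / τ))).congr_deriv (by simp)
      refine antitoneOn_of_deriv_nonpos (convex_Icc _ _)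
        (fun s hs => (hd' s hs).continuousAt.continuousWithinAt)
        (fun s hs => (hd' s (interior_subset hs)).differentiableAt.differentiableWithinAt) ?_
      intro s hs
      rw [(hd' s (interior_subset hs)).deriv]
      linarith [h1 s (interior_subset hs)]
    have h3 := hanti hs (Set.right_mem_Icc.2 hle) hs.2
    simp only at h3
    have h4 : B / τ * (T - s) ≤ B := by
      rw [div_mul_eq_mul_div, div_le_iff₀ hτ]
      exact mul_le_mul_of_nonneg_left (by linarith [hs.1]) hB
    have h5 : 0 ≤ 2 / b := by positivity
    nlinarith
  have hpos : ∀ s ∈ Set.Icc t₀ T, 0 < h s := fun s hs => by linarith [hlow s hs]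
  have hmono : MonotoneOn (fun s => (h s)⁻¹ - b / (2 * τ) * s) (Set.Icc t₀ T) := by
    have hd' : ∀ s ∈ Set.Icc t₀ T, HasDerivAt (fun s => (h s)⁻¹ - b / (2 * τ) * s)
        (-h' s / h s ^ 2 - b / (2 * τ)) s := fun s hs =>
      (((hd s hs).inv (hpos s hs).ne').sub ((hasDerivAt_id s).const_mul (b / (2 * τ)))).congr_deriv
        (by simp)
    refine monotoneOn_of_deriv_nonneg (convex_Icc _ _)
      (fun s hs => (hd' s hs).continuousAt.continuousWithinAt)
      (fun s hs => (hd' s (interior_subset hs)).differentiableAt.differentiableWithinAt) ?_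
    intro s hs
    have hs' := interior_subset hs
    rw [(hd' s hs').deriv]
    have h3 := h2 s hs' (hpos s hs').le
    have h4 := hlow s hs'
    have h5 : B ≤ b / 2 * h s ^ 2 := by
      have h6 : H₀ ≤ h s ^ 2 := h4.trans (le_self_pow₀ (hH₀1.trans h4) two_ne_zero)
      linarith [mul_le_mul_of_nonneg_left h6 hb.le]
    have h6 : h' s ≤ -(b / (2 * τ)) * h s ^ 2 := by
      refine h3.trans ?_
      rw [div_le_iff₀ hτ]
      have : -(b / (2 * τ)) * h s ^ 2 * τ = -(b / 2 * h s ^ 2) := by field_simp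
      rw [this]; linarith
    rw [sub_nonneg, le_div_iff₀ (pow_pos (hpos s hs') 2)]
    linarith
  have h3 := hmono (Set.left_mem_Icc.2 hle) (Set.right_mem_Icc.2 hle) hle
  simp only at h3
  have h4 : 0 < (h t₀)⁻¹ := inv_pos.2 (hpos t₀ (Set.left_mem_Icc.2 hle))
  have h5 : b / (2 * τ) * T - b / (2 * τ) * t₀ = b / 2 := by rw [hT]; field_simp; ring
  have h6 : b / 2 ≤ (h T)⁻¹ := by linarith
  have h7 : 0 < h T := hpos T (Set.right_mem_Icc.2 hle)
  have h8 : h T ≤ 2 / b := by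
    rw [le_inv_comm₀ (by positivity) h7] at h6
    rwa [inv_div] at h6
  linarith

variable {d N : ℕ} [NeZero N]

/-- The set where the heat kernel has the right order of magnitude carries a fixed proportion of the
weights `exp (-|z - x| / R)`. -/
theorem heat_large_on_proportion {d : ℕ} (hd : 1 ≤ d) {K : ℝ} (hK : 0 ≤ K) (M : ℝ) :
    ∃ η : ℝ, 0 < η ∧ ∃ σ : ℝ, 0 < σ ∧ ∀ (N : ℕ) [NeZero N] (c : Torus d N → Torus d N → ℝ),
      TorusChain d N K M c → ∀ R : ℝ, 1 ≤ R → R ≤ N → ∀ x a : Torus d N, tnorm (a - x) ≤ d * R →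
      ∀ s, R ^ 2 / 4 ≤ s → s ≤ R ^ 2 →
        σ * (16 * R) ^ d ≤ ∑ z ∈ Finset.univ.filter (fun z => η / R ^ d ≤ heat c s a z),
          Real.exp (-tnorm (z - x) / R) := by
  obtain ⟨A, hA1, hA⟩ := heat_upper_bound d hK M
  obtain ⟨A', hA'1, hA'⟩ := heat_moment_bound hd hK M
  set Λ : ℝ := 2 * A' + d with hΛ
  set η : ℝ := (4 * Real.exp Λ * 16 ^ d)⁻¹ with hη
  refine ⟨η, by positivity, Real.exp (-Λ) / (4 * A * 2 ^ d * 16 ^ d), by positivity, ?_⟩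
  intro N _ c h R hR hRN x a hax s hs1 hs2
  have hR0 : 0 < R := by linarith
  have hs0 : 0 < s := lt_of_lt_of_le (by positivity) hs1
  set p : Torus d N → ℝ := fun z => heat c s a z with hp
  have hp0 : ∀ z, 0 ≤ p z := fun z => heat_nonneg h.nonneg hs0.le a z
  have hpA : ∀ z, p z ≤ A * 2 ^ d / R ^ d := by
    intro z
    refine (hA N c h s hs0 (hs2.trans (pow_le_pow_left₀ hR0.le hRN 2)) a z).trans ?_
    have h1 : R / 2 ≤ Real.sqrt s := by
      apply Real.le_sqrt_of_sq_le
      linarith [show (R / 2) ^ 2 = R ^ 2 / 4 by ring]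
    have h2 := pow_le_pow_left₀ (by positivity) h1 d
    calc A / Real.sqrt s ^ d ≤ A / (R / 2) ^ d :=
          div_le_div_of_nonneg_left (by linarith) (by positivity) h2
      _ = _ := by rw [div_pow]; field_simp
  set near := Finset.univ.filter fun z : Torus d N => tnorm (z - x) ≤ Λ * R with hnear
  set S := Finset.univ.filter (fun z => η / R ^ d ≤ p z) with hS
  have hmass : 1 / 2 ≤ ∑ z ∈ near, p z := by
    have h1 := hA' N c h R hR hRN a s hs0.le hs2
    have h2 : ∑ z ∈ Finset.univ.filter (fun z : Torus d N => ¬ tnorm (z - x) ≤ Λ * R), p z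
        * (2 * A' * R) ≤ A' * R := by
      refine le_trans (le_trans ?_ (Finset.sum_le_sum_of_subset_of_nonneg
        (Finset.subset_univ (Finset.univ.filter fun z : Torus d N => ¬ tnorm (z - x) ≤ Λ * R))
          fun z _ _ => mul_nonneg (hp0 z) (tnorm_nonneg (z - a)))) h1
      refine Finset.sum_le_sum fun z hz => mul_le_mul_of_nonneg_left ?_ (hp0 z)
      rw [Finset.mem_filter] at hz
      have h3 := tnorm_sub_le z a x
      have h4 := not_le.1 hz.2
      rw [hΛ, add_mul] at h4
      linarith
    rw [← Finset.sum_mul] at h2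
    have h3 : ∑ z ∈ near, p z
        + ∑ z ∈ Finset.univ.filter (fun z : Torus d N => ¬ tnorm (z - x) ≤ Λ * R), p z = 1 := by
      rw [← sum_heat h.symm s a]
      exact Finset.sum_filter_add_sum_filter_not Finset.univ
        (fun z : Torus d N => tnorm (z - x) ≤ Λ * R) p
    have h4 : 0 < A' * R := by positivity
    nlinarith
  have hsmall : ∑ z ∈ near.filter (fun z => ¬ η / R ^ d ≤ p z), p z ≤ 1 / 4 := by
    calc ∑ z ∈ near.filter (fun z => ¬ η / R ^ d ≤ p z), p z
        ≤ ∑ _z ∈ near.filter (fun z => ¬ η / R ^ d ≤ p z), η / R ^ d :=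
          Finset.sum_le_sum fun z hz => (not_le.1 (Finset.mem_filter.1 hz).2).le
      _ ≤ near.card * (η / R ^ d) := by
          rw [Finset.sum_const, nsmul_eq_mul]
          refine mul_le_mul_of_nonneg_right ?_ (by positivity)
          exact_mod_cast Finset.card_filter_le _ _
      _ ≤ Real.exp Λ * (16 * R) ^ d * (η / R ^ d) :=
          mul_le_mul_of_nonneg_right (card_ball_le hR x) (by positivity)
      _ = 1 / 4 := by rw [hη, mul_pow]; field_simp
  have hbig : 1 / 4 ≤ ∑ z ∈ near.filter (fun z => η / R ^ d ≤ p z), p z := by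
    have := Finset.sum_filter_add_sum_filter_not near (fun z => η / R ^ d ≤ p z) p
    linarith
  set S' := near.filter (fun z => η / R ^ d ≤ p z) with hS'
  have hcard : 1 / 4 ≤ S'.card * (A * 2 ^ d / R ^ d) := by
    refine hbig.trans ((Finset.sum_le_sum fun z _ => hpA z).trans (le_of_eq ?_))
    rw [Finset.sum_const, nsmul_eq_mul]
  have hsub : S' ⊆ S := fun z hz =>
    Finset.mem_filter.2 ⟨Finset.mem_univ z, (Finset.mem_filter.1 hz).2⟩
  calc Real.exp (-Λ) / (4 * A * 2 ^ d * 16 ^ d) * (16 * R) ^ d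
      ≤ S'.card * Real.exp (-Λ) := by
        have h1 : R ^ d ≤ S'.card * (4 * A * 2 ^ d) := by
          rw [mul_div_assoc', le_div_iff₀ (by positivity)] at hcard
          linarith
        rw [mul_pow]
        have h2 : Real.exp (-Λ) / (4 * A * 2 ^ d * 16 ^ d) * (16 ^ d * R ^ d)
            = Real.exp (-Λ) * R ^ d / (4 * A * 2 ^ d) := by field_simp
        rw [h2, div_le_iff₀ (by positivity)]
        nlinarith [mul_le_mul_of_nonneg_left h1 (Real.exp_pos (-Λ)).le]
    _ ≤ ∑ z ∈ S', Real.exp (-tnorm (z - x) / R) := by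
        rw [← nsmul_eq_mul, ← Finset.sum_const]
        refine Finset.sum_le_sum fun z hz => Real.exp_le_exp.2 ?_
        have h1 := (Finset.mem_filter.1 (Finset.mem_filter.1 hz).1).2
        rw [neg_div, neg_le_neg_iff, div_le_iff₀ hR0]
        exact h1
    _ ≤ _ := Finset.sum_le_sum_of_subset_of_nonneg hsub fun _ _ _ => (Real.exp_pos _).le

/-- The energy of the square roots of the weights `exp (-|z - x| / R)`. -/
theorem TorusChain.sqrt_weight_energy {K M : ℝ} {c : Torus d N → Torus d N → ℝ}
    (h : TorusChain d N K M c) {R : ℝ} (hR : 0 < R) (x : Torus d N) :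
    ∑ z, ∑ w, c z w *
      (Real.exp (-tnorm (z - x) / (2 * R)) - Real.exp (-tnorm (w - x) / (2 * R))) ^ 2
      ≤ K / (2 * R ^ 2) * ∑ z, Real.exp (-tnorm (z - x) / R) := by
  set p : Torus d N → ℝ := fun z => Real.exp (-tnorm (z - x) / (2 * R)) with hp
  have hp2 : ∀ z, Real.exp (-tnorm (z - x) / R) = p z ^ 2 := fun z => by
    simp only [hp]
    rw [← Real.exp_nat_mul]; congr 1; push_cast; field_simp
  simp only [hp2]
  have hexp : ∀ a b : ℝ, (Real.exp a - Real.exp b) ^ 2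
      ≤ (a - b) ^ 2 * (Real.exp a ^ 2 + Real.exp b ^ 2) := by
    have key : ∀ a b : ℝ, b ≤ a → (Real.exp a - Real.exp b) ^ 2 ≤ (a - b) ^ 2 * Real.exp a ^ 2 := by
      intro a b hab
      have h1 : Real.exp b = Real.exp a * Real.exp (b - a) := by rw [← Real.exp_add]; congr 1; ring
      have h2 := Real.add_one_le_exp (b - a)
      have h3 : Real.exp (b - a) ≤ 1 := Real.exp_le_one_iff.2 (by linarith)
      rw [h1, ← mul_one_sub, mul_pow, mul_comm]
      refine mul_le_mul_of_nonneg_right ?_ (sq_nonneg _)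
      exact pow_le_pow_left₀ (by linarith) (by linarith) 2
    intro a b
    rcases le_total b a with h | h
    · nlinarith [key a b h, mul_nonneg (sq_nonneg (a - b)) (sq_nonneg (Real.exp b))]
    · nlinarith [key b a h, mul_nonneg (sq_nonneg (a - b)) (sq_nonneg (Real.exp a))]
  set P : Torus d N → Torus d N → ℝ := fun z w => c z w * tnorm (z - w) ^ 2 with hP
  have h1 : ∀ z w, c z w * (p z - p w) ^ 2
      ≤ 1 / (4 * R ^ 2) * (P z w * p z ^ 2 + P z w * p w ^ 2) := by
    intro z w
    have h2 := hexp (-tnorm (z - x) / (2 * R)) (-tnorm (w - x) / (2 * R))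
    have h3 : (-tnorm (z - x) / (2 * R) - -tnorm (w - x) / (2 * R)) ^ 2
        ≤ 1 / (4 * R ^ 2) * tnorm (z - w) ^ 2 := by
      have e : (-tnorm (z - x) / (2 * R) - -tnorm (w - x) / (2 * R)) ^ 2
          = 1 / (4 * R ^ 2) * (tnorm (z - x) - tnorm (w - x)) ^ 2 := by field_simp; ring
      rw [e]
      refine mul_le_mul_of_nonneg_left ?_ (by positivity)
      rw [← sq_abs]
      exact pow_le_pow_left₀ (abs_nonneg _) (abs_tnorm_sub_tnorm_le x z w) 2
    have h4 := h2.trans (mul_le_mul_of_nonneg_right h3 (by positivity))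
    have h5 := mul_le_mul_of_nonneg_left h4 (h.nonneg z w)
    refine h5.trans (le_of_eq ?_)
    simp only [hP, hp]; ring
  have hsum : ∑ z, ∑ w, P z w * p z ^ 2 ≤ K * ∑ z, p z ^ 2 := by
    rw [Finset.mul_sum]
    refine Finset.sum_le_sum fun z _ => ?_
    rw [← Finset.sum_mul]
    exact mul_le_mul_of_nonneg_right (h.moment z) (sq_nonneg _)
  have hsum2 : ∑ z, ∑ w, P z w * p w ^ 2 = ∑ z, ∑ w, P z w * p z ^ 2 := by
    rw [Finset.sum_comm]
    refine Finset.sum_congr rfl fun z _ => Finset.sum_congr rfl fun w _ => ?_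
    simp only [hP]
    rw [h.symm, tnorm_sub_comm]
  calc ∑ z, ∑ w, c z w * (p z - p w) ^ 2
      ≤ ∑ z, ∑ w, 1 / (4 * R ^ 2) * (P z w * p z ^ 2 + P z w * p w ^ 2) :=
        Finset.sum_le_sum fun z _ => Finset.sum_le_sum fun w _ => h1 z w
    _ = 1 / (4 * R ^ 2) * (∑ z, ∑ w, P z w * p z ^ 2 + ∑ z, ∑ w, P z w * p w ^ 2) := by
        simp only [← Finset.mul_sum, Finset.sum_add_distrib]
    _ ≤ 1 / (4 * R ^ 2) * (2 * (K * ∑ z, p z ^ 2)) := by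
        rw [hsum2]
        exact mul_le_mul_of_nonneg_left (by linarith) (by positivity)
    _ = _ := by field_simp; ring

end LowerBound

section LogMean

/-- The weighted mean of `log (R^d u)` is bounded below at times of order `R²`: it satisfies a
Riccati type inequality, by the weighted Poincaré inequality and because `R^d u` is bounded below on
a fixed proportion of the weights. -/
theorem log_mean_lower_bound {d : ℕ} (hd : 1 ≤ d) {K M : ℝ} (hK : 0 ≤ K) (hM : 0 ≤ M) :
    ∃ σ : ℝ, 0 < σ ∧ ∃ C : ℝ, ∀ (N : ℕ) [NeZero N] (c : Torus d N → Torus d N → ℝ),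
      TorusChain d N K M c → ∀ R : ℝ, 1 ≤ R → R ≤ N → ∀ x a : Torus d N, tnorm (a - x) ≤ d * R →
      ∀ ε : ℝ, 0 < ε → ∀ π : Torus d N → ℝ, (∀ z, π z = Real.exp (-tnorm (z - x) / R)) →
        σ * R ^ d ≤ ∑ z, π z ∧
        -C * ∑ z, π z ≤ ∑ z, π z * (Real.log (heat c (R ^ 2 / 2) a z + ε) + d * Real.log R) := by
  obtain ⟨η, hη, σ, hσ, hprop⟩ := heat_large_on_proportion hd hK M
  set CP : ℝ := 72 * d ^ 2 * (K * Real.exp M * (Real.exp M * 16 ^ d)) + 1 with hCP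
  have hCP0 : 0 < CP := by positivity
  set B : ℝ := K / 8 with hB
  have hB0 : 0 ≤ B := by positivity
  set b : ℝ := σ / (16 * CP) with hb
  have hb0 : 0 < b := by positivity
  refine ⟨σ * 16 ^ d, by positivity, B + (2 * B / b + 1) + 2 / b - Real.log η, ?_⟩
  intro N _ c h R hR hRN x a hax ε hε π hπ
  have hR0 : 0 < R := by linarith
  have hπpos : ∀ z, 0 < π z := fun z => by rw [hπ]; exact Real.exp_pos _
  set W := ∑ z, π z with hW
  have hWlow : ∀ s, R ^ 2 / 4 ≤ s → s ≤ R ^ 2 → σ * (16 * R) ^ d ≤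
      ∑ z ∈ Finset.univ.filter (fun z => η / R ^ d ≤ heat c s a z), π z := by
    intro s h1 h2
    simpa only [hπ] using hprop N c h R hR hRN x a hax s h1 h2
  have hWσ : σ * (16 * R) ^ d ≤ W :=
    (hWlow (R ^ 2) (by nlinarith) le_rfl).trans
      (Finset.sum_le_sum_of_subset_of_nonneg (Finset.subset_univ _) fun z _ _ => (hπpos z).le)
  have hW0 : 0 < W := lt_of_lt_of_le (by positivity) hWσ
  have hWup : W ≤ (16 * R) ^ d := by
    have h1 := sum_shift (fun z : Torus d N => Real.exp (-tnorm z / R)) x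
    rw [hW]
    simp only [hπ]
    rw [h1]
    exact sum_exp_tnorm_le hR
  refine ⟨by rw [mul_pow] at hWσ; linarith, ?_⟩
  set u : ℝ → Torus d N → ℝ := fun s z => heat c s a z + ε with hu
  have husol : IsHeatSol c u := (isHeatSol_heat h.symm a).add_const ε
  have hupos : ∀ s, 0 ≤ s → ∀ z, 0 < u s z := fun s hs z => by
    have := heat_nonneg h.nonneg hs a z
    simp only [hu]; linarith
  set f : ℝ → Torus d N → ℝ := fun s z => Real.log (u s z) + d * Real.log R with hf
  set g : ℝ → ℝ := fun s => (∑ z, π z * f s z) / W with hg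
  set p : Torus d N → ℝ := fun z => Real.exp (-tnorm (z - x) / (2 * R)) with hp
  have hπp : ∀ z, π z = p z ^ 2 := fun z => by
    rw [hπ]
    simp only [hp]
    rw [← Real.exp_nat_mul]; congr 1; push_cast; field_simp
  set E : ℝ → ℝ := fun s => ∑ z, ∑ w, c z w * (min (π z) (π w) * (f s z - f s w) ^ 2) with hE
  have hE0 : ∀ s, 0 ≤ E s := fun s => Finset.sum_nonneg fun z _ => Finset.sum_nonneg fun w _ =>
    mul_nonneg (h.nonneg z w) (mul_nonneg (le_min (hπpos z).le (hπpos w).le) (sq_nonneg _))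
  have hgd : ∀ s, 0 ≤ s → ∃ g', HasDerivAt g g' s ∧ 1 / 4 * E s / W - K / (2 * R ^ 2) ≤ g' := by
    intro s hs
    obtain ⟨G', hG1, hG2⟩ := husol.hasDerivAt_sum_log h.nonneg h.symm (hupos s hs)
      (p := p) (fun z => Real.exp_pos _)
    have e1 : g = fun s => (∑ z, p z ^ 2 * Real.log (u s z) + W * (d * Real.log R)) / W := by
      ext s
      simp only [hg, hf, hW, mul_add, Finset.sum_add_distrib, Finset.sum_mul, hπp]
    refine ⟨G' / W, ?_, ?_⟩
    · rw [e1]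
      exact (hG1.add_const _).div_const W
    · have h1 := h.sqrt_weight_energy hR0 x
      have e2 : ∑ z, Real.exp (-tnorm (z - x) / R) = W := by simp only [hW, hπ]
      rw [e2] at h1
      have e3 : ∑ z, ∑ w, c z w * (min (p z ^ 2) (p w ^ 2)
          * (Real.log (u s z) - Real.log (u s w)) ^ 2) = E s := by
        simp only [hE, hf, hπp]
        refine Finset.sum_congr rfl fun z _ => Finset.sum_congr rfl fun w _ => ?_
        congr 3
        ring
      rw [e3] at hG2
      rw [le_div_iff₀ hW0, sub_mul, div_mul_cancel₀ _ hW0.ne']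
      have h2 : ∑ z, ∑ w, c z w * (p z - p w) ^ 2 ≤ K / (2 * R ^ 2) * W := h1
      linarith
  choose! g' hg' hg'low using hgd
  set τ : ℝ := R ^ 2 / 4 with hτ
  have hτ0 : 0 < τ := by positivity
  have hend : τ + τ = R ^ 2 / 2 := by rw [hτ]; ring
  have hKτ : K / (2 * R ^ 2) = B / τ := by rw [hτ, hB]; field_simp; ring
  have hric := riccati_bound (h := fun s => Real.log η - g s) (h' := fun s => -g' s)
    (t₀ := τ) (τ := τ) (b := b) (B := B) hτ0 hb0 hB0
    (fun s hs => (hg' s (hτ0.le.trans hs.1)).const_sub _) (fun s hs => by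
      have h1 := hg'low s (hτ0.le.trans hs.1)
      have h2 : 0 ≤ 1 / 4 * E s / W := div_nonneg (mul_nonneg (by norm_num) (hE0 s)) hW0.le
      rw [← hKτ]; linarith) (fun s hs hpos => by
      have hs0 : 0 ≤ s := hτ0.le.trans hs.1
      have h1 := hg'low s hs0
      have h2 := h.weighted_poincare hK hM hR x (f s) hπ
      change ∑ z, π z * (f s z - g s) ^ 2 ≤ _ * E s at h2
      have h3 : σ * (16 * R) ^ d * (Real.log η - g s) ^ 2 ≤ ∑ z, π z * (f s z - g s) ^ 2 := by
        have h4 := hWlow s hs.1 (by rw [hend] at hs; nlinarith [hs.2])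
        refine (mul_le_mul_of_nonneg_right h4 (sq_nonneg _)).trans ?_
        rw [Finset.sum_mul]
        refine (Finset.sum_le_sum fun z hz => ?_).trans
          (Finset.sum_le_sum_of_subset_of_nonneg (Finset.subset_univ _) fun z _ _ =>
            mul_nonneg (hπpos z).le (sq_nonneg _))
        refine mul_le_mul_of_nonneg_left (pow_le_pow_left₀ hpos ?_ 2) (hπpos z).le
        have h5 := (Finset.mem_filter.1 hz).2
        have h6 : Real.log η ≤ f s z := by
          simp only [hf]
          rw [← Real.log_pow, ← Real.log_mul (hupos s hs0 z).ne' (by positivity)]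
          refine Real.log_le_log hη ?_
          rw [div_le_iff₀ (by positivity)] at h5
          refine h5.trans (mul_le_mul_of_nonneg_right ?_ (by positivity))
          simp only [hu]; linarith
        linarith
      have h7 : ∑ z, π z * (f s z - g s) ^ 2 ≤ CP * R ^ 2 * E s := by
        refine h2.trans (mul_le_mul_of_nonneg_right ?_ (hE0 s))
        refine mul_le_mul_of_nonneg_right ?_ (sq_nonneg _)
        rw [hCP]; linarith
      have h8 : σ * W * (Real.log η - g s) ^ 2 ≤ CP * R ^ 2 * E s := by
        refine le_trans ?_ (h3.trans h7)
        refine mul_le_mul_of_nonneg_right ?_ (sq_nonneg _)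
        exact mul_le_mul_of_nonneg_left hWup hσ.le
      have h9 : b * (Real.log η - g s) ^ 2 / τ ≤ 1 / 4 * E s / W := by
        rw [hb, hτ, div_le_div_iff₀ (by positivity) hW0]
        have e : σ / (16 * CP) * (Real.log η - g s) ^ 2 * W
            = σ * W * (Real.log η - g s) ^ 2 / (16 * CP) := by ring
        rw [e, div_le_iff₀ (by positivity)]
        linarith
      rw [sub_div, ← hKτ]
      linarith)
  rw [hend] at hric
  have hfin : -(B + (2 * B / b + 1) + 2 / b - Real.log η) ≤ g (R ^ 2 / 2) := by linarith
  have := mul_le_mul_of_nonneg_right hfin hW0.le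
  refine this.trans (le_of_eq ?_)
  simp only [hg]
  rw [div_mul_cancel₀ _ hW0.ne']

/-- The near-diagonal lower bound `p_t(x, y) ≥ c t^{-d/2}` for `|x - y| ≤ d √t`: write
`p_t = ∑_z p_{t/2} p_{t/2}` and use Jensen's inequality for the exponential function. -/
theorem heat_lower_bound {d : ℕ} (hd : 1 ≤ d) {K M : ℝ} (hK : 0 ≤ K) (hM : 0 ≤ M) :
    ∃ b : ℝ, 0 < b ∧ ∀ (N : ℕ) [NeZero N] (c : Torus d N → Torus d N → ℝ),
      TorusChain d N K M c → ∀ R : ℝ, 1 ≤ R → R ≤ N → ∀ x y : Torus d N, tnorm (y - x) ≤ d * R →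
        b / R ^ d ≤ heat c (R ^ 2) x y := by
  obtain ⟨σ, hσ, C, hC⟩ := log_mean_lower_bound hd hK hM
  refine ⟨Real.exp (-2 * C) * σ, by positivity, ?_⟩
  intro N _ c h R hR hRN x y hxy
  have hR0 : 0 < R := by linarith
  have ht0 : 0 ≤ R ^ 2 / 2 := by positivity
  set π : Torus d N → ℝ := fun z => Real.exp (-tnorm (z - x) / R) with hπ
  have hπpos : ∀ z, 0 < π z := fun z => Real.exp_pos _
  have hπ1 : ∀ z, π z ≤ 1 := fun z => by
    refine Real.exp_le_one_iff.2 ?_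
    rw [neg_div, neg_nonpos]
    exact div_nonneg (tnorm_nonneg _) hR0.le
  have key : ∀ ε : ℝ, 0 < ε → Real.exp (-2 * C) * σ / R ^ d
      ≤ heat c (R ^ 2) x y + 2 * ε + ε ^ 2 * (Fintype.card (Torus d N)) := by
    intro ε hε
    obtain ⟨hW, h1⟩ := hC N c h R hR hRN x x (by simp; positivity) ε hε π fun z => rfl
    obtain ⟨_, h2⟩ := hC N c h R hR hRN x y hxy ε hε π fun z => rfl
    set u : Torus d N → ℝ := fun z => heat c (R ^ 2 / 2) x z + ε with hu
    set v : Torus d N → ℝ := fun z => heat c (R ^ 2 / 2) y z + ε with hv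
    have hu0 : ∀ z, 0 < u z := fun z => by
      have := heat_nonneg h.nonneg ht0 x z
      simp only [hu]; linarith
    have hv0 : ∀ z, 0 < v z := fun z => by
      have := heat_nonneg h.nonneg ht0 y z
      simp only [hv]; linarith
    set fu : Torus d N → ℝ := fun z => Real.log (u z) + d * Real.log R with hfu
    set fv : Torus d N → ℝ := fun z => Real.log (v z) + d * Real.log R with hfv
    have hexp : ∀ w : ℝ, 0 < w → Real.exp (Real.log w + d * Real.log R) = w * R ^ d := by
      intro w hw
      rw [Real.exp_add, Real.exp_log hw, mul_comm (d : ℝ), Real.exp_mul, Real.exp_log hR0,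
        Real.rpow_natCast]
    have hprod : ∑ z, u z * v z
        = heat c (R ^ 2) x y + 2 * ε + ε ^ 2 * (Fintype.card (Torus d N)) := by
      have e1 : ∀ z, u z * v z = heat c (R ^ 2 / 2) x z * heat c (R ^ 2 / 2) z y
          + ε * heat c (R ^ 2 / 2) x z + ε * heat c (R ^ 2 / 2) y z + ε ^ 2 := fun z => by
        simp only [hu, hv]
        rw [heat_symm h.symm _ z y]; ring
      simp only [e1, Finset.sum_add_distrib, ← Finset.mul_sum, sum_heat h.symm]
      rw [← heat_add, Finset.sum_const, Finset.card_univ, nsmul_eq_mul, add_halves]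
      ring
    have hlow : ∀ z, Real.exp (-2 * C) * (1 + (fu z + fv z + 2 * C)) ≤ u z * v z * (R ^ d) ^ 2 := by
      intro z
      have e1 : u z * v z * (R ^ d) ^ 2 = Real.exp (-2 * C) * Real.exp (fu z + fv z + 2 * C) := by
        rw [← Real.exp_add]
        have : -2 * C + (fu z + fv z + 2 * C) = fu z + fv z := by ring
        rw [this, Real.exp_add, hexp _ (hu0 z), hexp _ (hv0 z)]
        ring
      rw [e1]
      refine mul_le_mul_of_nonneg_left ?_ (Real.exp_pos _).le
      linarith [Real.add_one_le_exp (fu z + fv z + 2 * C)]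
    have hsum : Real.exp (-2 * C) * ∑ z, π z ≤ (∑ z, u z * v z) * (R ^ d) ^ 2 := by
      calc Real.exp (-2 * C) * ∑ z, π z
          ≤ ∑ z, π z * (Real.exp (-2 * C) * (1 + (fu z + fv z + 2 * C))) := by
            have e1 : ∑ z, π z * (Real.exp (-2 * C) * (1 + (fu z + fv z + 2 * C)))
                = Real.exp (-2 * C) * (∑ z, π z + (∑ z, π z * fu z + ∑ z, π z * fv z
                  + 2 * C * ∑ z, π z)) := by
              simp only [Finset.mul_sum, ← Finset.sum_add_distrib]
              exact Finset.sum_congr rfl fun z _ => by ring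
            rw [e1]
            refine mul_le_mul_of_nonneg_left ?_ (Real.exp_pos _).le
            linarith
        _ ≤ ∑ z, π z * (u z * v z * (R ^ d) ^ 2) :=
            Finset.sum_le_sum fun z _ => mul_le_mul_of_nonneg_left (hlow z) (hπpos z).le
        _ ≤ ∑ z, u z * v z * (R ^ d) ^ 2 := by
            refine Finset.sum_le_sum fun z _ => mul_le_of_le_one_left ?_ (hπ1 z)
            exact mul_nonneg (mul_nonneg (hu0 z).le (hv0 z).le) (sq_nonneg _)
        _ = _ := by rw [Finset.sum_mul]
    rw [← hprod]
    have hRd : 0 < R ^ d := by positivity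
    rw [div_le_iff₀ hRd]
    have h3 := (mul_le_mul_of_nonneg_left hW (Real.exp_pos (-2 * C)).le).trans hsum
    refine le_of_mul_le_mul_right (a := R ^ d) ?_ hRd
    linarith
  -- let `ε → 0`
  have hcont : Filter.Tendsto (fun ε : ℝ => heat c (R ^ 2) x y + 2 * ε
      + ε ^ 2 * (Fintype.card (Torus d N))) (nhdsWithin 0 (Set.Ioi 0))
      (nhds (heat c (R ^ 2) x y + 2 * 0 + 0 ^ 2 * (Fintype.card (Torus d N)))) := by
    refine Filter.Tendsto.mono_left (Continuous.tendsto ?_ 0) nhdsWithin_le_nhds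
    fun_prop
  have := ge_of_tendsto hcont (Filter.eventually_of_mem self_mem_nhdsWithin fun ε hε => key ε hε)
  simpa using this

end LogMean

/-! ### The killed chain -/

section Killed

open scoped Classical in
/-- The generator of the chain killed when it leaves `B`, extended outside `B` by pure killing. -/
noncomputable def killedGen {V : Type*} [Fintype V] (c : V → V → ℝ) (B : Set V) : Matrix V V ℝ :=
  Matrix.of fun u v => if u = v then gen c u u else if u ∈ B ∧ v ∈ B then c u v else 0

variable {V : Type*} [Fintype V] {c : V → V → ℝ} (B : Set V)

theorem killedGen_self [DecidableEq V] (u : V) : killedGen c B u u = gen c u u := by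
  have h : (fun a b => Classical.propDecidable (a = b)) = (inferInstance : DecidableEq V) :=
    Subsingleton.elim _ _
  simp only [killedGen, Matrix.of_apply, if_true]
  rw [h]

theorem killedGen_of_mem {u v : V} (h : u ≠ v) (hu : u ∈ B) (hv : v ∈ B) :
    killedGen c B u v = c u v := by
  simp [killedGen, h, hu, hv]

theorem killedGen_of_notMem {u v : V} (h : u ≠ v) (huv : ¬ (u ∈ B ∧ v ∈ B)) :
    killedGen c B u v = 0 := by
  simp only [killedGen, Matrix.of_apply, if_neg h, if_neg huv]

theorem killedGen_nonneg (hc : ∀ u v, 0 ≤ c u v) (u v : V) (h : u ≠ v) : 0 ≤ killedGen c B u v := by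
  by_cases huv : u ∈ B ∧ v ∈ B
  · rw [killedGen_of_mem B h huv.1 huv.2]; exact hc u v
  · rw [killedGen_of_notMem B h huv]

theorem killedGen_le_gen [DecidableEq V] (hc : ∀ u v, 0 ≤ c u v) (u v : V) :
    killedGen c B u v ≤ gen c u v := by
  by_cases h : u = v
  · subst h; rw [killedGen_self]
  · rw [gen_apply_ne c h]
    by_cases huv : u ∈ B ∧ v ∈ B
    · rw [killedGen_of_mem B h huv.1 huv.2]
    · rw [killedGen_of_notMem B h huv]; exact hc u v

theorem killedGen_symm (hs : ∀ u v, c u v = c v u) (u v : V) :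
    killedGen c B u v = killedGen c B v u := by
  by_cases h : u = v
  · rw [h]
  · by_cases huv : u ∈ B ∧ v ∈ B
    · rw [killedGen_of_mem B h huv.1 huv.2, killedGen_of_mem B (Ne.symm h) huv.2 huv.1, hs]
    · rw [killedGen_of_notMem B h huv, killedGen_of_notMem B (Ne.symm h) fun h' => huv ⟨h'.2, h'.1⟩]

/-- A bound for the probability of leaving `B` before time `t` by the probability of being in `F` at
time `t`, if from every point outside `B` the chain is in `F` with probability at least `1/2`. This
replaces a use of the strong Markov property by the maximum principle. -/
theorem killed_mass_ge [DecidableEq V] (hc : ∀ u v, 0 ≤ c u v) (F : Finset V) {t : ℝ}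
    (ht : 0 ≤ t) (hF : ∀ s, 0 ≤ s → s ≤ t → ∀ z, z ∉ B → 1 / 2 ≤ ∑ w ∈ F, heat c s z w)
    {z : V} (hz : z ∈ B) :
    1 - 2 * ∑ w ∈ F, heat c t z w ≤ ∑ w, expMat (killedGen c B) t z w := by
  classical
  set φ : ℝ → V → ℝ := fun s z => 1 - 2 * ∑ w ∈ F, heat c s z w with hφ
  have hφd : ∀ s z, HasDerivAt (fun s => φ s z) (∑ w, gen c z w * φ s w) s := by
    intro s z
    have h1 := HasDerivAt.fun_sum (u := F) fun w _ => isHeatSol_heat_left (c := c) w s z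
    refine ((h1.const_mul 2).const_sub 1).congr_deriv ?_
    rw [sum_gen_mul, Finset.sum_comm, Finset.mul_sum, ← Finset.sum_neg_distrib]
    refine Finset.sum_congr rfl fun w _ => ?_
    rw [← Finset.mul_sum, Finset.sum_sub_distrib]
    simp only [hφ]; ring
  have h := le_expMat_of_subsolution (A := killedGen c B) (killedGen_nonneg B hc)
    (f := fun s z => if z ∈ B then φ s z else 0)
    (f' := fun s z => if z ∈ B then ∑ w, gen c z w * φ s w else 0) (fun s z => by
      by_cases h : z ∈ B
      · simpa only [h, if_true] using hφd s z
      · simpa only [h, if_false] using hasDerivAt_const s (0 : ℝ)) ht (fun s z hs0 hst => by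
      by_cases h : z ∈ B
      · simp only [h, if_true]
        refine Finset.sum_le_sum fun w _ => ?_
        by_cases hw : w ∈ B
        · simp only [hw, if_true]
          by_cases hzw : z = w
          · rw [← hzw, killedGen_self]
          · rw [killedGen_of_mem B hzw h hw, gen_apply_ne c hzw]
        · have hzw : z ≠ w := fun e => hw (e ▸ h)
          simp only [hw, if_false, mul_zero]
          rw [gen_apply_ne c hzw]
          refine mul_nonpos_of_nonneg_of_nonpos (hc z w) ?_
          have := hF s hs0 hst w hw
          simp only [hφ]; linarith
      · simp only [h, if_false]
        refine (Finset.sum_eq_zero fun w _ => ?_).ge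
        by_cases hzw : z = w
        · rw [← hzw]; simp [h]
        · rw [killedGen_of_notMem B hzw fun h' => h h'.1, zero_mul]) z
  simp only [hz, if_true] at h
  refine h.trans (Finset.sum_le_sum fun w _ => ?_)
  refine mul_le_of_le_one_right (expMat_nonneg (killedGen_nonneg B hc) ht z w) ?_
  split_ifs
  · have : 0 ≤ ∑ v ∈ F, heat c 0 w v := Finset.sum_nonneg fun v _ => heat_nonneg hc le_rfl w v
    simp only [hφ]; linarith
  · exact zero_le_one

/-- The heat kernel and the killed heat kernel at time `2s` differ by at most the on-diagonal bound
times the probabilities of leaving `B` before time `s`. -/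
theorem heat_sub_killed_le [DecidableEq V] (hc : ∀ u v, 0 ≤ c u v) (hs : ∀ u v, c u v = c v u)
    {s b : ℝ} (hs0 : 0 ≤ s) (hb : ∀ z w, heat c s z w ≤ b) (x y : V) :
    heat c (s + s) x y - expMat (killedGen c B) (s + s) x y
      ≤ b * ((1 - ∑ w, expMat (killedGen c B) s x w)
        + (1 - ∑ w, expMat (killedGen c B) s y w)) := by
  set q : V → V → ℝ := fun z w => expMat (killedGen c B) s z w with hq
  have hqp : ∀ z w, 0 ≤ q z w ∧ q z w ≤ heat c s z w := fun z w =>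
    expMat_mono (killedGen_nonneg B hc) (killedGen_le_gen B hc) hs0 z w
  have hqs : ∀ z w, q z w = q w z := fun z w => expMat_symm (killedGen_symm B hs) s z w
  have h1 : heat c (s + s) x y - expMat (killedGen c B) (s + s) x y
      = ∑ w, ((heat c s x w - q x w) * heat c s w y + q x w * (heat c s w y - q w y)) := by
    rw [heat_add, expMat_add, Matrix.mul_apply, ← Finset.sum_sub_distrib]
    exact Finset.sum_congr rfl fun w _ => by simp only [hq]; ring
  have h2 : ∀ z, 1 - ∑ w, q z w = ∑ w, (heat c s z w - q z w) := fun z => by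
    rw [Finset.sum_sub_distrib, sum_heat hs]
  change _ ≤ b * ((1 - ∑ w, q x w) + (1 - ∑ w, q y w))
  rw [h1, h2, h2, ← Finset.sum_add_distrib, Finset.mul_sum]
  refine Finset.sum_le_sum fun w _ => ?_
  have h3 := hqp x w
  have h4 := hqp y w
  rw [hqs w y, heat_symm hs s w y]
  have h5 := hb y w
  have h6 := hb x w
  have h7 : (heat c s x w - q x w) * heat c s y w ≤ (heat c s x w - q x w) * b :=
    mul_le_mul_of_nonneg_left h5 (by linarith)
  have h8 : q x w * (heat c s y w - q y w) ≤ b * (heat c s y w - q y w) :=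
    mul_le_mul_of_nonneg_right (h3.2.trans h6) (by linarith)
  linarith

end Killed

/-- The near-diagonal lower bound for the chain killed on leaving a large ball. -/
theorem killed_lower_bound {d : ℕ} (hd : 1 ≤ d) {K M : ℝ} (hK : 0 ≤ K) (hM : 0 ≤ M) :
    ∃ b : ℝ, 0 < b ∧ ∃ L : ℝ, 1 < L ∧ ∀ (N : ℕ) [NeZero N] (c : Torus d N → Torus d N → ℝ),
      TorusChain d N K M c → ∀ R r : ℝ, 1 ≤ R → R ≤ N → L * R ≤ r →
        ∀ x y : Torus d N, tnorm (y - x) ≤ d * R →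
        b / R ^ d ≤ expMat (killedGen c {z | tnorm (z - x) < r}) (R ^ 2) x y := by
  obtain ⟨A, hA1, hA⟩ := heat_upper_bound d hK M
  obtain ⟨A', hA'1, hA'⟩ := heat_moment_bound hd hK M
  obtain ⟨b, hb, hlow⟩ := heat_lower_bound hd hK hM
  have hd1 : (1 : ℝ) ≤ d := by exact_mod_cast hd
  -- By Markov's inequality a displacement of order `L R` is unlikely; the last term of `L` makes
  -- the probability of leaving the ball small in comparison with `b / A`.
  set L : ℝ := 4 * A' + 4 * d + 32 * A * 2 ^ d * A' / b with hL
  have hL0 : 0 < 32 * A * 2 ^ d * A' / b := by positivity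
  refine ⟨b / 2, by positivity, L, by rw [hL]; linarith, ?_⟩
  intro N _ c h R r hR hRN hr x y hxy
  have hR0 : 0 < R := by linarith
  set B : Set (Torus d N) := {z | tnorm (z - x) < r} with hB
  have hr1 : 4 * A' * R ≤ r := by
    refine le_trans (mul_le_mul_of_nonneg_right ?_ hR0.le) hr
    rw [hL]; linarith
  have hr2 : 4 * d * R ≤ r := by
    refine le_trans (mul_le_mul_of_nonneg_right ?_ hR0.le) hr
    rw [hL]; linarith
  have hr3 : 32 * A * 2 ^ d * A' / b * R ≤ r := by
    refine le_trans (mul_le_mul_of_nonneg_right ?_ hR0.le) hr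
    rw [hL]; linarith
  have hr0 : 0 < r := lt_of_lt_of_le (by positivity) hr1
  have hmarkov : ∀ s, 0 ≤ s → s ≤ R ^ 2 → ∀ (z : Torus d N) (ρ : ℝ) (F : Finset (Torus d N)),
      (∀ w ∈ F, ρ ≤ tnorm (w - z)) → (∑ w ∈ F, heat c s z w) * ρ ≤ A' * R := by
    intro s hs0 hs z ρ F hF
    refine le_trans ?_ (hA' N c h R hR hRN z s hs0 hs)
    rw [Finset.sum_mul]
    refine (Finset.sum_le_sum fun w hw => mul_le_mul_of_nonneg_left (hF w hw)
      (heat_nonneg h.nonneg hs0 z w)).trans ?_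
    exact Finset.sum_le_sum_of_subset_of_nonneg (Finset.subset_univ _) fun w _ _ =>
      mul_nonneg (heat_nonneg h.nonneg hs0 z w) (tnorm_nonneg _)
  set F : Finset (Torus d N) := Finset.univ.filter fun w => r / 2 ≤ tnorm (w - x) with hF
  set s : ℝ := R ^ 2 / 2 with hs
  have hs0 : 0 < s := by positivity
  have hsR : s ≤ R ^ 2 := by rw [hs]; linarith [sq_nonneg R]
  have hout : ∀ s', 0 ≤ s' → s' ≤ s → ∀ z, z ∉ B → 1 / 2 ≤ ∑ w ∈ F, heat c s' z w := by
    intro s' h0 h1 z hz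
    have hz' : r ≤ tnorm (z - x) := not_lt.1 hz
    have h2 := hmarkov s' h0 (h1.trans hsR) z (r / 2)
      (Finset.univ.filter fun w => ¬ r / 2 ≤ tnorm (w - x)) (fun w hw => by
        have h3 := not_le.1 (Finset.mem_filter.1 hw).2
        have h4 := tnorm_sub_le z w x
        rw [tnorm_sub_comm w z]
        linarith)
    have h5 := Finset.sum_filter_add_sum_filter_not Finset.univ
      (fun w : Torus d N => r / 2 ≤ tnorm (w - x)) (heat c s' z)
    rw [sum_heat h.symm] at h5
    nlinarith
  have hexit : ∀ z, tnorm (z - x) ≤ d * R →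
      1 - ∑ w, expMat (killedGen c B) s z w ≤ 8 * A' * R / r := by
    intro z hz
    have hzB : z ∈ B := by
      change tnorm (z - x) < r
      have : 0 < (d : ℝ) * R := by positivity
      linarith
    have h1 := killed_mass_ge B h.nonneg F hs0.le hout hzB
    have h2 := hmarkov s hs0.le hsR z (r / 4) F (fun w hw => by
      have h3 := (Finset.mem_filter.1 hw).2
      have h4 := tnorm_sub_le w z x
      linarith)
    rw [le_div_iff₀ hr0]
    nlinarith
  have hup : ∀ z w, heat c s z w ≤ A * 2 ^ d / R ^ d := by
    intro z w
    refine (hA N c h s hs0 (hsR.trans (pow_le_pow_left₀ hR0.le hRN 2)) z w).trans ?_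
    have h1 : R / 2 ≤ Real.sqrt s := by
      apply Real.le_sqrt_of_sq_le
      rw [hs]
      nlinarith [sq_nonneg R]
    have h2 := pow_le_pow_left₀ (by positivity) h1 d
    calc A / Real.sqrt s ^ d ≤ A / (R / 2) ^ d :=
          div_le_div_of_nonneg_left (by linarith) (by positivity) h2
      _ = _ := by rw [div_pow]; field_simp
  have h1 := heat_sub_killed_le B h.nonneg h.symm hs0.le hup x y
  have hss : s + s = R ^ 2 := by rw [hs]; ring
  rw [hss] at h1
  have h2 := hexit x (by simp; positivity)
  have h3 := hexit y hxy
  have h4 := hlow N c h R hR hRN x y hxy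
  have h5 : A * 2 ^ d / R ^ d * ((1 - ∑ w, expMat (killedGen c B) s x w)
      + (1 - ∑ w, expMat (killedGen c B) s y w)) ≤ b / 2 / R ^ d := by
    have h6 : 16 * A' * R / r ≤ b / 2 / (A * 2 ^ d) := by
      rw [div_mul_eq_mul_div, div_le_iff₀ hb] at hr3
      rw [div_le_div_iff₀ hr0 (by positivity)]
      linarith
    calc A * 2 ^ d / R ^ d * ((1 - ∑ w, expMat (killedGen c B) s x w)
        + (1 - ∑ w, expMat (killedGen c B) s y w))
        ≤ A * 2 ^ d / R ^ d * (b / 2 / (A * 2 ^ d)) := by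
          refine mul_le_mul_of_nonneg_left ?_ (by positivity)
          refine le_trans ?_ h6
          have : 16 * A' * R / r = 8 * A' * R / r + 8 * A' * R / r := by ring
          linarith
      _ = _ := by field_simp
  have h6 : b / R ^ d = b / 2 / R ^ d + b / 2 / R ^ d := by ring
  linarith

/-! ### The law of a path of the continuous time chain -/

namespace Conductance

variable {d : ℕ} (C : Conductance d)

theorem measurableSet_cylinder (p : ℕ → Lattice d) (n : ℕ) :
    MeasurableSet {X : ℕ → Lattice d | ∀ k ≤ n, X k = p k} := by
  have : {X : ℕ → Lattice d | ∀ k ≤ n, X k = p k} = ⋂ k, ⋂ (_ : k ≤ n), {X | X k = p k} := by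
    ext X; simp
  rw [this]
  exact MeasurableSet.iInter fun k => MeasurableSet.iInter fun _ =>
    measurableSet_eq_fun (measurable_pi_apply k) measurable_const

/-- The finite dimensional distributions of the jump chain. -/
theorem jumpChainLaw_cylinder (p : ℕ → Lattice d) (n : ℕ) :
    C.jumpChainLaw (p 0) {X | ∀ k ≤ n, X k = p k} =
      ∏ k ∈ Finset.range n, C.jumpPMF (p k) (p (k + 1)) := by
  have key : ∀ n, C.jumpChainLaw (p 0) {X | ∀ k ≤ n, X k = p k} =
      Kernel.partialTraj (X := fun _ => Lattice d) C.stepKernel 0 n (fun _ => p 0)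
        {fun k : Finset.Iic n => p k} := by
    intro n
    rw [← Kernel.traj_map_frestrictLe_apply, Measure.map_apply
      (Preorder.measurable_frestrictLe n) (measurableSet_singleton _)]
    congr 1
    ext X
    simp only [Set.mem_ofPred_eq, Set.mem_preimage, Set.mem_singleton_iff, funext_iff,
      Preorder.frestrictLe_apply, Subtype.forall, Finset.mem_Iic]
  induction n with
  | zero =>
    rw [key, Kernel.partialTraj_zero, Kernel.deterministic_apply,
      Measure.dirac_apply' _ (measurableSet_singleton _)]
    rw [Finset.range_zero, Finset.prod_empty, Set.indicator_of_mem]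
    · rfl
    · simp only [Set.mem_singleton_iff, funext_iff, Subtype.forall, Finset.mem_Iic]
      intro k hk
      obtain rfl := Nat.le_zero.1 hk
      exact fun _ => rfl
  | succ n ih =>
    rw [Finset.prod_range_succ, ← ih, key n]
    have h1 : C.jumpChainLaw (p 0) {X | ∀ k ≤ n + 1, X k = p k} =
        ((Kernel.traj (X := fun _ => Lattice d) C.stepKernel 0 (fun _ => p 0)).map
          fun x => (Preorder.frestrictLe n x, x))
          ({fun k : Finset.Iic n => p k} ×ˢ {X | X (n + 1) = p (n + 1)}) := by
      rw [Measure.map_apply (by fun_prop) ((measurableSet_singleton _).prod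
        (measurableSet_eq_fun (measurable_pi_apply (n + 1)) measurable_const))]
      unfold jumpChainLaw
      congr 1
      ext X
      simp only [Set.mem_ofPred_eq, Set.mem_preimage, Set.mem_prod, Set.mem_singleton_iff,
        funext_iff, Preorder.frestrictLe_apply, Subtype.forall, Finset.mem_Iic]
      constructor
      · intro h; exact ⟨fun k hk => h k (by omega), h _ le_rfl⟩
      · rintro ⟨h, h'⟩ k hk
        rcases Nat.lt_or_ge n k with h2 | h2
        · obtain rfl : k = n + 1 := by omega
          exact h'
        · exact h k h2
    have h2 : ∀ h : Finset.Iic n → Lattice d, Kernel.traj (X := fun _ => Lattice d) C.stepKernel n h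
        {X | X (n + 1) = p (n + 1)} = C.jumpPMF (h ⟨n, Finset.mem_Iic.2 le_rfl⟩) (p (n + 1)) := by
      intro h
      have h3 := Kernel.map_traj_succ_self (X := fun _ => Lattice d) (κ := C.stepKernel) (a := n)
      have h4 := congrArg (fun κ => κ h {p (n + 1)}) h3
      rw [Kernel.map_apply' _ (by fun_prop) _ (measurableSet_singleton _)] at h4
      refine Eq.trans h4 ?_
      unfold stepKernel jumpKernel
      rw [Kernel.comap_apply, Kernel.ofFunOfCountable]
      exact PMF.toMeasure_apply_singleton _ _ (measurableSet_singleton _)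
    rw [h1, ← Kernel.partialTraj_compProd_traj (Nat.zero_le n),
      Measure.compProd_apply_prod (measurableSet_singleton _)
        (measurableSet_eq_fun (measurable_pi_apply (n + 1)) measurable_const)]
    simp only [h2, lintegral_singleton]
    exact mul_comm _ _

/-- The probability that exponential clocks at the sites `p 0, p 1, …` ring exactly `n` times up to
time `t`. -/
noncomputable def ringProb (p : ℕ → Lattice d) (n : ℕ) (t : ℝ) : ℝ≥0∞ :=
  Measure.pi (fun k : Fin (n + 1) => C.holdingLaw (p k))
    {u | ∑ k : Fin n, u k.castSucc ≤ t ∧ t < ∑ k, u k}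

theorem measurableSet_ring (n : ℕ) (t : ℝ) :
    MeasurableSet {u : Fin (n + 1) → ℝ | ∑ k : Fin n, u k.castSucc ≤ t ∧ t < ∑ k, u k} :=
  MeasurableSet.inter
    (measurableSet_le (f := fun u : Fin (n + 1) → ℝ => ∑ k : Fin n, u k.castSucc) (by fun_prop)
      measurable_const)
    (measurableSet_lt (g := fun u : Fin (n + 1) → ℝ => ∑ k, u k) measurable_const (by fun_prop))

/-- The clocks along a trajectory belong to different indices of the family, also if the trajectory
returns to a site, so that they are independent. -/
theorem clockLaw_ring (p : ℕ → Lattice d) (n : ℕ) (t : ℝ) :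
    C.clockLaw {u | ∑ k ∈ Finset.range n, u (k, p k) ≤ t ∧
      t < ∑ k ∈ Finset.range (n + 1), u (k, p k)} = C.ringProb p n t := by
  have hinj : Function.Injective fun k : Fin (n + 1) => ((k : ℕ), p k) := fun k l h =>
    Fin.ext (congrArg Prod.fst h)
  have h := Measure.map_infinitePi_infinitePi_of_inj
    (P := fun q : ℕ × Lattice d => C.holdingLaw q.2) hinj
  rw [Measure.infinitePi_eq_pi (ι := Fin (n + 1))] at h
  unfold ringProb clockLaw
  rw [← h, Measure.map_apply (by fun_prop) (measurableSet_ring n t)]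
  congr 1
  ext u
  simp only [Set.mem_ofPred_eq, Set.mem_preimage, Finset.sum_range, Fin.val_castSucc]

/-- Condition on the first clock. -/
theorem ringProb_succ (p : ℕ → Lattice d) (n : ℕ) (t : ℝ) :
    C.ringProb p (n + 1) t =
      ∫⁻ s, C.ringProb (fun k => p (k + 1)) n (t - s) ∂C.holdingLaw (p 0) := by
  have h := measurePreserving_piFinSuccAbove
    (fun k : Fin (n + 2) => C.holdingLaw (p k)) 0
  unfold ringProb
  rw [← h.symm.measure_preimage_equiv, Measure.prod_apply]
  · refine lintegral_congr fun s => ?_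
    have : (fun j : Fin (n + 1) => C.holdingLaw (p ((0 : Fin (n + 2)).succAbove j))) =
        fun j : Fin (n + 1) => C.holdingLaw (p (j + 1)) := by
      funext j; simp
    rw [this]
    congr 1
    ext u
    simp only [Set.mem_preimage, Set.mem_ofPred_eq, MeasurableEquiv.piFinSuccAbove_symm_apply,
      Fin.insertNthEquiv, Equiv.coe_fn_mk, Fin.insertNth_zero, Fin.sum_univ_succ (n := n + 1),
      Fin.cons_zero, Fin.cons_succ]
    rw [Fin.sum_univ_succ (n := n)]
    simp only [Fin.castSucc_zero, Fin.castSucc_succ, Fin.cons_zero, Fin.cons_succ, cast_eq]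
    constructor
    · rintro ⟨h1, h2⟩; exact ⟨by linarith, by linarith⟩
    · rintro ⟨h1, h2⟩; exact ⟨by linarith, by linarith⟩
  · exact (MeasurableEquiv.measurable _) (measurableSet_ring (n + 1) t)

theorem holdingLaw_lt (z : Lattice d) {t : ℝ} (ht : 0 ≤ t) :
    C.holdingLaw z (Set.Ioi t) = ENNReal.ofReal (Real.exp (-(C.nu z * t))) := by
  have hν : 0 < (C.nu z : ℝ) := NNReal.coe_pos.2 (C.nu_pos z)
  have h1 : C.holdingLaw z (Set.Iic t) = ENNReal.ofReal (1 - Real.exp (-(C.nu z * t))) := by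
    have h := lintegral_exponentialPDF_eq_antiDeriv hν t
    rw [if_pos ht] at h
    rw [← h]
    exact withDensity_apply _ measurableSet_Iic
  rw [← Set.compl_Iic, prob_compl_eq_one_sub measurableSet_Iic, h1, ← ENNReal.ofReal_one,
    ← ENNReal.ofReal_sub]
  · congr 1; ring
  · rw [sub_nonneg, Real.exp_le_one_iff, neg_nonpos]; positivity

theorem holdingLaw_nonneg (z : Lattice d) : ∀ᵐ s ∂C.holdingLaw z, 0 ≤ s := by
  rw [ae_iff]
  have : {a : ℝ | ¬ 0 ≤ a} = Set.Iio 0 := by ext; simp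
  rw [this]
  exact (withDensity_apply _ measurableSet_Iio).trans
    (lintegral_exponentialPDF_of_nonpos le_rfl)

theorem ringProb_zero (p : ℕ → Lattice d) {t : ℝ} (ht : 0 ≤ t) :
    C.ringProb p 0 t = ENNReal.ofReal (Real.exp (-(C.nu (p 0) * t))) := by
  rw [← holdingLaw_lt _ _ ht]
  have h := measurePreserving_eval (fun k : Fin (0 + 1) => C.holdingLaw (p k)) 0
  have h1 := h.measure_preimage (s := Set.Ioi t) measurableSet_Ioi.nullMeasurableSet
  unfold ringProb
  refine Eq.trans ?_ h1
  congr 1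
  ext u
  simp [ht]

theorem clockLaw_nonneg : ∀ᵐ u ∂C.clockLaw, ∀ q, 0 ≤ u q := by
  rw [ae_all_iff]
  intro q
  have h := measurePreserving_eval_infinitePi (fun q : ℕ × Lattice d => C.holdingLaw q.2) q
  exact h.quasiMeasurePreserving.ae (C.holdingLaw_nonneg q.2)

end Conductance

/-! ### Paths in a finite set -/

section Paths

variable {d : ℕ} {V : Type*}

/-- The trajectory in the lattice which starts at `ι x` and visits `ι (q 0), …, ι (q (n - 1))` next;
it is continued in an arbitrary way. -/
def lift (ι : V → Lattice d) (x : V) {n : ℕ} (q : Fin n → V) : ℕ → Lattice d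
  | 0 => ι x
  | k + 1 => if h : k < n then ι (q ⟨k, h⟩) else 0

theorem lift_succ (ι : V → Lattice d) (x : V) {n : ℕ} (q : Fin n → V) (k : Fin n) :
    lift ι x q (k + 1) = ι (q k) := by
  simp [lift]

theorem lift_cons_succ (ι : V → Lattice d) (x z : V) {n : ℕ} (q : Fin n → V) (k : ℕ) :
    lift ι x (Fin.cons z q : Fin (n + 1) → V) (k + 1) = lift ι z q k := by
  cases k with
  | zero => simp [lift]
  | succ k =>
    simp only [lift, Nat.add_lt_add_iff_right]
    refine dite_congr rfl (fun h => ?_) fun _ => rfl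
    exact congrArg ι (Fin.cons_succ (α := fun _ => V) z q ⟨k, h⟩)

/-- The end point of the path `x, q 0, …, q (n - 1)`. -/
def pathEnd (x : V) {n : ℕ} (q : Fin n → V) : V := (Fin.cons x q : Fin (n + 1) → V) (Fin.last n)

theorem pathEnd_cons (x z : V) {n : ℕ} (q : Fin n → V) :
    pathEnd x (Fin.cons z q : Fin (n + 1) → V) = pathEnd z q := by
  unfold pathEnd
  rw [← Fin.succ_last, Fin.cons_succ]

theorem lift_end (ι : V → Lattice d) (x : V) {n : ℕ} (q : Fin n → V) :
    lift ι x q n = ι (pathEnd x q) := by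
  cases n with
  | zero => rfl
  | succ n =>
    unfold pathEnd
    rw [← Fin.succ_last, Fin.cons_succ]
    exact lift_succ ι x q (Fin.last n)

/-- If two paths in the lattice have `n` steps and agree, so do the paths which they lift. -/
theorem lift_injective {ι : V → Lattice d} (hι : Function.Injective ι) (x : V) {n : ℕ}
    {q q' : Fin n → V} (h : ∀ k ≤ n, lift ι x q k = lift ι x q' k) : q = q' := by
  funext k
  have := h (k + 1) k.2
  rw [lift_succ, lift_succ] at this
  exact hι this

end Paths

namespace Conductance

variable {d : ℕ} (C : Conductance d)

theorem measurable_ringProb (p : ℕ → Lattice d) (n : ℕ) : Measurable (C.ringProb p n) := by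
  have h : MeasurableSet {a : ℝ × (Fin (n + 1) → ℝ) |
      ∑ k : Fin n, a.2 k.castSucc ≤ a.1 ∧ a.1 < ∑ k, a.2 k} :=
    MeasurableSet.inter
      (measurableSet_le (f := fun a : ℝ × (Fin (n + 1) → ℝ) => ∑ k : Fin n, a.2 k.castSucc)
        (by fun_prop) measurable_fst)
      (measurableSet_lt (g := fun a : ℝ × (Fin (n + 1) → ℝ) => ∑ k, a.2 k) measurable_fst
        (by fun_prop))
  exact measurable_measure_prodMk_left h

/-- The probability that the jump chain starts with `p 0, …, p n` and that these are exactly the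
sites which the continuous time chain visits up to time `t`. -/
noncomputable def pathProb (p : ℕ → Lattice d) (n : ℕ) (t : ℝ) : ℝ≥0∞ :=
  (∏ k ∈ Finset.range n, C.jumpPMF (p k) (p (k + 1))) * C.ringProb p n t

theorem pathProb_succ (p : ℕ → Lattice d) (n : ℕ) (t : ℝ) :
    C.pathProb p (n + 1) t = C.jumpPMF (p 0) (p 1) *
      ∫⁻ s, C.pathProb (fun k => p (k + 1)) n (t - s) ∂C.holdingLaw (p 0) := by
  have h : Measurable fun s => C.ringProb (fun k => p (k + 1)) n (t - s) :=
    (C.measurable_ringProb _ n).comp (measurable_const.sub measurable_id)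
  unfold pathProb
  rw [lintegral_const_mul _ h, Finset.prod_range_succ', ringProb_succ]
  ring

/-- The event that the jump chain starts with `p 0, …, p n` and that these are exactly the sites
which the continuous time chain visits up to time `t`. -/
def pathEvent (p : ℕ → Lattice d) (n : ℕ) (t : ℝ) : Set (Sample d) :=
  {X | ∀ k ≤ n, X k = p k} ×ˢ ({u | ∑ k ∈ Finset.range n, u (k, p k) ≤ t ∧
      t < ∑ k ∈ Finset.range (n + 1), u (k, p k)} ∩ {u | ∀ q, 0 ≤ u q})

theorem measurableSet_pathEvent (p : ℕ → Lattice d) (n : ℕ) (t : ℝ) :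
    MeasurableSet (pathEvent p n t) := by
  refine (measurableSet_cylinder p n).prod (MeasurableSet.inter (MeasurableSet.inter ?_ ?_) ?_)
  · exact measurableSet_le
      (f := fun u : ℕ × Lattice d → ℝ => ∑ k ∈ Finset.range n, u (k, p k)) (by fun_prop)
      measurable_const
  · exact measurableSet_lt
      (g := fun u : ℕ × Lattice d → ℝ => ∑ k ∈ Finset.range (n + 1), u (k, p k)) measurable_const
      (by fun_prop)
  · have : {u : ℕ × Lattice d → ℝ | ∀ q, 0 ≤ u q} = ⋂ q, {u | 0 ≤ u q} := by ext; simp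
    rw [this]
    exact MeasurableSet.iInter fun q => measurableSet_le measurable_const (by fun_prop)

theorem law_pathEvent (p : ℕ → Lattice d) (n : ℕ) (t : ℝ) :
    C.law (p 0) (pathEvent p n t) = C.pathProb p n t := by
  unfold law pathEvent pathProb
  rw [Measure.prod_prod, jumpChainLaw_cylinder, measure_inter_conull, clockLaw_ring]
  exact C.clockLaw_nonneg

theorem jumpTime_eq {ω : Sample d} {p : ℕ → Lattice d} {n : ℕ} (h : ∀ k ≤ n, ω.1 k = p k) {m : ℕ}
    (hm : m ≤ n + 1) : jumpTime m ω = ∑ k ∈ Finset.range m, ω.2 (k, p k) :=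
  Finset.sum_congr rfl fun k hk => by rw [h k (by have := Finset.mem_range.1 hk; omega)]

theorem jumpTime_mono {ω : Sample d} (h : ∀ q, 0 ≤ ω.2 q) : Monotone fun n => jumpTime n ω :=
  fun _ _ hmn => Finset.sum_le_sum_of_subset_of_nonneg (Finset.range_mono hmn) fun _ _ _ => h _

theorem jumpCount_eq {ω : Sample d} {p : ℕ → Lattice d} {n : ℕ} {t : ℝ≥0}
    (hω : ω ∈ pathEvent p n t) : jumpCount t ω = n := by
  obtain ⟨h1, ⟨h2, h3⟩, h4⟩ := hω
  refine le_antisymm (Nat.sInf_le ?_) (le_csInf ⟨n, ?_⟩ fun m hm => ?_)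
  · change (t : ℝ) < jumpTime (n + 1) ω
    rwa [jumpTime_eq h1 le_rfl]
  · change (t : ℝ) < jumpTime (n + 1) ω
    rwa [jumpTime_eq h1 le_rfl]
  · by_contra! hmn
    have h5 : jumpTime (m + 1) ω ≤ jumpTime n ω := jumpTime_mono h4 hmn
    rw [jumpTime_eq h1 (Nat.le_succ n)] at h5
    exact absurd (lt_of_lt_of_le hm h5) (not_lt.2 h2)

/-- On the path event the process is at `p n` at time `t`, and it can be outside `S` only after the
`(n + 1)`-st jump, which occurs after `t`. -/
theorem pathEvent_subset {p : ℕ → Lattice d} {n : ℕ} {t : ℝ≥0} {S : Set (Lattice d)}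
    (hS : ∀ k ≤ n, p k ∈ S) :
    pathEvent p n t ⊆ {ω | Y t ω = p n ∧ (t : ℝ≥0∞) < exitTime S ω} := by
  intro ω hω
  have hc := jumpCount_eq hω
  obtain ⟨h1, ⟨h2, h3⟩, h4⟩ := hω
  refine ⟨by unfold Y; rw [hc, h1 n le_rfl], ?_⟩
  have h5 : (t : ℝ≥0∞) < ENNReal.ofReal (jumpTime (n + 1) ω) := by
    rw [jumpTime_eq h1 le_rfl, ENNReal.lt_ofReal_iff_toReal_lt ENNReal.coe_ne_top]
    exact h3
  refine h5.trans_le (le_iInf₂ fun s hs => ?_)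
  by_contra! hlt
  rw [ENNReal.lt_ofReal_iff_toReal_lt ENNReal.coe_ne_top] at hlt
  have h6 : jumpCount s ω ≤ n := Nat.sInf_le hlt
  exact hs (by unfold Y; rw [h1 _ h6]; exact hS _ h6)

section Expansion

variable {V : Type*} [Fintype V] (ι : V → Lattice d) (B : Set V) (y : V)

open scoped Classical in
/-- The probability that the chain started at `ι x` visits, up to time `t`, `n` further sites, all
of them in `ι '' B` and the last one equal to `ι y`. -/
noncomputable def stepProb (n : ℕ) (t : ℝ) (x : V) : ℝ≥0∞ :=
  ∑ q : Fin n → V, if (∀ k, q k ∈ B) ∧ pathEnd x q = y then C.pathProb (lift ι x q) n t else 0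

open scoped Classical in
theorem stepProb_zero {t : ℝ} (ht : 0 ≤ t) (x : V) : C.stepProb ι B y 0 t x =
    if x = y then ENNReal.ofReal (Real.exp (-(C.nu (ι x) * t))) else 0 := by
  unfold stepProb pathProb
  rw [Fintype.sum_unique]
  simp only [IsEmpty.forall_iff, true_and, Finset.range_zero, Finset.prod_empty, one_mul,
    ringProb_zero _ _ ht]
  rfl

theorem measurable_stepProb (n : ℕ) (x : V) : Measurable fun t => C.stepProb ι B y n t x := by
  classical
  refine Finset.measurable_fun_sum _ fun q _ => ?_
  split_ifs
  · exact (C.measurable_ringProb _ n).const_mul _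
  · exact measurable_const

open scoped Classical in
/-- Decompose according to the first site visited and the first clock. -/
theorem stepProb_succ (n : ℕ) (t : ℝ) (x : V) : C.stepProb ι B y (n + 1) t x =
    ∑ z, if z ∈ B then C.jumpPMF (ι x) (ι z) *
      ∫⁻ s, C.stepProb ι B y n (t - s) z ∂C.holdingLaw (ι x) else 0 := by
  have h1 : C.stepProb ι B y (n + 1) t x = ∑ a : V × (Fin n → V),
      if (∀ k, (Fin.cons a.1 a.2 : Fin (n + 1) → V) k ∈ B) ∧
        pathEnd x (Fin.cons a.1 a.2 : Fin (n + 1) → V) = y then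
        C.pathProb (lift ι x (Fin.cons a.1 a.2 : Fin (n + 1) → V)) (n + 1) t else 0 :=
    (Fintype.sum_equiv (Fin.consEquiv fun _ => V) _ _ fun a => rfl).symm
  rw [h1, Fintype.sum_prod_type]
  refine Finset.sum_congr rfl fun z _ => ?_
  simp only [pathEnd_cons, Fin.forall_fin_succ, Fin.cons_zero, Fin.cons_succ]
  by_cases hz : z ∈ B
  · simp only [hz, true_and, if_true]
    unfold stepProb
    rw [lintegral_finsetSum, Finset.mul_sum]
    · refine Finset.sum_congr rfl fun q _ => ?_
      split_ifs with hq
      · rw [pathProb_succ]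
        simp only [lift_cons_succ]
        exact congrArg (· * _) (congrArg _ (lift_cons_succ ι x z q 0))
      · simp
    · intro q _
      split_ifs
      · exact ((C.measurable_ringProb _ n).const_mul _).comp (by fun_prop)
      · exact measurable_const
  · simp [hz]

/-- The paths in `ι '' B` from `ι x` to `ι y` contribute disjoint parts of the event that the chain
is at `ι y` at time `t` and has not yet left `S`. -/
theorem sum_stepProb_le {ι} (hι : Function.Injective ι) {S : Set (Lattice d)}
    (hS : ∀ u ∈ B, ι u ∈ S) {x : V} (hx : x ∈ B) (t : ℝ≥0) (N : ℕ) :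
    ∑ n ∈ Finset.range N, C.stepProb ι B y n t x ≤
      C.law (ι x) {ω | Y t ω = ι y ∧ (t : ℝ≥0∞) < exitTime S ω} := by
  classical
  set I : Finset (Σ n : ℕ, Fin n → V) := (Finset.range N).sigma fun n =>
    Finset.univ.filter fun q => (∀ k, q k ∈ B) ∧ pathEnd x q = y with hI
  have hsum : ∑ n ∈ Finset.range N, C.stepProb ι B y n t x =
      ∑ a ∈ I, C.law (ι x) (pathEvent (lift ι x a.2) a.1 t) := by
    rw [hI, Finset.sum_sigma]
    refine Finset.sum_congr rfl fun n _ => ?_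
    unfold stepProb
    rw [Finset.sum_filter]
    exact Finset.sum_congr rfl fun q _ => if_congr Iff.rfl
      (C.law_pathEvent (lift ι x q) n t).symm rfl
  rw [hsum, ← measure_biUnion_finset]
  · refine measure_mono (Set.iUnion₂_subset fun a ha => ?_)
    obtain ⟨n, q⟩ := a
    obtain ⟨-, ha⟩ := Finset.mem_sigma.1 ha
    obtain ⟨hq, he⟩ := (Finset.mem_filter.1 ha).2
    have h := pathEvent_subset (p := lift ι x q) (n := n) (t := t) (S := S) fun k hk => by
      cases k with
      | zero => exact hS x hx
      | succ k => exact lift_succ ι x q ⟨k, hk⟩ ▸ hS _ (hq _)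
    rwa [lift_end, he] at h
  · rintro ⟨n, q⟩ _ ⟨n', q'⟩ _ hne
    refine Set.disjoint_left.2 fun ω h h' => hne ?_
    obtain rfl : n = n' := (jumpCount_eq h).symm.trans (jumpCount_eq h')
    have hq : q = q' := lift_injective hι x fun k hk => (h.1 k hk).symm.trans (h'.1 k hk)
    rw [hq]
  · exact fun a _ => measurableSet_pathEvent _ _ _

end Expansion

end Conductance

/-! ### Duhamel's formula and the expansion over paths -/

section Duhamel

variable {V : Type*} [Fintype V] [DecidableEq V]

/-- Duhamel's formula for the removal of the diagonal entry at `x`. -/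
theorem expMat_le_duhamel {G : Matrix V V ℝ} (hG : ∀ u v, u ≠ v → 0 ≤ G u v) {x : V} {ν : ℝ}
    (hx : G x x ≤ -ν) (y : V) {t : ℝ} (ht : 0 ≤ t) :
    expMat G t x y ≤ Real.exp (-(ν * t)) * (1 : Matrix V V ℝ) x y +
      ∫ s in (0 : ℝ)..t, Real.exp (-(ν * s)) *
        ∑ z ∈ Finset.univ.erase x, G x z * expMat G (t - s) z y := by
  set F' : ℝ → ℝ := fun s => -(Real.exp (-(ν * s)) *
    (ν * expMat G (t - s) x y + ∑ z, G x z * expMat G (t - s) z y)) with hF'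
  have hcont : ∀ z, Continuous fun s => expMat G (t - s) z y := fun z =>
    (continuous_expMat G z y).comp (continuous_const.sub continuous_id)
  have hexp : Continuous fun s : ℝ => Real.exp (-(ν * s)) := by fun_prop
  have hd : ∀ s, HasDerivAt (fun s => Real.exp (-(ν * s)) * expMat G (t - s) x y) (F' s) s := by
    intro s
    have h1 : HasDerivAt (fun s : ℝ => Real.exp (-(ν * s))) (Real.exp (-(ν * s)) * (-(ν * 1))) s :=
      (((hasDerivAt_id s).const_mul ν).neg).exp
    have h2 : HasDerivAt (fun s : ℝ => t - s) (-1) s := (hasDerivAt_id s).const_sub t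
    have h3 := (hasDerivAt_expMat_left G (t - s) x y).comp s h2
    refine (h1.mul h3).congr_deriv ?_
    simp only [hF', Function.comp]
    ring
  have hF'c : Continuous F' := by
    refine (hexp.mul ((continuous_const.mul (hcont x)).add ?_)).neg
    exact continuous_finsetSum _ fun z _ => continuous_const.mul (hcont z)
  have hint := intervalIntegral.integral_eq_sub_of_hasDerivAt (a := 0) (b := t)
    (fun s _ => hd s) (hF'c.intervalIntegrable _ _)
  simp only [sub_self, expMat_zero, mul_zero, neg_zero, Real.exp_zero, one_mul, sub_zero] at hint
  have hmono : ∫ s in (0 : ℝ)..t, -F' s ≤ ∫ s in (0 : ℝ)..t, Real.exp (-(ν * s)) *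
        ∑ z ∈ Finset.univ.erase x, G x z * expMat G (t - s) z y := by
    refine intervalIntegral.integral_mono_on ht (hF'c.neg.intervalIntegrable _ _)
      (Continuous.intervalIntegrable (hexp.mul (continuous_finsetSum _ fun z _ =>
        continuous_const.mul (hcont z))) _ _) fun s hs => ?_
    simp only [hF', neg_neg]
    refine mul_le_mul_of_nonneg_left ?_ (Real.exp_pos _).le
    rw [← Finset.add_sum_erase _ _ (Finset.mem_univ x)]
    have := expMat_nonneg hG (t := t - s) (by linarith [hs.2]) x y
    nlinarith
  rw [intervalIntegral.integral_neg] at hmono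
  linarith

end Duhamel

namespace Conductance

variable {d : ℕ} (C : Conductance d)

theorem setLIntegral_holdingLaw (z : Lattice d) (t : ℝ) {f : ℝ → ℝ≥0∞} (hf : Measurable f) :
    ∫⁻ s in Set.Ioc 0 t, f s ∂C.holdingLaw z =
      ∫⁻ s in Set.Ioc 0 t, ENNReal.ofReal (C.nu z * Real.exp (-(C.nu z * s))) * f s := by
  have h : Measurable (exponentialPDF (C.nu z)) := by unfold exponentialPDF; fun_prop
  refine (setLIntegral_withDensity_eq_setLIntegral_mul _ h hf measurableSet_Ioc).trans ?_
  refine setLIntegral_congr_fun measurableSet_Ioc fun s hs => ?_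
  rw [Pi.mul_apply, exponentialPDF_of_nonneg hs.1.le]

theorem sum_jumpPMF_le {V : Type*} [Fintype V] {ι : V → Lattice d} (hι : Function.Injective ι)
    (x : Lattice d) : ∑ z, C.jumpPMF x (ι z) ≤ 1 := by
  rw [← (C.jumpPMF x).tsum_coe, ← tsum_fintype (L := .unconditional _)]
  exact ENNReal.tsum_comp_le_tsum_of_injective hι _

variable {V : Type*} [Fintype V] [DecidableEq V] {ι : V → Lattice d} {B : Set V}
  {G : Matrix V V ℝ}

open scoped Classical in
/-- One iteration of the integral inequality for the semigroup of `G`. -/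
theorem ofReal_expMat_le (hG : ∀ u v, u ≠ v → 0 ≤ G u v)
    (hdiag : ∀ u ∈ B, G u u ≤ -(C.nu (ι u) : ℝ))
    (hin : ∀ u ∈ B, ∀ v ∈ B, u ≠ v → G u v ≤ C.val (ι u) (ι v))
    (hout : ∀ u ∈ B, ∀ v ∉ B, u ≠ v → G u v = 0) {x : V} (hx : x ∈ B) (y : V) {t : ℝ}
    (ht : 0 ≤ t) :
    ENNReal.ofReal (expMat G t x y) ≤ C.stepProb ι B y 0 t x +
      ∑ z, if z ∈ B then C.jumpPMF (ι x) (ι z) *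
        ∫⁻ s in Set.Ioc 0 t, ENNReal.ofReal (expMat G (t - s) z y) ∂C.holdingLaw (ι x) else 0 := by
  have hν : 0 < (C.nu (ι x) : ℝ) := NNReal.coe_pos.2 (C.nu_pos _)
  set ν : ℝ := (C.nu (ι x)).toReal with hνdef
  have hcont : ∀ z, Continuous fun s => expMat G (t - s) z y := fun z =>
    (continuous_expMat G z y).comp (continuous_const.sub continuous_id)
  refine (ENNReal.ofReal_le_ofReal (expMat_le_duhamel hG (hdiag x hx) y ht)).trans
    (ENNReal.ofReal_add_le.trans (add_le_add ?_ ?_))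
  · rw [stepProb_zero _ _ _ _ ht, Matrix.one_apply]
    split_ifs <;> simp
  set g : ℝ → ℝ := fun s => ∑ z, if z ∈ B then
    (C.val (ι x) (ι z) / ν : ℝ) * (ν * Real.exp (-(ν * s)) * expMat G (t - s) z y) else 0 with hg
  have hgc : Continuous g := by
    refine continuous_finsetSum _ fun z _ => ?_
    split_ifs
    · exact continuous_const.mul ((by fun_prop : Continuous fun s => ν * Real.exp (-(ν * s))).mul
        (hcont z))
    · exact continuous_const
  have hterm : ∀ s ∈ Set.Ioc 0 t, ∀ z, 0 ≤ if z ∈ B then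
    (C.val (ι x) (ι z) / ν : ℝ) * (ν * Real.exp (-(ν * s)) * expMat G (t - s) z y) else 0 := by
    intro s hs z
    have := expMat_nonneg hG (t := t - s) (by linarith [hs.2]) z y
    split_ifs <;> positivity
  have hgi : IntegrableOn g (Set.Ioc 0 t) :=
    (hgc.integrableOn_Icc (a := 0) (b := t)).mono_set Set.Ioc_subset_Icc_self
  have h1 : ∫ s in (0 : ℝ)..t, Real.exp (-(ν * s)) *
        ∑ z ∈ Finset.univ.erase x, G x z * expMat G (t - s) z y ≤ ∫ s in Set.Ioc 0 t, g s := by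
    rw [intervalIntegral.integral_of_le ht]
    refine setIntegral_mono_on ?_ hgi measurableSet_Ioc fun s hs => ?_
    · refine (Continuous.integrableOn_Icc (a := 0) (b := t) ?_).mono_set Set.Ioc_subset_Icc_self
      exact (by fun_prop : Continuous fun s => Real.exp (-(ν * s))).mul
        (continuous_finsetSum _ fun z _ => continuous_const.mul (hcont z))
    · rw [Finset.mul_sum]
      refine (Finset.sum_le_sum fun z hz => ?_).trans (Finset.sum_le_sum_of_subset_of_nonneg
        (Finset.subset_univ _) fun z _ _ => hterm s hs z)
      have hne : x ≠ z := (Finset.ne_of_mem_erase hz).symm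
      have h0 := expMat_nonneg hG (t := t - s) (by linarith [hs.2]) z y
      split_ifs with hzB
      · have h2 := hin x hx z hzB hne
        calc Real.exp (-(ν * s)) * (G x z * expMat G (t - s) z y)
            ≤ Real.exp (-(ν * s)) * (C.val (ι x) (ι z) * expMat G (t - s) z y) := by gcongr
          _ = _ := by field_simp
      · rw [hout x hx z hzB hne]; simp
  refine (ENNReal.ofReal_le_ofReal h1).trans (le_of_eq ?_)
  rw [ofReal_integral_eq_lintegral_ofReal hgi ((ae_restrict_iff' measurableSet_Ioc).2
    (Filter.Eventually.of_forall fun s hs => Finset.sum_nonneg fun z _ => hterm s hs z))]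
  have hpt : ∀ s ∈ Set.Ioc 0 t, ENNReal.ofReal (g s) = ∑ z, if z ∈ B then
      C.jumpPMF (ι x) (ι z) * (ENNReal.ofReal (ν * Real.exp (-(ν * s))) *
        ENNReal.ofReal (expMat G (t - s) z y)) else 0 := by
    intro s hs
    rw [hg, ENNReal.ofReal_sum_of_nonneg fun z _ => hterm s hs z]
    refine Finset.sum_congr rfl fun z _ => ?_
    split_ifs
    · rw [ENNReal.ofReal_mul (by positivity), ENNReal.ofReal_mul (by positivity)]
      congr 1
      rw [hνdef, ← NNReal.coe_div, ENNReal.ofReal_coe_nnreal]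
      rfl
    · exact ENNReal.ofReal_zero
  rw [setLIntegral_congr_fun measurableSet_Ioc hpt]
  have hm : ∀ z, Measurable fun s => ENNReal.ofReal (ν * Real.exp (-(ν * s))) *
        ENNReal.ofReal (expMat G (t - s) z y) := fun z =>
    ((by fun_prop : Measurable fun s => ν * Real.exp (-(ν * s))).ennreal_ofReal).mul
      (hcont z).measurable.ennreal_ofReal
  rw [lintegral_finsetSum]
  · refine Finset.sum_congr rfl fun z _ => ?_
    split_ifs
    · rw [lintegral_const_mul _ (hm z),
        setLIntegral_holdingLaw _ _ _ (hcont z).measurable.ennreal_ofReal]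
    · simp
  · intro z _
    split_ifs
    · exact (hm z).const_mul _
    · exact measurable_const

/-- The error `a (Λ t)^N / N!` passes to the next one of this form when it is integrated against a
holding time. -/
theorem lintegral_pow_error {z : Lattice d} {Λ : ℝ} (hΛ : C.nu z ≤ Λ) {a : ℝ} (ha : 0 ≤ a) (N : ℕ)
    {t : ℝ} (ht : 0 ≤ t) :
    ∫⁻ s in Set.Ioc 0 t, ENNReal.ofReal (a * (Λ * (t - s)) ^ N / N.factorial) ∂C.holdingLaw z ≤
      ENNReal.ofReal (a * (Λ * t) ^ (N + 1) / (N + 1).factorial) := by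
  have hΛ0 : 0 ≤ Λ := (NNReal.coe_nonneg _).trans hΛ
  rw [setLIntegral_holdingLaw]
  swap
  · exact (by fun_prop : Measurable fun s => a * (Λ * (t - s)) ^ N / N.factorial).ennreal_ofReal
  set g : ℝ → ℝ := fun s => Λ * (a * (Λ * (t - s)) ^ N / N.factorial) with hg
  have hgc : Continuous g := by fun_prop
  have h1 : ∀ s ∈ Set.Ioc 0 t, ENNReal.ofReal (C.nu z * Real.exp (-(C.nu z * s))) *
      ENNReal.ofReal (a * (Λ * (t - s)) ^ N / N.factorial) ≤ ENNReal.ofReal (g s) := by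
    intro s hs
    have h2 : 0 ≤ t - s := by linarith [hs.2]
    rw [← ENNReal.ofReal_mul (by positivity)]
    refine ENNReal.ofReal_le_ofReal (mul_le_mul_of_nonneg_right ?_ (by positivity))
    have h3 : Real.exp (-(C.nu z * s)) ≤ 1 := by
      rw [Real.exp_le_one_iff, neg_nonpos]
      have := hs.1.le
      positivity
    calc (C.nu z : ℝ) * Real.exp (-(C.nu z * s)) ≤ C.nu z * 1 := by gcongr
      _ ≤ Λ := by rw [mul_one]; exact hΛ
  refine (setLIntegral_mono' measurableSet_Ioc h1).trans (le_of_eq ?_)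
  rw [← ofReal_integral_eq_lintegral_ofReal ((hgc.integrableOn_Icc (a := 0) (b := t)).mono_set
    Set.Ioc_subset_Icc_self) ((ae_restrict_iff' measurableSet_Ioc).2
    (Filter.Eventually.of_forall fun s hs => by
      have h2 : 0 ≤ t - s := by linarith [hs.2]
      simp only [hg, Pi.zero_apply]; positivity)), ← intervalIntegral.integral_of_le ht]
  congr 1
  have hd : ∀ s,
      HasDerivAt (fun s => -(a * (Λ * (t - s)) ^ (N + 1) / (N + 1).factorial)) (g s) s := by
    intro s
    have h2 : HasDerivAt (fun s : ℝ => Λ * (t - s)) (Λ * -1) s :=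
      ((hasDerivAt_id s).const_sub t).const_mul Λ
    refine ((((h2.pow (N + 1)).const_mul a).div_const _).neg).congr_deriv ?_
    rw [Nat.factorial_succ]
    simp only [hg, Nat.add_sub_cancel]
    push_cast
    field_simp
  rw [intervalIntegral.integral_eq_sub_of_hasDerivAt (fun s _ => hd s)
    (hgc.intervalIntegrable _ _)]
  simp

/-- The semigroup of `G` is bounded by the transition probabilities of the chain killed on leaving
`S`, if `G` is dominated in `ι '' B ⊆ S` by the generator of the chain and does not leave `B`. -/
theorem expMat_le_law (hι : Function.Injective ι) {S : Set (Lattice d)} (hS : ∀ u ∈ B, ι u ∈ S)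
    (hG : ∀ u v, u ≠ v → 0 ≤ G u v) (hdiag : ∀ u ∈ B, G u u ≤ -(C.nu (ι u) : ℝ))
    (hin : ∀ u ∈ B, ∀ v ∈ B, u ≠ v → G u v ≤ C.val (ι u) (ι v))
    (hout : ∀ u ∈ B, ∀ v ∉ B, u ≠ v → G u v = 0) {x : V} (hx : x ∈ B) (y : V) (t : ℝ≥0) :
    expMat G t x y ≤ (C.law (ι x)).real {ω | Y t ω = ι y ∧ (t : ℝ≥0∞) < exitTime S ω} := by
  classical
  -- With `a` bounding the entries and `Λ` all jump rates, `N` iterations leave the error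
  -- `a (Λ s)^N / N!`, which tends to `0`.
  obtain ⟨a, ha0, ha⟩ : ∃ a : ℝ, 0 ≤ a ∧ ∀ s ∈ Set.Icc (0 : ℝ) t, ∀ z, expMat G s z y ≤ a := by
    have h1 : Continuous fun s => ∑ z, |expMat G s z y| :=
      continuous_finsetSum _ fun z _ => (continuous_expMat G z y).abs
    obtain ⟨a, ha⟩ := isCompact_Icc.bddAbove_image (K := Set.Icc (0 : ℝ) t) h1.continuousOn
    have h2 : ∀ s ∈ Set.Icc (0 : ℝ) t, ∑ z, |expMat G s z y| ≤ a := fun s hs =>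
      ha (Set.mem_image_of_mem _ hs)
    refine ⟨a, (Finset.sum_nonneg fun z _ => abs_nonneg _).trans
      (h2 0 ⟨le_rfl, t.2⟩), fun s hs z => (le_abs_self _).trans (le_trans ?_ (h2 s hs))⟩
    exact Finset.single_le_sum (f := fun z => |expMat G s z y|) (fun z _ => abs_nonneg _)
      (Finset.mem_univ z)
  set Λ : ℝ := ∑ u, (C.nu (ι u) : ℝ) with hΛdef
  have hΛ : ∀ u, (C.nu (ι u) : ℝ) ≤ Λ := fun u =>
    Finset.single_le_sum (f := fun u => (C.nu (ι u) : ℝ)) (fun u _ => NNReal.coe_nonneg _)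
      (Finset.mem_univ u)
  have main : ∀ N : ℕ, ∀ s ∈ Set.Icc (0 : ℝ) t, ∀ u ∈ B, ENNReal.ofReal (expMat G s u y) ≤
      ∑ n ∈ Finset.range N, C.stepProb ι B y n s u +
        ENNReal.ofReal (a * (Λ * s) ^ N / N.factorial) := by
    intro N
    induction N with
    | zero =>
      intro s hs u _
      simpa using ENNReal.ofReal_le_ofReal (ha s hs u)
    | succ N ih =>
      intro s hs u hu
      refine (C.ofReal_expMat_le hG hdiag hin hout hu y hs.1).trans ?_
      rw [Finset.sum_range_succ', add_comm (∑ n ∈ Finset.range N, _), add_assoc]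
      refine add_le_add le_rfl ?_
      have hm : ∀ n z, Measurable fun r => C.stepProb ι B y n (s - r) z := fun n z =>
        (C.measurable_stepProb ι B y n z).comp (measurable_const.sub measurable_id)
      have h1 : ∀ z, (if z ∈ B then C.jumpPMF (ι u) (ι z) * ∫⁻ r in Set.Ioc 0 s,
          ENNReal.ofReal (expMat G (s - r) z y) ∂C.holdingLaw (ι u) else 0) ≤
          (∑ n ∈ Finset.range N, if z ∈ B then C.jumpPMF (ι u) (ι z) *
            ∫⁻ r, C.stepProb ι B y n (s - r) z ∂C.holdingLaw (ι u) else 0) +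
          C.jumpPMF (ι u) (ι z) *
            ENNReal.ofReal (a * (Λ * s) ^ (N + 1) / (N + 1).factorial) := by
        intro z
        by_cases hz : z ∈ B
        · simp only [hz, if_true]
          rw [← Finset.mul_sum, ← mul_add]
          gcongr
          calc ∫⁻ r in Set.Ioc 0 s, ENNReal.ofReal (expMat G (s - r) z y) ∂C.holdingLaw (ι u)
              ≤ ∫⁻ r in Set.Ioc 0 s, (∑ n ∈ Finset.range N, C.stepProb ι B y n (s - r) z +
                  ENNReal.ofReal (a * (Λ * (s - r)) ^ N / N.factorial)) ∂C.holdingLaw (ι u) :=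
                setLIntegral_mono' measurableSet_Ioc fun r hr =>
                  ih (s - r) ⟨by linarith [hr.2], by linarith [hr.1, hs.2]⟩ z hz
            _ = ∫⁻ r in Set.Ioc 0 s, (∑ n ∈ Finset.range N, C.stepProb ι B y n (s - r) z)
                  ∂C.holdingLaw (ι u) + ∫⁻ r in Set.Ioc 0 s,
                  ENNReal.ofReal (a * (Λ * (s - r)) ^ N / N.factorial) ∂C.holdingLaw (ι u) :=
                lintegral_add_left (Finset.measurable_fun_sum _ fun n _ => hm n z) _
            _ ≤ _ := by
                refine add_le_add ?_ (C.lintegral_pow_error (hΛ u) ha0 N hs.1)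
                refine (setLIntegral_le_lintegral _ _).trans (le_of_eq ?_)
                exact lintegral_finsetSum _ fun n _ => hm n z
        · simp [hz]
      refine (Finset.sum_le_sum fun z _ => h1 z).trans ?_
      rw [Finset.sum_add_distrib, Finset.sum_comm, ← Finset.sum_mul]
      refine add_le_add (le_of_eq ?_) ?_
      · exact Finset.sum_congr rfl fun n _ => (C.stepProb_succ ι B y n s u).symm
      · exact mul_le_of_le_one_left zero_le (C.sum_jumpPMF_le hι _)
  have hle : ENNReal.ofReal (expMat G t x y) ≤
      C.law (ι x) {ω | Y t ω = ι y ∧ (t : ℝ≥0∞) < exitTime S ω} := by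
    have hlim : Filter.Tendsto (fun N : ℕ =>
        C.law (ι x) {ω | Y t ω = ι y ∧ (t : ℝ≥0∞) < exitTime S ω} +
          ENNReal.ofReal (a * (Λ * t) ^ N / N.factorial)) Filter.atTop
        (nhds (C.law (ι x) {ω | Y t ω = ι y ∧ (t : ℝ≥0∞) < exitTime S ω} +
          ENNReal.ofReal 0)) := by
      refine Filter.Tendsto.const_add _ (ENNReal.tendsto_ofReal ?_)
      have h := (FloorSemiring.tendsto_pow_div_factorial_atTop (Λ * (t : ℝ))).const_mul a
      rw [mul_zero] at h
      exact h.congr fun N => (mul_div_assoc _ _ _).symm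
    rw [ENNReal.ofReal_zero, add_zero] at hlim
    exact ge_of_tendsto' hlim fun N => (main N t ⟨t.2, le_rfl⟩ x hx).trans
      (add_le_add (C.sum_stepProb_le B y hι hS hx t N) le_rfl)
  exact (ENNReal.ofReal_le_iff_le_toReal (measure_ne_top _ _)).1 hle

end Conductance

/-! ### The second moment of the jumps -/

section Lattice

variable {d : ℕ}

theorem eDist_nonneg (x y : Lattice d) : 0 ≤ eDist x y := Real.sqrt_nonneg _

theorem eDist_sq (x y : Lattice d) : eDist x y ^ 2 = ∑ i, ((x i : ℝ) - (y i : ℝ)) ^ 2 :=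
  Real.sq_sqrt (Finset.sum_nonneg fun _ _ => sq_nonneg _)

theorem abs_sub_le_eDist (x y : Lattice d) (i : Fin d) : |(x i : ℝ) - y i| ≤ eDist x y := by
  refine abs_le_of_sq_le_sq ?_ (eDist_nonneg x y)
  rw [eDist_sq]
  exact Finset.single_le_sum (f := fun i => ((x i : ℝ) - (y i : ℝ)) ^ 2)
    (fun i _ => sq_nonneg _) (Finset.mem_univ i)

theorem sum_abs_sub_le (x y : Lattice d) : ∑ i, |(x i : ℝ) - y i| ≤ d * eDist x y := by
  refine (Finset.sum_le_sum fun i _ => abs_sub_le_eDist x y i).trans (le_of_eq ?_)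
  simp

theorem eDist_le_sum (x y : Lattice d) : eDist x y ≤ ∑ i, |(x i : ℝ) - y i| := by
  refine (abs_le_of_sq_le_sq' ?_ (Finset.sum_nonneg fun i _ => abs_nonneg _)).2
  rw [eDist_sq]
  refine le_trans (le_of_eq (Finset.sum_congr rfl fun i _ => (sq_abs _).symm)) ?_
  exact Finset.sum_sq_le_sq_sum_of_nonneg fun i _ => abs_nonneg _

/-- The distance of two lattice points in the supremum norm. -/
def supDist (x y : Lattice d) : ℕ := Finset.univ.sup fun i => (x i - y i).natAbs

theorem natAbs_le_supDist (x y : Lattice d) (i : Fin d) : (x i - y i).natAbs ≤ supDist x y :=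
  Finset.le_sup (f := fun i => (x i - y i).natAbs) (Finset.mem_univ i)

theorem abs_le_supDist (x y : Lattice d) (i : Fin d) : |(x i : ℝ) - y i| ≤ supDist x y := by
  have := natAbs_le_supDist x y i
  rw [← Int.cast_sub, ← Int.cast_abs, Int.abs_eq_natAbs]
  exact_mod_cast this

theorem eDist_sq_le (x y : Lattice d) : eDist x y ^ 2 ≤ d * (supDist x y : ℝ) ^ 2 := by
  rw [eDist_sq]
  refine (Finset.sum_le_sum fun i _ => ?_).trans (le_of_eq (by
    rw [Finset.sum_const, Finset.card_univ, Fintype.card_fin, nsmul_eq_mul]))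
  rw [← sq_abs]
  exact pow_le_pow_left₀ (abs_nonneg _) (abs_le_supDist x y i) 2

theorem exists_supDist (hd : 1 ≤ d) (x y : Lattice d) : ∃ i, (x i - y i).natAbs = supDist x y := by
  have : Nonempty (Fin d) := ⟨⟨0, hd⟩⟩
  obtain ⟨i, -, hi⟩ := Finset.exists_mem_eq_sup (Finset.univ : Finset (Fin d))
    Finset.univ_nonempty fun i => (x i - y i).natAbs
  exact ⟨i, hi.symm⟩

theorem supDist_le_floor (hd : 1 ≤ d) (x y : Lattice d) : supDist x y ≤ ⌊eDist x y⌋₊ := by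
  obtain ⟨i, hi⟩ := exists_supDist hd x y
  refine Nat.le_floor (le_trans (le_of_eq ?_) (abs_sub_le_eDist x y i))
  rw [← hi, ← Int.cast_sub, ← Int.cast_abs, Int.abs_eq_natAbs]
  rfl

theorem card_sphere_le (hd : 1 ≤ d) (x : Lattice d) {j : ℕ} (hj : 1 ≤ j) (F : Finset (Lattice d)) :
    (F.filter fun y => supDist x y = j).card ≤ d * (2 * (3 * j) ^ (d - 1)) := by
  classical
  set T : Fin d → Finset (Lattice d) := fun i => Fintype.piFinset fun k =>
    if k = i then ({x k - j, x k + j} : Finset ℤ) else Finset.Icc (x k - j) (x k + j) with hT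
  have hsub : (F.filter fun y => supDist x y = j) ⊆ Finset.univ.biUnion T := by
    intro y hy
    obtain ⟨-, hy⟩ := Finset.mem_filter.1 hy
    obtain ⟨i, hi⟩ := exists_supDist hd x y
    refine Finset.mem_biUnion.2 ⟨i, Finset.mem_univ i, ?_⟩
    rw [hT, Fintype.mem_piFinset]
    intro k
    have hk := natAbs_le_supDist x y k
    rw [hy] at hk hi
    split_ifs with h
    · subst h
      rw [Finset.mem_insert, Finset.mem_singleton]
      omega
    · rw [Finset.mem_Icc]
      omega
  have hcard : ∀ i, (T i).card ≤ 2 * (3 * j) ^ (d - 1) := by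
    intro i
    rw [hT, Fintype.card_piFinset, ← Finset.mul_prod_erase _ _ (Finset.mem_univ i), if_pos rfl]
    refine Nat.mul_le_mul Finset.card_le_two ?_
    refine (Finset.prod_le_pow_card _ _ (3 * j) fun k hk => ?_).trans (le_of_eq ?_)
    · rw [if_neg (Finset.ne_of_mem_erase hk), Int.card_Icc]
      omega
    · rw [Finset.card_erase_of_mem (Finset.mem_univ i), Finset.card_univ, Fintype.card_fin]
  refine (Finset.card_le_card hsub).trans (Finset.card_biUnion_le.trans ?_)
  refine (Finset.sum_le_sum fun i _ => hcard i).trans (le_of_eq ?_)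
  simp

/-- The second moments of the jumps are bounded in terms of the dominating function. -/
theorem exists_moment_bound (hd : 1 ≤ d) (φ : ℕ → ℝ≥0) :
    ∃ K : ℝ, 0 ≤ K ∧ ∀ C : Conductance d, DominatedBy C φ → ∀ (x : Lattice d)
      (F : Finset (Lattice d)), ∑ y ∈ F, (C.val x y : ℝ) * eDist x y ^ 2 ≤ K := by
  set a : ℕ → ℝ := fun j => (d * (2 * 3 ^ (d - 1)) * d) * ((j : ℝ) ^ (d + 1) * φ j) with ha
  have ha0 : ∀ j, 0 ≤ a j := fun j => by positivity
  refine ⟨∑' j, a j, tsum_nonneg ha0, fun C ⟨hφ, hC⟩ x F => ?_⟩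
  have hsum : Summable a := by
    refine Summable.mul_left _ ?_
    have := NNReal.summable_coe.2 hφ.summable
    exact this.congr fun j => by push_cast; rfl
  have h1 : ∀ y ∈ F, (C.val x y : ℝ) * eDist x y ^ 2 ≤
      d * (supDist x y : ℝ) ^ 2 * φ (supDist x y) := by
    intro y _
    by_cases hxy : x = y
    · subst hxy
      rw [C.diag]
      simp only [NNReal.coe_zero, zero_mul]
      positivity
    have hpos : 1 ≤ supDist x y := by
      by_contra! h
      refine hxy (funext fun i => ?_)
      have := natAbs_le_supDist x y i
      omega
    have h2 : C.val x y ≤ φ (supDist x y) := (hC x y hxy).trans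
      (hφ.antitone hpos (hpos.trans (supDist_le_floor hd x y)) (supDist_le_floor hd x y))
    rw [mul_comm]
    exact mul_le_mul (eDist_sq_le x y) (NNReal.coe_le_coe.2 h2) (NNReal.coe_nonneg _)
      (by positivity)
  refine (Finset.sum_le_sum h1).trans ?_
  rw [Finset.sum_comp (fun j : ℕ => d * (j : ℝ) ^ 2 * φ j) (supDist x)]
  refine (Finset.sum_le_sum fun j _ => ?_).trans (hsum.sum_le_tsum _ fun j _ => ha0 j)
  rcases Nat.eq_zero_or_pos j with rfl | hj
  · simpa using ha0 0
  · have h3 : ((F.filter fun y => supDist x y = j).card : ℝ) ≤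
        d * (2 * (3 * j) ^ (d - 1)) := by exact_mod_cast card_sphere_le hd x hj F
    rw [nsmul_eq_mul]
    refine (mul_le_mul_of_nonneg_right h3 (by positivity)).trans (le_of_eq ?_)
    obtain ⟨e, rfl⟩ : ∃ e, d = e + 1 := ⟨d - 1, by omega⟩
    simp only [ha, Nat.add_sub_cancel, mul_pow]
    ring

end Lattice

/-! ### Energy along chains of edges -/

section Chain

/-- If `z 1, …, z N` is a chain of edges of conductance at least `δ` in `S`, then the increment of
`f` along the chain is bounded by the energy of `f` in `S`, uniformly in the length of the chain: the
chain can be replaced by one without repetitions. -/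
theorem sq_sub_le_of_chain {V : Type*} {c : V → V → ℝ} (hc : ∀ u v, 0 ≤ c u v)
    {δ : ℝ} (hδ : 0 < δ) (S : Finset V) (f : V → ℝ) {z : ℕ → V} {N : ℕ} (hN : 1 ≤ N)
    (hS : ∀ i, 1 ≤ i → i ≤ N → z i ∈ S)
    (hz : ∀ i, 1 ≤ i → i < N → δ ≤ c (z i) (z (i + 1))) :
    (f (z N) - f (z 1)) ^ 2 ≤
      (S.card : ℝ) ^ 2 / δ * ∑ a ∈ S, ∑ b ∈ S, c a b * (f a - f b) ^ 2 := by
  classical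
  set E := ∑ a ∈ S, ∑ b ∈ S, c a b * (f a - f b) ^ 2 with hE
  have hE0 : 0 ≤ E := Finset.sum_nonneg fun a _ => Finset.sum_nonneg fun b _ =>
    mul_nonneg (hc a b) (sq_nonneg _)
  set h := Real.sqrt (E / δ) with hh
  have hh0 : 0 ≤ h := Real.sqrt_nonneg _
  have hstep : ∀ a ∈ S, ∀ b ∈ S, δ ≤ c a b → |f a - f b| ≤ h := by
    intro a ha b hb hab
    refine Real.abs_le_sqrt ?_
    rw [le_div_iff₀ hδ, mul_comm]
    calc δ * (f a - f b) ^ 2 ≤ c a b * (f a - f b) ^ 2 := by gcongr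
      _ ≤ ∑ b ∈ S, c a b * (f a - f b) ^ 2 :=
        Finset.single_le_sum (f := fun b => c a b * (f a - f b) ^ 2)
          (fun b _ => mul_nonneg (hc a b) (sq_nonneg _)) hb
      _ ≤ E := Finset.single_le_sum (f := fun a => ∑ b ∈ S, c a b * (f a - f b) ^ 2)
          (fun a _ => Finset.sum_nonneg fun b _ => mul_nonneg (hc a b) (sq_nonneg _)) ha
  let G : SimpleGraph S :=
    { Adj := fun a b => a ≠ b ∧ |f a - f b| ≤ h
      symm := ⟨fun a b ⟨h1, h2⟩ => ⟨h1.symm, by rwa [abs_sub_comm]⟩⟩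
      loopless := ⟨fun a ⟨h1, _⟩ => h1 rfl⟩ }
  have hwalk : ∀ {a b : S} (p : G.Walk a b), |f b - f a| ≤ p.length * h := by
    intro a b p
    induction p with
    | nil => simp
    | @cons u v w hadj p ih =>
      have h1 : |f u - f v| ≤ h := hadj.2
      have h2 := abs_sub_le (f w) (f v) (f u)
      rw [abs_sub_comm (f v) (f u)] at h2
      rw [SimpleGraph.Walk.length_cons]
      push_cast
      linarith
  have hreach : ∀ i (hi : 1 ≤ i) (hiN : i ≤ N),
      G.Reachable ⟨z 1, hS 1 le_rfl hN⟩ ⟨z i, hS i hi hiN⟩ := by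
    intro i hi
    induction i, hi using Nat.le_induction with
    | base => intro _; exact SimpleGraph.Reachable.refl _
    | succ i hi ih =>
      intro hiN
      refine (ih (by omega)).trans ?_
      by_cases heq : z i = z (i + 1)
      · have : (⟨z i, hS i hi (by omega)⟩ : S) = ⟨z (i + 1), hS _ (by omega) hiN⟩ :=
          Subtype.ext heq
        rw [this]
      · exact SimpleGraph.Adj.reachable (G := G) ⟨fun h => heq (congrArg Subtype.val h),
          hstep _ (hS i hi (by omega)) _ (hS _ (by omega) hiN) (hz i hi (by omega))⟩
  obtain ⟨p, hp⟩ := (hreach N hN le_rfl).exists_isPath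
  have hlen : (p.length : ℝ) ≤ S.card := by
    have := hp.length_lt
    rw [Fintype.card_coe] at this
    exact_mod_cast this.le
  have h1 : |f (z N) - f (z 1)| ≤ S.card * h := (hwalk p).trans (by gcongr)
  calc (f (z N) - f (z 1)) ^ 2 = |f (z N) - f (z 1)| ^ 2 := (sq_abs _).symm
    _ ≤ (S.card * h) ^ 2 := by gcongr
    _ = (S.card : ℝ) ^ 2 / δ * E := by
      rw [mul_pow, hh, Real.sq_sqrt (div_nonneg hE0 hδ.le)]; ring

end Chain

/-! ### Conductances transplanted to a large torus -/

section Transplant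

variable {d N : ℕ} [NeZero N]

/-- The representative in the lattice, near `x`, of a point of the torus; `0` represents `x`. -/
def toLattice (x : Lattice d) (u : Torus d N) : Lattice d := fun i => x i + (u i).valMinAbs

/-- The projection of the lattice to the torus which maps `x` to `0`. -/
def toTorus (N : ℕ) (x : Lattice d) (z : Lattice d) : Torus d N :=
  fun i => ((z i - x i : ℤ) : ZMod N)

omit [NeZero N] in
theorem toTorus_toLattice (x : Lattice d) (u : Torus d N) : toTorus N x (toLattice x u) = u := by
  funext i
  simp [toTorus, toLattice]

omit [NeZero N] in
theorem toLattice_injective (x : Lattice d) : Function.Injective (toLattice x : Torus d N → _) :=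
  Function.LeftInverse.injective (toTorus_toLattice x)

theorem toLattice_toTorus {x z : Lattice d} (h : ∀ i, 2 * |(z i : ℝ) - x i| < N) :
    toLattice x (toTorus N x z) = z := by
  funext i
  have h1 : 2 * |z i - x i| < N := by
    have := h i
    rw [← Int.cast_sub, ← Int.cast_abs] at this
    exact_mod_cast this
  have h2 : ((z i - x i : ℤ) : ZMod N).valMinAbs = z i - x i :=
    (ZMod.valMinAbs_spec _ _).2 ⟨rfl, by
      have h3 := abs_lt.1 (show |(z i - x i) * 2| < N by rw [abs_mul]; norm_num; linarith)
      exact ⟨h3.1, h3.2.le⟩⟩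
  simp only [toLattice, toTorus, h2]
  ring

/-- The projection is Lipschitz, since the representatives used in `tnorm` are the shortest ones. -/
theorem tnorm_toTorus_sub_le (x z w : Lattice d) :
    tnorm (toTorus N x z - toTorus N x w) ≤ d * eDist z w := by
  refine le_trans (Finset.sum_le_sum fun i _ => ?_) (sum_abs_sub_le z w)
  have h1 : (toTorus N x z - toTorus N x w) i = ((z i - w i : ℤ) : ZMod N) := by
    simp only [toTorus, Pi.sub_apply]
    push_cast
    ring
  have h2 := ZMod.natAbs_min_of_le_div_two N ((z i - w i : ℤ) : ZMod N).valMinAbs (z i - w i)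
    (ZMod.coe_valMinAbs _) (ZMod.natAbs_valMinAbs_le _)
  rw [h1, ← Int.cast_sub, ← Int.cast_abs, Int.abs_eq_natAbs, Int.cast_natCast]
  exact_mod_cast h2

theorem tnorm_sub_le_eDist (x : Lattice d) (u v : Torus d N) :
    tnorm (u - v) ≤ d * eDist (toLattice x u) (toLattice x v) := by
  have := tnorm_toTorus_sub_le (N := N) x (toLattice x u) (toLattice x v)
  rwa [toTorus_toLattice, toTorus_toLattice] at this

omit [NeZero N] in
theorem abs_toLattice_sub_le (x : Lattice d) (u : Torus d N) (i : Fin d) :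
    |(toLattice x u i : ℝ) - x i| ≤ tnorm u := by
  refine le_trans (le_of_eq ?_) (coord_le_tnorm u i)
  have : ((toLattice x u i : ℤ) : ℝ) - x i = ((u i).valMinAbs : ℤ) := by
    simp only [toLattice]; push_cast; ring
  rw [this, ← Int.cast_abs, Int.abs_eq_natAbs]
  rfl

omit [NeZero N] in
theorem eDist_toLattice_le (x : Lattice d) (u : Torus d N) : eDist x (toLattice x u) ≤ tnorm u := by
  refine (eDist_le_sum _ _).trans (le_of_eq (Finset.sum_congr rfl fun i _ => ?_))
  have : (x i : ℝ) - (toLattice x u i : ℤ) = -((u i).valMinAbs : ℤ) := by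
    simp only [toLattice]; push_cast; ring
  rw [this, abs_neg, ← Int.cast_abs, Int.abs_eq_natAbs]
  rfl

theorem toLattice_add_unitVec {x : Lattice d} {u : Torus d N} {r : ℝ} (hu : tnorm u ≤ r)
    (hN : 2 * (r + 1) < N) (i : Fin d) :
    toLattice x (u + unitVec i) = toLattice x u + Pi.single i 1 := by
  have h1 : u + unitVec i = toTorus N x (toLattice x u + Pi.single i 1) := by
    funext k
    simp only [toTorus, Pi.add_apply, unitVec, toLattice]
    by_cases hk : k = i
    · subst hk
      simp
      ring
    · simp [Pi.single_eq_of_ne hk]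
  rw [h1]
  refine toLattice_toTorus fun k => ?_
  have h2 := abs_toLattice_sub_le x u k
  have h3 : |((Pi.single i 1 : Lattice d) k : ℝ)| ≤ 1 := by
    by_cases hk : k = i
    · subst hk; simp
    · simp [Pi.single_eq_of_ne hk]
  have h4 : (((toLattice x u + Pi.single i 1 : Lattice d) k : ℤ) : ℝ) - x k =
      ((toLattice x u k : ℝ) - x k) + ((Pi.single i 1 : Lattice d) k : ℤ) := by
    rw [Pi.add_apply]; push_cast; ring
  rw [h4]
  have h5 := abs_add_le ((toLattice x u k : ℝ) - x k) ((Pi.single i 1 : Lattice d) k : ℤ)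
  linarith

omit [NeZero N] in
theorem tnorm_unitVec (hN : 2 ≤ N) (i : Fin d) : tnorm (unitVec i : Torus d N) = 1 := by
  have h1 : (1 : ZMod N).valMinAbs = 1 := by
    have := ZMod.valMinAbs_natCast_of_le_half (n := N) (a := 1) (by omega)
    simpa using this
  unfold tnorm unitVec
  rw [Finset.sum_eq_single i]
  · simp [h1]
  · intro k _ hk
    simp [Pi.single_eq_of_ne hk]
  · simp

open scoped Classical in
/-- Conductances on the torus: those of `C` near the point `x`, represented by `0`, supplemented by
unit conductances on the nearest neighbour edges which are not within distance `r` of `0`. -/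
noncomputable def torusCond (C : Conductance d) (x : Lattice d) (r : ℝ) (u v : Torus d N) : ℝ :=
  C.val (toLattice x u) (toLattice x v) +
    if tnorm (u - v) = 1 ∧ ¬ (tnorm u ≤ r ∧ tnorm v ≤ r) then 1 else 0

variable {C : Conductance d} {x : Lattice d} {r : ℝ}

omit [NeZero N] in
theorem val_le_torusCond (u v : Torus d N) :
    (C.val (toLattice x u) (toLattice x v) : ℝ) ≤ torusCond C x r u v := by
  unfold torusCond
  split_ifs <;> simp

omit [NeZero N] in
theorem torusCond_nonneg (u v : Torus d N) : 0 ≤ torusCond C x r u v :=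
  (NNReal.coe_nonneg _).trans (val_le_torusCond u v)

omit [NeZero N] in
theorem torusCond_of_le {u v : Torus d N} (hu : tnorm u ≤ r) (hv : tnorm v ≤ r) :
    torusCond C x r u v = C.val (toLattice x u) (toLattice x v) := by
  unfold torusCond
  rw [if_neg fun h => h.2 ⟨hu, hv⟩, add_zero]

/-- The second part of the bound counts the nearest neighbours of a point. -/
theorem torusCond_moment {K : ℝ}
    (hK : ∀ F : Finset (Lattice d), ∀ z, ∑ y ∈ F, (C.val z y : ℝ) * eDist z y ^ 2 ≤ K)
    (u : Torus d N) :
    ∑ v, torusCond C x r u v * tnorm (u - v) ^ 2 ≤ d ^ 2 * K + Real.exp 1 * 16 ^ d := by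
  classical
  have h1 : ∀ v, torusCond C x r u v * tnorm (u - v) ^ 2 ≤
      d ^ 2 * (C.val (toLattice x u) (toLattice x v) *
        eDist (toLattice x u) (toLattice x v) ^ 2) + if tnorm (v - u) ≤ 1 * 1 then 1 else 0 := by
    intro v
    unfold torusCond
    rw [add_mul]
    refine add_le_add ?_ ?_
    · have h2 := pow_le_pow_left₀ (tnorm_nonneg _) (tnorm_sub_le_eDist x u v) 2
      rw [mul_pow] at h2
      refine (mul_le_mul_of_nonneg_left h2 (NNReal.coe_nonneg _)).trans (le_of_eq ?_)
      ring
    · rw [tnorm_sub_comm v u]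
      by_cases h : tnorm (u - v) = 1 ∧ ¬ (tnorm u ≤ r ∧ tnorm v ≤ r)
      · rw [if_pos h, h.1]; norm_num
      · rw [if_neg h, zero_mul]; split_ifs <;> norm_num
  refine (Finset.sum_le_sum fun v _ => h1 v).trans ?_
  rw [Finset.sum_add_distrib, ← Finset.mul_sum]
  refine add_le_add (mul_le_mul_of_nonneg_left ?_ (by positivity)) ?_
  · have := hK (Finset.univ.image (toLattice x : Torus d N → _)) (toLattice x u)
    rwa [Finset.sum_image fun a _ b _ h => toLattice_injective x h] at this
  · rw [← Finset.sum_filter, Finset.sum_const, nsmul_one]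
    have := card_ball_le (R := 1) le_rfl (m := 1) u
    rwa [mul_one (16 : ℝ)] at this

/-- An edge near `0` is controlled by the chain of edges joining its ends in the lattice: this chain
stays within distance `N / 2` of `x`, so that its edges keep their conductances on the torus. -/
theorem torusCond_edge {M₀ δ : ℝ} (hM₀ : 0 ≤ M₀) (hδ : 0 < δ) (hC : LocallyIrreducible C M₀ δ)
    (hN : 2 * (r + M₀ + 1) < N) {u : Torus d N} {i : Fin d} (hu : tnorm u ≤ r)
    (f : Torus d N → ℝ) :
    (f (u + unitVec i) - f u) ^ 2 ≤
      (Real.exp (d * M₀) * 16 ^ d) ^ 2 / δ *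
        ∑ a ∈ Finset.univ.filter fun a : Torus d N => tnorm (a - u) ≤ d * M₀,
          ∑ b ∈ Finset.univ.filter fun b : Torus d N => tnorm (b - u) ≤ d * M₀,
            torusCond C x r a b * (f a - f b) ^ 2 := by
  have hlat := toLattice_add_unitVec (x := x) hu (by linarith) i
  obtain ⟨n, hn, z, hz1, hzn, hzB, hzδ⟩ := hC (toLattice x u) (toLattice x (u + unitVec i)) (by
    rw [hlat]
    unfold eDist
    rw [Real.sqrt_eq_one, Finset.sum_eq_single i]
    · simp
    · intro k _ hk
      simp [Pi.single_eq_of_ne hk]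
    · simp)
  have hback : ∀ k, 1 ≤ k → k ≤ n → toLattice x (toTorus N x (z k)) = z k := by
    intro k hk1 hkn
    refine toLattice_toTorus fun l => ?_
    have h1 := abs_toLattice_sub_le x u l
    have h2 : |(toLattice x u l : ℝ) - z k l| < M₀ :=
      (abs_sub_le_eDist _ _ l).trans_lt (hzB k hk1 hkn)
    have h3 := abs_sub_le (z k l : ℝ) (toLattice x u l) (x l)
    rw [abs_sub_comm (z k l : ℝ) (toLattice x u l)] at h3
    linarith
  have h := sq_sub_le_of_chain (c := torusCond C x r) torusCond_nonneg hδ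
    (Finset.univ.filter fun a : Torus d N => tnorm (a - u) ≤ d * M₀) f
    (z := fun k => toTorus N x (z k)) (N := n) (by omega) (fun k hk1 hkn => by
      rw [Finset.mem_filter, tnorm_sub_comm]
      refine ⟨Finset.mem_univ _, ?_⟩
      have h1 := tnorm_toTorus_sub_le (N := N) x (toLattice x u) (z k)
      rw [toTorus_toLattice] at h1
      exact h1.trans (mul_le_mul_of_nonneg_left (hzB k hk1 hkn).le (Nat.cast_nonneg d)))
    (fun k hk1 hkn => by
      refine (hzδ k hk1 hkn).trans (le_trans (le_of_eq ?_) (val_le_torusCond _ _))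
      rw [hback k hk1 hkn.le, hback (k + 1) (by omega) hkn])
  simp only [hzn, hz1, toTorus_toLattice] at h
  refine h.trans ?_
  have hcard := card_ball_le (R := 1) le_rfl (m := d * M₀) u
  rw [mul_one, mul_one] at hcard
  refine mul_le_mul_of_nonneg_right ?_ (Finset.sum_nonneg fun a _ => Finset.sum_nonneg fun b _ =>
    mul_nonneg (torusCond_nonneg _ _) (sq_nonneg _))
  gcongr

/-- Edges near `0` are controlled by the chains of edges in the lattice, all others by the
conductances which were added. -/
theorem torusChain_torusCond (hd : 1 ≤ d) {K M₀ δ : ℝ} (hK0 : 0 ≤ K) (hM₀ : 1 ≤ M₀) (hδ : 0 < δ)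
    (hC : LocallyIrreducible C M₀ δ)
    (hK : ∀ F : Finset (Lattice d), ∀ z, ∑ y ∈ F, (C.val z y : ℝ) * eDist z y ^ 2 ≤ K)
    (hr : 0 ≤ r) (hN : 2 * (r + M₀ + 1) < N) :
    TorusChain d N (d ^ 2 * K + Real.exp 1 * 16 ^ d + (Real.exp (d * M₀) * 16 ^ d) ^ 2 / δ + 1)
      (d * M₀) (torusCond C x r) where
  nonneg := torusCond_nonneg
  symm u v := by
    unfold torusCond
    rw [C.symm, tnorm_sub_comm]
    simp only [and_comm]
  moment u := by
    refine (torusCond_moment hK u).trans ?_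
    have : 0 ≤ (Real.exp (d * M₀) * 16 ^ d) ^ 2 / δ := by positivity
    linarith
  edge f u i := by
    classical
    have hterm : ∀ a b, 0 ≤ if tnorm (a - u) ≤ d * M₀ ∧ tnorm (b - u) ≤ d * M₀ then
        torusCond C x r a b * (f a - f b) ^ 2 else 0 := fun a b => by
      split_ifs
      · exact mul_nonneg (torusCond_nonneg _ _) (sq_nonneg _)
      · exact le_rfl
    have h1 : 0 ≤ (Real.exp (d * M₀) * 16 ^ d) ^ 2 / δ := by positivity
    have h2 : 0 ≤ (d : ℝ) ^ 2 * K + Real.exp 1 * 16 ^ d := by positivity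
    by_cases h : tnorm u ≤ r ∧ tnorm (u + unitVec i) ≤ r
    · refine (torusCond_edge (x := x) (by linarith) hδ hC hN h.1 f).trans ?_
      have h3 : ∑ a ∈ Finset.univ.filter fun a : Torus d N => tnorm (a - u) ≤ d * M₀,
          ∑ b ∈ Finset.univ.filter fun b : Torus d N => tnorm (b - u) ≤ d * M₀,
            torusCond C x r a b * (f a - f b) ^ 2 =
          ∑ a, ∑ b, if tnorm (a - u) ≤ d * M₀ ∧ tnorm (b - u) ≤ d * M₀ then
            torusCond C x r a b * (f a - f b) ^ 2 else 0 := by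
        rw [Finset.sum_filter]
        refine Finset.sum_congr rfl fun a _ => ?_
        split_ifs with ha
        · rw [Finset.sum_filter]
          simp [ha]
        · simp [ha]
      rw [h3]
      exact mul_le_mul_of_nonneg_right (by linarith)
        (Finset.sum_nonneg fun a _ => Finset.sum_nonneg fun b _ => hterm a b)
    · have hN2 : 2 ≤ N := by
        have : (2 : ℝ) < N := by linarith
        exact_mod_cast this.le
      have hdM : (1 : ℝ) ≤ d * M₀ := by
        have : (1 : ℝ) ≤ d := by exact_mod_cast hd
        nlinarith
      have h3 : (f (u + unitVec i) - f u) ^ 2 ≤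
          if tnorm ((u + unitVec i) - u) ≤ d * M₀ ∧ tnorm (u - u) ≤ d * M₀ then
            torusCond C x r (u + unitVec i) u * (f (u + unitVec i) - f u) ^ 2 else 0 := by
        rw [add_sub_cancel_left, sub_self, tnorm_zero, tnorm_unitVec hN2,
          if_pos ⟨hdM, by linarith⟩]
        refine le_mul_of_one_le_left (sq_nonneg _) ?_
        unfold torusCond
        rw [add_sub_cancel_left, tnorm_unitVec hN2, if_pos ⟨rfl, fun h' => h h'.symm⟩]
        linarith [NNReal.coe_nonneg (C.val (toLattice x (u + unitVec i)) (toLattice x u))]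
      refine h3.trans ?_
      refine (Finset.single_le_sum (f := fun b => if tnorm ((u + unitVec i) - u) ≤ d * M₀ ∧
        tnorm (b - u) ≤ d * M₀ then torusCond C x r (u + unitVec i) b *
          (f (u + unitVec i) - f b) ^ 2 else 0) (fun b _ => hterm _ b) (Finset.mem_univ u)).trans ?_
      refine (Finset.single_le_sum (f := fun a => ∑ b, if tnorm (a - u) ≤ d * M₀ ∧
        tnorm (b - u) ≤ d * M₀ then torusCond C x r a b * (f a - f b) ^ 2 else 0)
        (fun a _ => Finset.sum_nonneg fun b _ => hterm a b)
        (Finset.mem_univ (u + unitVec i))).trans ?_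
      exact le_mul_of_one_le_left
        (Finset.sum_nonneg fun a _ => Finset.sum_nonneg fun b _ => hterm a b) (by linarith)

/-- The conductance from a point near `x` to points which are not represented on the torus is small:
they are at distance at least `R`, and the second moment of the jumps is at most `K`. -/
theorem nu_toLattice_le {K R : ℝ} (hR : 0 < R)
    (hK : ∀ F : Finset (Lattice d), ∀ z, ∑ y ∈ F, (C.val z y : ℝ) * eDist z y ^ 2 ≤ K)
    {u : Torus d N} (hu : tnorm u ≤ r) (hN : 2 * (r + R) ≤ N) :
    (C.nu (toLattice x u) : ℝ) ≤
      ∑ v : Torus d N, (C.val (toLattice x u) (toLattice x v) : ℝ) + K / R ^ 2 := by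
  classical
  set w := toLattice x u with hw
  have hs : Summable fun y => (C.val w y : ℝ) := NNReal.summable_coe.2 (C.summable w)
  unfold Conductance.nu
  rw [NNReal.coe_tsum]
  refine hs.tsum_le_of_sum_le fun F => ?_
  set T := Finset.univ.image (toLattice x : Torus d N → _) with hT
  have h1 : ∑ y ∈ F, (C.val w y : ℝ) ≤
      ∑ y ∈ T, (C.val w y : ℝ) + ∑ y ∈ F \ T, (C.val w y : ℝ) := by
    rw [← Finset.sum_inter_add_sum_sdiff F T]
    exact add_le_add (Finset.sum_le_sum_of_subset_of_nonneg Finset.inter_subset_right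
      fun _ _ _ => NNReal.coe_nonneg _) le_rfl
  refine h1.trans (add_le_add (le_of_eq ?_) ?_)
  · rw [hT, Finset.sum_image fun a _ b _ h => toLattice_injective x h]
  · rw [le_div_iff₀ (by positivity), Finset.sum_mul]
    refine (Finset.sum_le_sum fun y hy => ?_).trans (hK (F \ T) w)
    refine mul_le_mul_of_nonneg_left (pow_le_pow_left₀ hR.le ?_ 2) (NNReal.coe_nonneg _)
    obtain ⟨i, hi⟩ : ∃ i, (N : ℝ) ≤ 2 * |(y i : ℝ) - x i| := by
      by_contra! h
      exact (Finset.mem_sdiff.1 hy).2 (Finset.mem_image.2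
        ⟨toTorus N x y, Finset.mem_univ _, toLattice_toTorus h⟩)
    have h2 := abs_toLattice_sub_le x u i
    have h3 := abs_sub_le (y i : ℝ) (w i) (x i)
    have h4 := abs_sub_le_eDist w y i
    rw [abs_sub_comm] at h4
    linarith

end Transplant

/-! ### The lower bound for the process on the lattice -/

/-- The lower bound in terms of the square root `R` of the time. -/
theorem exists_law_lower_bound {d : ℕ} (hd : 1 ≤ d) {M₀ δ : ℝ} (φ : ℕ → ℝ≥0) (hM₀ : 1 ≤ M₀)
    (hδ : 0 < δ) :
    ∃ c : ℝ, 0 < c ∧ ∃ L : ℝ, 1 < L ∧ ∀ C : Conductance d, LocallyIrreducible C M₀ δ →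
      DominatedBy C φ → ∀ (x y : Lattice d) (R : ℝ), 1 ≤ R → eDist x y ≤ R → ∀ t : ℝ≥0,
        (t : ℝ) = R ^ 2 → ∀ S : Set (Lattice d), (∀ z, eDist x z < L * R → z ∈ S) →
        c / R ^ d ≤ (C.law x).real {ω | Y t ω = y ∧ (t : ℝ≥0∞) < exitTime S ω} := by
  classical
  obtain ⟨K, hK0, hK⟩ := exists_moment_bound hd φ
  have hK'0 : 0 ≤ (d : ℝ) ^ 2 * K + Real.exp 1 * 16 ^ d +
    (Real.exp (d * M₀) * 16 ^ d) ^ 2 / δ + 1 := by positivity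
  obtain ⟨b, hb, L, hL, hlow⟩ := killed_lower_bound hd hK'0
    (show 0 ≤ (d : ℝ) * M₀ by positivity)
  refine ⟨b * Real.exp (-K), by positivity, L, hL, fun C hC hφ x y R hR hxy t ht S hS => ?_⟩
  set r : ℝ := L * R with hr
  have hR0 : 0 < R := by linarith
  have hr0 : R ≤ r := by nlinarith
  -- The torus represents the ball of radius `r` with margins `R`, for long jumps, and `M₀ + 1`, for
  -- the chains of edges.
  obtain ⟨N, hN⟩ := exists_nat_gt (2 * (r + R + M₀ + 1))
  have hN0 : NeZero N := ⟨by rintro rfl; norm_num at hN; linarith⟩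
  have hKC := hK C hφ
  have hchain := torusChain_torusCond (C := C) (x := x) (N := N) (r := r) hd hK0 hM₀ hδ hC
    (fun F z => hKC z F) (by linarith) (by linarith)
  have hx : toLattice x (0 : Torus d N) = x := by
    funext i; simp [toLattice]
  have hy : toLattice x (toTorus N x y) = y := by
    refine toLattice_toTorus fun i => ?_
    have := (abs_sub_le_eDist x y i).trans hxy
    rw [abs_sub_comm] at this
    linarith
  have hty : tnorm (toTorus N x y - 0) ≤ d * R := by
    have h1 := tnorm_sub_le_eDist x 0 (toTorus N x y)
    rw [hx, hy, tnorm_sub_comm] at h1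
    exact h1.trans (by gcongr)
  have h1 := hlow N _ hchain R r hR (by linarith) le_rfl 0 (toTorus N x y) hty
  simp only [sub_zero] at h1
  set B : Set (Torus d N) := {z | tnorm z < r} with hB
  -- The rate `κ` makes up for the jumps to points which the torus does not represent.
  set κ : ℝ := K / R ^ 2 with hκ
  set G : Matrix (Torus d N) (Torus d N) ℝ :=
    killedGen (torusCond C x r) B + (-κ) • (1 : Matrix (Torus d N) (Torus d N) ℝ) with hG
  have hGne : ∀ u v, u ≠ v → G u v = killedGen (torusCond C x r) B u v := by
    intro u v huv
    simp [hG, Matrix.one_apply_ne huv]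
  have h2 := C.expMat_le_law (ι := toLattice x) (B := B) (G := G) (toLattice_injective x)
    (S := S) (fun u hu => hS _ ((eDist_toLattice_le x u).trans_lt hu))
    (fun u v huv => by
      rw [hGne u v huv]; exact killedGen_nonneg B torusCond_nonneg u v huv)
    (fun u hu => by
      have hu' : tnorm u < r := hu
      have h3 := nu_toLattice_le (C := C) (x := x) hR0 (fun F z => hKC z F) hu'.le
        (show 2 * (r + R) ≤ N by linarith)
      have h4 : ∑ v : Torus d N, (C.val (toLattice x u) (toLattice x v) : ℝ) ≤
          ∑ v, torusCond C x r u v := Finset.sum_le_sum fun v _ => val_le_torusCond u v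
      have h5 : torusCond C x r u u = 0 := by
        rw [torusCond_of_le hu'.le hu'.le, C.diag]; rfl
      have h6 : G u u = -∑ v, torusCond C x r u v - κ := by
        simp only [hG, Matrix.add_apply, Matrix.smul_apply, Matrix.one_apply_eq, killedGen_self,
          gen_apply_self, h5]
        simp [sub_eq_add_neg]
      rw [h6]
      linarith)
    (fun u hu v hv huv => by
      have hu' : tnorm u < r := hu
      have hv' : tnorm v < r := hv
      rw [hGne u v huv, killedGen_of_mem B huv hu hv, torusCond_of_le hu'.le hv'.le])
    (fun u hu v hv huv => by
      rw [hGne u v huv, killedGen_of_notMem B huv fun h => hv h.2])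
    (x := 0) (show tnorm (0 : Torus d N) < r by rw [tnorm_zero]; linarith) (toTorus N x y) t
  rw [hx, hy, hG, expMat_add_smul_one, ht, Matrix.smul_apply, smul_eq_mul] at h2
  have h3 : R ^ 2 * -κ = -K := by
    rw [hκ]; field_simp
  rw [h3] at h2
  refine le_trans ?_ h2
  calc b * Real.exp (-K) / R ^ d = Real.exp (-K) * (b / R ^ d) := by ring
    _ ≤ _ := by gcongr

end ConductanceChain

theorem proposition4p2 (d : ℕ) (ν₁ ν₂ M₀ δ : ℝ) (φ : ℕ → ℝ≥0)
    (hν₁ : 0 < ν₁) (hν₂ : 0 < ν₂) (hM₀ : 1 ≤ M₀) (hδ : 0 < δ) :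
    ∃ c : ℝ, 0 < c ∧ ∃ θ : ℝ, 0 < θ ∧ θ < 1 ∧
      ∀ C : ConductanceChain.Conductance d,
        ConductanceChain.TotalBounds C ν₁ ν₂ →
        ConductanceChain.LocallyIrreducible C M₀ δ →
        ConductanceChain.DominatedBy C φ →
        ∀ (x y : ConductanceChain.Lattice d) (t : ℝ≥0) (r : ℝ),
          1 ≤ t →
          ConductanceChain.eDist x y ≤ (t : ℝ) ^ (1 / 2 : ℝ) →
          (t : ℝ) ^ (1 / 2 : ℝ) / θ < r →
          c * (t : ℝ) ^ (-(d : ℝ) / 2) ≤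
            (C.law x).real {ω | ConductanceChain.Y t ω = y ∧
              (t : ℝ≥0∞) < ConductanceChain.exitTime (ConductanceChain.eBall x r) ω} := by
  rcases Nat.eq_zero_or_pos d with rfl | hd
  · -- There are no conductances in dimension `0`: the total conductance of the point vanishes.
    refine ⟨1, one_pos, 1 / 2, by norm_num, by norm_num, fun C => ?_⟩
    have h : ∀ y, C.val 0 y = 0 := fun y => by rw [Subsingleton.elim y 0, C.diag]
    exact absurd (C.pos 0) (by rw [tsum_congr h, tsum_zero]; exact lt_irrefl 0)
  · obtain ⟨c, hc, L, hL, h⟩ := ConductanceChain.exists_law_lower_bound hd φ hM₀ hδ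
    refine ⟨c, hc, L⁻¹, by positivity, inv_lt_one_of_one_lt₀ hL,
      fun C _ hC hφ x y t r ht hxy hr => ?_⟩
    have ht1 : (1 : ℝ) ≤ t := by exact_mod_cast ht
    have ht0 : (0 : ℝ) ≤ t := t.2
    have hR : (1 : ℝ) ≤ (t : ℝ) ^ (1 / 2 : ℝ) := Real.one_le_rpow ht1 (by norm_num)
    have hR2 : (t : ℝ) = ((t : ℝ) ^ (1 / 2 : ℝ)) ^ 2 := by
      rw [← Real.rpow_natCast, ← Real.rpow_mul ht0]; norm_num
    have h1 := h C hC hφ x y _ hR hxy t hR2 (ConductanceChain.eBall x r) fun z hz =>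
      hz.trans (by rwa [div_inv_eq_mul, mul_comm] at hr)
    refine le_trans (le_of_eq ?_) h1
    rw [← Real.rpow_natCast, ← Real.rpow_mul ht0, div_eq_mul_inv c, ← Real.rpow_neg ht0]
    congr 2
    ring
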